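/- **Theorem.** Let $\mathbb{k}$ be a field of characteristic zero and let $A=\bigoplus_{n\ge 0}A_n$ be a graded commutative algebra over $\mathbb{k}$ (commutative in the usual sense, without signs). Let $\mathcal{O}_A$ be the shuffle operad with components $\mathcal{O}_A(n)=A_{n-1}$ for $n\ge 1$, with unit $1\in A_0=\mathcal{O}_A(1)$, all of whose (shuffle) partial compositions $$\mathcal{O}_A(k)\otimes\mathcal{O}_A(l)=A_{k-1}\otimes A_{l-1}\to A_{k+l-2}=\mathcal{O}_A(k+l-1)$$ are given by the product of $A$. If the algebra $A$ is Koszul, then the operad $\mathcal{O}_A$ is Koszul. Here $A$ is called Koszul if it is connected ($A_0=\mathbb{k}$) and its bar homology $\mathrm{Tor}^A_{q,j}(\mathbb{k},\mathbb{k})$ (homological degree $q$, internal degree $j$) vanishes for $q\ne j$. For a shuffle operad $\mathcal{P}$ with $\mathcal{P}(1)=\mathbb{k}$, operations of arity $n$ are given weight $n-1$ (the weight grading for which binary generators have weight one). Such an operad is called Koszul if its bar homology is concentrated on the diagonal: for all $n\ge1$, the homology of the arity $n$ component of the bar complex of $\mathcal{P}$ (spanned by trees with $n$ labelled leaves, whose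 vertices have at least two inputs and are decorated by operations of $\mathcal{P}$, the homological degree being the number of vertices) vanishes in all homological degrees $q\ne n-1$. -/

import Mathlib

open scoped TensorProduct DirectSum

universe u v

/-! ### Vanishing of homology -/

/-- For a sequence of linear maps `d q : C (q + 1) → C q` (a complex in nonnegative homological
degrees), the homology in degree `q` vanishes: the kernel of the map leaving `C q` equals the image
of the map arriving at `C q`, where the map leaving `C 0` is zero. -/
def HomologyVanishesAt {k : Type u} [Field k] {C : ℕ → Type v} [∀ q, AddCommMonoid (C q)]
    [∀ q, Module k (C q)] (d : ∀ q, C (q + 1) →ₗ[k] C q) : ℕ → Prop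
  | 0 => Function.Surjective (d 0)
  | q + 1 => Function.Exact (d (q + 1)) (d q)

/-! ### The bar complex of a connected graded commutative algebra -/

namespace GradedBar

variable {k : Type u} {A : Type v} [Field k] [CommRing A] [Algebra k A]
  (𝒜 : ℕ → Submodule k A)

/-- The sequences `(i 0, …, i (q - 1))` of positive integers with sum `j`. -/
abbrev Index (q j : ℕ) : Type :=
  {i : Fin q → ℕ // (∀ t, 1 ≤ i t) ∧ ∑ t, i t = j}

/-- The component of internal degree `j` of the `q`-th tensor power of `A₊ = ⨁_{i ≥ 1} A_i`, that is
the direct sum of `A_{i 0} ⊗ ⋯ ⊗ A_{i (q-1)}` over all `i t ≥ 1` with sum `j`. -/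
abbrev Chains (j q : ℕ) : Type (max u v) :=
  ⨁ i : Index q j, ⨂[k] t, 𝒜 (i.1 t)

theorem sum_contractNth {q : ℕ} (t : Fin q) (i : Fin (q + 1) → ℕ) :
    ∑ s, Fin.contractNth t.castSucc (· + ·) i s = ∑ s, i s := by
  induction q with
  | zero => exact t.elim0
  | succ q ih =>
    induction t using Fin.cases with
    | zero =>
      rw [Fin.sum_univ_succ, Fin.sum_univ_succ (n := q + 1), Fin.sum_univ_succ (n := q)]
      simp [Fin.contractNth, add_assoc]
    | succ t =>
      rw [Fin.sum_univ_succ, Fin.sum_univ_succ (n := q + 1), ← ih t (fun s => i s.succ)]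
      congr 1
      apply Finset.sum_congr rfl
      intro s _
      simp [Fin.contractNth]

/-- Replace the neighbouring entries in positions `t`, `t + 1` by their sum. -/
def Index.merge {q j : ℕ} (i : Index (q + 1) j) (t : Fin q) : Index q j :=
  ⟨Fin.contractNth t.castSucc (· + ·) i.1, by
    intro s
    have h1 := i.2.1 s.castSucc
    have h2 := i.2.1 s.succ
    unfold Fin.contractNth
    split_ifs
    exacts [h1, le_add_right h1, h2], by
    rw [sum_contractNth]; exact i.2.2⟩

theorem coe_update {q : ℕ} {i : Fin q → ℕ} [DecidableEq (Fin q)] (a : ∀ s, 𝒜 (i s)) (r : Fin q)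
    (x : 𝒜 (i r)) (p : Fin q) :
    ((Function.update a r x p : 𝒜 (i p)) : A) = if p = r then (x : A) else (a p : A) := by
  by_cases h : p = r
  · subst h; simp
  · simp [h]

variable [GradedAlgebra 𝒜]

/-- Replace the neighbouring factors in positions `t`, `t + 1` by their product. -/
def mergeFun {q j : ℕ} (i : Index (q + 1) j) (t : Fin q) (a : ∀ s, 𝒜 (i.1 s)) :
    ∀ s, 𝒜 ((i.merge t).1 s) :=
  fun s => ⟨Fin.contractNth t.castSucc (· * ·) (fun r => (a r : A)) s, by
    simp only [Index.merge, Fin.contractNth]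
    split_ifs
    · exact (a _).2
    · exact SetLike.mul_mem_graded (a _).2 (a _).2
    · exact (a _).2⟩

/-- The position into which the factor in position `r` goes when the factors in positions `t` and
`t + 1` are multiplied. -/
def mergePos {q : ℕ} (t : Fin q) (r : Fin (q + 1)) : Fin q :=
  if h : (r : ℕ) ≤ t then ⟨r, by omega⟩ else ⟨r - 1, by omega⟩

theorem mergeFun_update {q j : ℕ} [DecidableEq (Fin (q + 1))] (i : Index (q + 1) j) (t : Fin q)
    (a : ∀ s, 𝒜 (i.1 s)) (r : Fin (q + 1)) (x : 𝒜 (i.1 r)) :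
    mergeFun 𝒜 i t (Function.update a r x) =
      Function.update (mergeFun 𝒜 i t a) (mergePos t r)
        (mergeFun 𝒜 i t (Function.update a r x) (mergePos t r)) := by
  funext s
  by_cases hs : s = mergePos t r
  · subst hs; simp
  · rw [Function.update_of_ne hs]
    apply Subtype.ext
    simp only [mergeFun, Fin.contractNth, coe_update]
    have h1 : (s : ℕ) ≠ mergePos t r := fun h => hs (Fin.ext h)
    unfold mergePos at h1
    split_ifs at h1 ⊢ <;> simp_all [Fin.ext_iff] <;> omega

theorem mergeFun_update_mergePos {q j : ℕ} [DecidableEq (Fin (q + 1))] (i : Index (q + 1) j)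
    (t : Fin q) (a : ∀ s, 𝒜 (i.1 s)) (r : Fin (q + 1)) :
    ∃ c : A, ∀ x : 𝒜 (i.1 r),
      (mergeFun 𝒜 i t (Function.update a r x) (mergePos t r) : A) = c * x := by
  simp only [mergeFun, Fin.contractNth, coe_update]
  rcases lt_trichotomy (r : ℕ) t with h | h | h
  · have h1 : (mergePos t r : ℕ) = r := by simp [mergePos, h.le]
    exact ⟨1, fun x => by simp [Fin.ext_iff, h1, h]⟩
  · have h1 : (mergePos t r : ℕ) = r := by simp [mergePos, h.le]
    exact ⟨a (mergePos t r).succ, fun x => by simp [Fin.ext_iff, h1, h, mul_comm]⟩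
  · have h1 : (mergePos t r : ℕ) = r - 1 := by simp [mergePos, not_le.2 h]
    rcases (Nat.succ_le_of_lt h).eq_or_lt with h2 | h2
    · have h3 : (r : ℕ) - 1 = t := by omega
      have h4 : (t : ℕ) + 1 = r := h2
      exact ⟨a (mergePos t r).castSucc, fun x => by simp [Fin.ext_iff, h1, h3, h4, h.ne]⟩
    · have h3 : ¬ (r : ℕ) - 1 < t := by omega
      have h4 : ¬ (r : ℕ) - 1 = t := by omega
      have h5 : (r : ℕ) - 1 + 1 = r := by omega
      exact ⟨1, fun x => by simp only [Fin.ext_iff, h1, Fin.val_castSucc, h3, h4, Fin.val_succ, h5,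
        if_true, if_false, one_mul]⟩

/-- The multilinear map `a_0 ⊗ ⋯ ⊗ a_q ↦ a_0 ⊗ ⋯ ⊗ a_t a_{t+1} ⊗ ⋯ ⊗ a_q`. -/
def mergeMulti {q j : ℕ} (i : Index (q + 1) j) (t : Fin q) :
    MultilinearMap k (fun s => 𝒜 (i.1 s)) (⨂[k] s, 𝒜 ((i.merge t).1 s)) where
  toFun a := PiTensorProduct.tprod k (mergeFun 𝒜 i t a)
  map_update_add' a r x y := by
    obtain ⟨c, hc⟩ := mergeFun_update_mergePos 𝒜 i t a r
    rw [mergeFun_update 𝒜 i t a r (x + y), mergeFun_update 𝒜 i t a r x,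
      mergeFun_update 𝒜 i t a r y, ← MultilinearMap.map_update_add]
    congr 2
    exact Subtype.ext (by simp [hc, mul_add])
  map_update_smul' a r b x := by
    obtain ⟨c, hc⟩ := mergeFun_update_mergePos 𝒜 i t a r
    rw [mergeFun_update 𝒜 i t a r (b • x), mergeFun_update 𝒜 i t a r x,
      ← MultilinearMap.map_update_smul]
    congr 2
    exact Subtype.ext (by simp [hc])

/-- The differential of the bar complex in internal degree `j`:
`d (a_0 ⊗ ⋯ ⊗ a_q) = ∑_{t < q} (-1)^t a_0 ⊗ ⋯ ⊗ a_t a_{t+1} ⊗ ⋯ ⊗ a_q`. -/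
noncomputable def d (j q : ℕ) : Chains 𝒜 j (q + 1) →ₗ[k] Chains 𝒜 j q :=
  DirectSum.toModule k (Index (q + 1) j) (Chains 𝒜 j q) fun i =>
    ∑ t : Fin q, ((-1 : k) ^ (t : ℕ)) •
      (DirectSum.lof k (Index q j) (fun i => ⨂[k] s, 𝒜 (i.1 s)) (i.merge t) ∘ₗ
        PiTensorProduct.lift (mergeMulti 𝒜 i t))

end GradedBar

/-- A graded commutative algebra is connected if `A_0` is the ground field. -/
def IsConnectedGraded {k : Type u} {A : Type v} [Field k] [CommRing A] [Algebra k A]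
    (𝒜 : ℕ → Submodule k A) : Prop :=
  Function.Injective (algebraMap k A) ∧ 𝒜 0 = 1

/-- A graded commutative algebra is Koszul if it is connected and its bar homology
`Tor^A_{q,j}(k, k)` (homological degree `q`, internal degree `j`) is concentrated on the diagonal
`q = j`. -/
def IsKoszulAlgebra {k : Type u} {A : Type v} [Field k] [CommRing A] [Algebra k A]
    (𝒜 : ℕ → Submodule k A) [GradedAlgebra 𝒜] : Prop :=
  IsConnectedGraded 𝒜 ∧ ∀ j q : ℕ, q ≠ j → HomologyVanishesAt (C := GradedBar.Chains 𝒜 j) (GradedBar.d 𝒜 j) q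

/-! ### Shuffle operads -/

/-- For a nonempty `J ⊆ I`, the set `(I \ J) ∪ {min J}` obtained from `I` by collapsing `J` to a
point, which is labelled by the minimum of `J`. -/
def collapse (I J : Finset ℕ) : Finset ℕ :=
  {x ∈ I | x ∈ J → ∀ y ∈ J, x ≤ y}

/-- A shuffle partial composition of operations of arities `m` and `l` into an operation of arity
`n`, encoded by the set `I` of its `n` inputs and the nonempty subset `J` of the `l` inputs of the
second operation: the first operation has the inputs `(I \ J) ∪ {min J}`, and the second one is
substituted into the input `min J`. If `I = {1, …, n}`, then `J` is the same thing as a shuffle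
`(i, σ)`, where `i = min J` is the slot used by `∘_{i,σ}` and the other elements of `J` determine the
shuffle `σ`. -/
structure ShuffleShape (I J : Finset ℕ) (m l n : ℕ) : Prop where
  nonempty : J.Nonempty
  subset : J ⊆ I
  card_outer : (collapse I J).card = m
  card_inner : J.card = l
  card_total : I.card = n

/-- A shuffle operad over `k`, given by its components `obj n` of arity `n ≥ 1`, its unit, and its
shuffle partial compositions. There are no operations without inputs: the type `obj 0` never enters
the structure and is a placeholder. -/
structure ShuffleOperad (k : Type u) [Field k] where
  obj : ℕ → Type v
  [addCommGroup : ∀ n, AddCommGroup (obj n)]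
  [module : ∀ n, Module k (obj n)]
  one : obj 1
  comp : ∀ {I J : Finset ℕ} {m l n : ℕ}, ShuffleShape I J m l n →
    (obj m →ₗ[k] obj l →ₗ[k] obj n)
  /-- Compositions depend only on the relative order of the labels. -/
  comp_relabel : ∀ {I J : Finset ℕ} {m l n : ℕ} (φ : ℕ → ℕ), StrictMonoOn φ I →
    ∀ (h : ShuffleShape I J m l n) (h' : ShuffleShape (I.image φ) (J.image φ) m l n),
      comp h' = comp h
  one_comp : ∀ {I : Finset ℕ} {n : ℕ} (h : ShuffleShape I I 1 n n) (a : obj n),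
    comp h one a = a
  comp_one : ∀ {I : Finset ℕ} {i n : ℕ} (h : ShuffleShape I {i} n 1 n) (a : obj n),
    comp h a one = a
  /-- Sequential composition. -/
  comp_assoc : ∀ {I J K : Finset ℕ} {m l n p q r : ℕ}
    (h₁ : ShuffleShape I J m l n) (h₂ : ShuffleShape J K p q l)
    (h₃ : ShuffleShape (collapse I K) (collapse J K) m p r) (h₄ : ShuffleShape I K r q n)
    (a : obj m) (b : obj p) (c : obj q),
      comp h₁ a (comp h₂ b c) = comp h₄ (comp h₃ a b) c
  /-- Parallel composition. -/
  comp_comm : ∀ {I J K : Finset ℕ} {m n p q r s : ℕ}, Disjoint J K →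
    ∀ (h₁ : ShuffleShape I J r p n) (h₂ : ShuffleShape (collapse I J) K m q r)
      (h₃ : ShuffleShape I K s q n) (h₄ : ShuffleShape (collapse I K) J m p s)
      (a : obj m) (b : obj p) (c : obj q),
        comp h₁ (comp h₂ a c) b = comp h₃ (comp h₄ a b) c

attribute [instance] ShuffleOperad.addCommGroup ShuffleOperad.module

/-! ### Trees -/

/-- A reduced rooted tree (all vertices have at least two inputs) with set of leaves `I`, encoded by
its set of vertices: a vertex is identified with the set of leaves above it. The family contains `I`
(the root) unless `I` is a single leaf, in which case the tree is degenerate and has no vertices. -/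
structure IsTree (I : Finset ℕ) (T : Finset (Finset ℕ)) : Prop where
  subset : ∀ S ∈ T, S ⊆ I
  two_le_card : ∀ S ∈ T, 2 ≤ S.card
  root_mem : 2 ≤ I.card → I ∈ T
  laminar : ∀ S ∈ T, ∀ R ∈ T, S ⊆ R ∨ R ⊆ S ∨ Disjoint S R

/-- The inputs of the vertex `S` of the tree `T`, each labelled by the smallest leaf above it: `x ∈ S`
labels an input if it is the minimum of every vertex strictly above `S` whose set of leaves contains
it. -/
def inputs (T : Finset (Finset ℕ)) (S : Finset ℕ) : Finset ℕ :=
  {x ∈ S | ∀ R ∈ T, R ⊂ S → x ∈ R → ∀ y ∈ R, x ≤ y}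

/-- `U` is the vertex of `T` to which the output of the vertex `S` is attached. -/
def IsParent (T : Finset (Finset ℕ)) (S U : Finset ℕ) : Prop :=
  U ∈ T ∧ S ⊂ U ∧ ∀ R ∈ T, S ⊂ R → U ⊆ R

theorem IsParent.unique {T : Finset (Finset ℕ)} {S U V : Finset ℕ} (hU : IsParent T S U)
    (hV : IsParent T S V) : U = V :=
  (hU.2.2 V hV.1 hV.2.1).antisymm (hV.2.2 U hU.1 hU.2.1)

namespace IsTree

variable {I : Finset ℕ} {T : Finset (Finset ℕ)} {S U : Finset ℕ}

theorem erase (hT : IsTree I T) (hS : S ≠ I) : IsTree I (T.erase S) where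
  subset R hR := hT.subset R (Finset.mem_of_mem_erase hR)
  two_le_card R hR := hT.two_le_card R (Finset.mem_of_mem_erase hR)
  root_mem h := Finset.mem_erase.2 ⟨hS.symm, hT.root_mem h⟩
  laminar R hR R' hR' :=
    hT.laminar R (Finset.mem_of_mem_erase hR) R' (Finset.mem_of_mem_erase hR')

theorem exists_parent (hT : IsTree I T) (hST : S ∈ T) (hS : S ≠ I) : ∃ U, IsParent T S U := by
  have hSI : S ⊂ I := (hT.subset S hST).ssubset_of_ne hS
  have hI : I ∈ T := hT.root_mem ((hT.two_le_card S hST).trans (Finset.card_le_card hSI.1))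
  obtain ⟨U, hU, hmin⟩ := Finset.exists_min_image (T.filter (S ⊂ ·)) Finset.card
    ⟨I, Finset.mem_filter.2 ⟨hI, hSI⟩⟩
  rw [Finset.mem_filter] at hU
  refine ⟨U, hU.1, hU.2, fun R hR hSR => ?_⟩
  rcases hT.laminar U hU.1 R hR with h | h | h
  · exact h
  · exact (Finset.eq_of_subset_of_card_le h (hmin R (Finset.mem_filter.2 ⟨hR, hSR⟩))).ge
  · obtain ⟨x, hx⟩ := Finset.card_pos.1 ((Nat.zero_lt_two).trans_le (hT.two_le_card S hST))
    exact absurd (hSR.1 hx) (Finset.disjoint_left.1 h (hU.2.1 hx))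

theorem inputs_erase (hT : IsTree I T) (hST : S ∈ T) (hU : U ∈ T) (h : ¬ IsParent T S U) :
    inputs (T.erase S) U = inputs T U := by
  ext x
  simp only [inputs, Finset.mem_filter]
  refine and_congr_right fun hxU => ⟨fun hx R hR hRU hxR => ?_, fun hx R hR =>
    hx R (Finset.mem_of_mem_erase hR)⟩
  by_cases hRS : R = S
  · subst hRS
    have : ∃ R' ∈ T, R ⊂ R' ∧ ¬ U ⊆ R' := by
      by_contra! hcon
      exact h ⟨hU, hRU, hcon⟩
    obtain ⟨R', hR', hRR', hUR'⟩ := this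
    have hR'U : R' ⊂ U := by
      rcases hT.laminar U hU R' hR' with h1 | h1 | h1
      · exact absurd h1 hUR'
      · exact ⟨h1, hUR'⟩
      · exact absurd (hRR'.1 hxR) (Finset.disjoint_left.1 h1 hxU)
    intro y hy
    exact hx R' (Finset.mem_erase.2 ⟨hRR'.ne', hR'⟩) hR'U (hRR'.1 hxR) y (hRR'.1 hy)
  · exact hx R (Finset.mem_erase.2 ⟨hRS, hR⟩) hRU hxR

theorem inputs_nonempty (hT : IsTree I T) (hST : S ∈ T) : (inputs T S).Nonempty := by
  obtain ⟨x, hx⟩ := Finset.card_pos.1 (Nat.zero_lt_two.trans_le (hT.two_le_card S hST))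
  obtain ⟨m, hm, hmin⟩ := S.exists_min_image id ⟨x, hx⟩
  exact ⟨m, Finset.mem_filter.2 ⟨hm, fun R _ h1 _ z hz => hmin z (h1.1 hz)⟩⟩

theorem ssubset_of_parent (hT : IsTree I T) (hU : IsParent T S U) (hST : S ∈ T) {R : Finset ℕ}
    (hR : R ∈ T) (hRS : R ≠ S) (hRU : R ⊂ U) {x : ℕ} (hxS : x ∈ S) (hxR : x ∈ R) : R ⊂ S := by
  rcases hT.laminar R hR S hST with h | h | h
  · exact h.ssubset_of_ne hRS
  · exact absurd (hU.2.2 R hR (h.ssubset_of_ne hRS.symm)) hRU.2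
  · exact absurd hxS (Finset.disjoint_left.1 h hxR)

/-- Contracting the edge between `S` and its parent `U` composes the operation at `U` with the
operation at `S`. -/
theorem shape_of_parent (hT : IsTree I T) (hST : S ∈ T) (hU : IsParent T S U) :
    ShuffleShape (inputs (T.erase S) U) (inputs T S)
      (inputs T U).card (inputs T S).card (inputs (T.erase S) U).card where
  nonempty := hT.inputs_nonempty hST
  subset := by
    intro x hx
    obtain ⟨hxS, hx⟩ := Finset.mem_filter.1 hx
    refine Finset.mem_filter.2 ⟨hU.2.1.1 hxS, fun R hR hRU hxR => ?_⟩
    obtain ⟨hRS, hR⟩ := Finset.mem_erase.1 hR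
    exact hx R hR (hT.ssubset_of_parent hU hST hR hRS hRU hxS hxR) hxR
  card_outer := by
    congr 1
    ext x
    refine Finset.mem_filter.trans (Iff.trans ?_ Finset.mem_filter.symm)
    simp only [inputs, Finset.mem_filter]
    constructor
    · rintro ⟨⟨hxU, hx⟩, hx'⟩
      refine ⟨hxU, fun R hR hRU hxR => ?_⟩
      by_cases hRS : R = S
      · subst hRS
        have hxin : x ∈ R ∧ ∀ R' ∈ T, R' ⊂ R → x ∈ R' → ∀ y ∈ R', x ≤ y :=
          ⟨hxR, fun R' hR' h1 h2 =>
            hx R' (Finset.mem_erase.2 ⟨h1.ne, hR'⟩) (h1.trans hRU) h2⟩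
        intro y hy
        obtain ⟨m, hm, hmin⟩ := R.exists_min_image id ⟨y, hy⟩
        exact (hx' hxin m ⟨hm, fun R' _ h1 _ z hz => hmin z (h1.1 hz)⟩).trans (hmin y hy)
      · exact hx R (Finset.mem_erase.2 ⟨hRS, hR⟩) hRU hxR
    · rintro ⟨hxU, hx⟩
      exact ⟨⟨hxU, fun R hR => hx R (Finset.mem_of_mem_erase hR)⟩, fun h y hy =>
        hx S hST hU.2.1 h.1 y hy.1⟩
  card_inner := rfl
  card_total := rfl

end IsTree

/-! ### The bar complex of a connected shuffle operad -/

namespace ShuffleOperad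

variable {k : Type u} [Field k] (P : ShuffleOperad.{u, v} k)

/-- A shuffle operad is connected if its component of arity one is spanned by the unit `one ≠ 0`, so
that its augmentation ideal consists of all operations of arity at least two. -/
def IsConnected : Prop :=
  Function.Bijective fun c : k => c • P.one

/-- The identification of two components of equal arity. -/
def castArity {m n : ℕ} (h : m = n) : P.obj m →ₗ[k] P.obj n :=
  h ▸ LinearMap.id

/-- The component at the tree `T` of the cofree shuffle cooperad on the augmentation ideal: the
tensor product over all vertices `S` of `T` of the components of `P` of arity the number of inputs
of `S`. -/
abbrev TreeTensor (T : Finset (Finset ℕ)) : Type (max u v) :=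
  ⨂[k] S : {S // S ∈ T}, P.obj (inputs T S.1).card

open Classical in
/-- Contraction of the edge connecting the vertex `S` to its parent `U`: the decoration of `U` is
replaced by its composition with the decoration of `S`, and the decorations of all vertices other
than `U` and `S` are unchanged. -/
noncomputable def contractFun {I : Finset ℕ} {T : Finset (Finset ℕ)} {S : Finset ℕ}
    (hT : IsTree I T) (hST : S ∈ T) (a : ∀ R : {R // R ∈ T}, P.obj (inputs T R.1).card) :
    ∀ U : {U // U ∈ T.erase S}, P.obj (inputs (T.erase S) U.1).card := fun U =>
  if h : IsParent T S U.1 then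
    P.comp (hT.shape_of_parent hST h) (a ⟨U.1, Finset.mem_of_mem_erase U.2⟩) (a ⟨S, hST⟩)
  else
    P.castArity
      (congrArg Finset.card (hT.inputs_erase hST (Finset.mem_of_mem_erase U.2) h).symm)
      (a ⟨U.1, Finset.mem_of_mem_erase U.2⟩)

theorem contractFun_update {I : Finset ℕ} {T : Finset (Finset ℕ)} {S : Finset ℕ}
    [DecidableEq {R // R ∈ T}] [DecidableEq {R // R ∈ T.erase S}]
    (hT : IsTree I T) (hST : S ∈ T) (hS : S ≠ I) (R : {R // R ∈ T}) :
    ∃ U₀ : {U // U ∈ T.erase S}, ∀ a : ∀ R : {R // R ∈ T}, P.obj (inputs T R.1).card,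
      ∃ L : P.obj (inputs T R.1).card →ₗ[k] P.obj (inputs (T.erase S) U₀.1).card,
        ∀ x, P.contractFun hT hST (Function.update a R x) =
          Function.update (P.contractFun hT hST a) U₀ (L x) := by
  obtain ⟨U, hU⟩ := hT.exists_parent hST hS
  have hUT : U ∈ T.erase S := Finset.mem_erase.2 ⟨hU.2.1.ne', hU.1⟩
  by_cases hRS : R = ⟨S, hST⟩
  · subst hRS
    refine ⟨⟨U, hUT⟩, fun a => ⟨P.comp (hT.shape_of_parent hST hU) (a ⟨U, hU.1⟩), fun x => ?_⟩⟩
    funext V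
    by_cases hV : V = ⟨U, hUT⟩
    · subst hV
      have hne : (⟨U, hU.1⟩ : {R // R ∈ T}) ≠ ⟨S, hST⟩ :=
        fun h => hU.2.1.ne' (congrArg Subtype.val h)
      simp [contractFun, hU, Function.update_of_ne hne]
    · have hVp : ¬ IsParent T S V.1 := fun h => hV (Subtype.ext (h.unique hU))
      have hne : (⟨V.1, Finset.mem_of_mem_erase V.2⟩ : {R // R ∈ T}) ≠ ⟨S, hST⟩ :=
        fun h => (Finset.mem_erase.1 V.2).1 (congrArg Subtype.val h)
      rw [Function.update_of_ne hV]
      simp [contractFun, hVp, Function.update_of_ne hne]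
  · have hRS' : R.1 ≠ S := fun h => hRS (Subtype.ext h)
    refine ⟨⟨R.1, Finset.mem_erase.2 ⟨hRS', R.2⟩⟩, fun a => ?_⟩
    have key : ∀ x, ∀ V : {U // U ∈ T.erase S}, V ≠ ⟨R.1, Finset.mem_erase.2 ⟨hRS', R.2⟩⟩ →
        P.contractFun hT hST (Function.update a R x) V = P.contractFun hT hST a V := by
      intro x V hV
      have h1 : (⟨V.1, Finset.mem_of_mem_erase V.2⟩ : {R // R ∈ T}) ≠ R :=
        fun h => hV (by
          have h2 : V.1 = R.1 := congrArg Subtype.val h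
          exact Subtype.ext h2)
      simp [contractFun, Function.update_of_ne h1, Function.update_of_ne (Ne.symm hRS)]
    by_cases hp : IsParent T S R.1
    · refine ⟨(P.comp (hT.shape_of_parent hST hp)).flip (a ⟨S, hST⟩), fun x => ?_⟩
      funext V
      by_cases hV : V = ⟨R.1, Finset.mem_erase.2 ⟨hRS', R.2⟩⟩
      · subst hV
        simp [contractFun, hp, Function.update_of_ne (Ne.symm hRS)]
      · rw [Function.update_of_ne hV, key x V hV]
    · refine ⟨P.castArity (congrArg Finset.card (hT.inputs_erase hST R.2 hp).symm), fun x => ?_⟩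
      funext V
      by_cases hV : V = ⟨R.1, Finset.mem_erase.2 ⟨hRS', R.2⟩⟩
      · subst hV
        simp [contractFun, hp]
      · rw [Function.update_of_ne hV, key x V hV]

/-- `contractFun` followed by the universal multilinear map. -/
noncomputable def contractMulti {I : Finset ℕ} {T : Finset (Finset ℕ)} {S : Finset ℕ}
    (hT : IsTree I T) (hST : S ∈ T) (hS : S ≠ I) :
    MultilinearMap k (fun R : {R // R ∈ T} => P.obj (inputs T R.1).card)
      (P.TreeTensor (T.erase S)) where
  toFun a := PiTensorProduct.tprod k (P.contractFun hT hST a)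
  map_update_add' a R x y := by
    obtain ⟨U₀, h⟩ := P.contractFun_update hT hST hS R
    obtain ⟨L, h⟩ := h a
    rw [h, h, h, map_add, MultilinearMap.map_update_add]
  map_update_smul' a R c x := by
    obtain ⟨U₀, h⟩ := P.contractFun_update hT hST hS R
    obtain ⟨L, h⟩ := h a
    rw [h, h, map_smul, MultilinearMap.map_update_smul]

/-- The trees with set of leaves `I` and `q` vertices. -/
abbrev TreeIndex (I : Finset ℕ) (q : ℕ) : Type :=
  {T : Finset (Finset ℕ) // IsTree I T ∧ T.card = q}

/-- The part of homological degree `q` of the bar complex with set of inputs `I`: the direct sum over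
all trees with `q` vertices. The vertices carry the degree shift, hence are odd; the tree is
oriented by listing its vertices in the colexicographic order of their sets of leaves. -/
abbrev Chains (I : Finset ℕ) (q : ℕ) : Type (max u v) :=
  ⨁ T : TreeIndex I q, P.TreeTensor T.1

/-- Remove the vertex `S`, that is contract the edge connecting it to its parent. -/
def TreeIndex.contract {I : Finset ℕ} {q : ℕ} (T : TreeIndex I (q + 1))
    (S : {S // S ∈ T.1.erase I}) : TreeIndex I q :=
  ⟨T.1.erase S.1, T.2.1.erase (Finset.ne_of_mem_erase S.2), by
    rw [Finset.card_erase_of_mem (Finset.mem_of_mem_erase S.2), T.2.2]; rfl⟩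

open Classical in
/-- The differential of the bar complex: the sum over all inner edges of a tree (equivalently, all
vertices `S` other than the root) of the contractions of the edge, with the sign `(-1)^p` where `p`
is the number of vertices preceding `S` in the chosen order. This is the Koszul sign for moving the
odd symbol of `S` next to the symbol of its parent and replacing these two symbols by one. -/
noncomputable def barD (I : Finset ℕ) (q : ℕ) : P.Chains I (q + 1) →ₗ[k] P.Chains I q :=
  DirectSum.toModule k (TreeIndex I (q + 1)) (P.Chains I q) fun T =>
    ∑ S : {S // S ∈ T.1.erase I},
      ((-1 : k) ^ (T.1.filter fun R => toColex R < toColex S.1).card) •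
        (DirectSum.lof k (TreeIndex I q) (fun T => P.TreeTensor T.1) (T.contract S) ∘ₗ
          PiTensorProduct.lift (P.contractMulti T.2.1 (Finset.mem_of_mem_erase S.2)
            (Finset.ne_of_mem_erase S.2)))

/-- A shuffle operad is Koszul (with generators of arity two, so that operations of arity `n` have
weight `n - 1`) if it is connected and its bar homology is concentrated on the diagonal: in arity
`n ≥ 1`, that is in weight `n - 1`, the homology of the bar complex vanishes in all homological
degrees `q ≠ n - 1`. -/
def IsKoszul : Prop :=
  P.IsConnected ∧ ∀ n q : ℕ, 1 ≤ n → q ≠ n - 1 →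
    HomologyVanishesAt (C := P.Chains (Finset.Icc 1 n)) (P.barD (Finset.Icc 1 n)) q

end ShuffleOperad

/-! ### The operad of a graded commutative algebra -/

theorem ShuffleShape.degree_add {I J : Finset ℕ} {m l n : ℕ} (h : ShuffleShape I J m l n) :
    m - 1 + (l - 1) = n - 1 := by
  obtain ⟨x, hx, hmin⟩ := J.exists_min_image id h.nonempty
  have h1 : collapse I J = insert x (I \ J) := by
    ext y
    simp only [collapse, Finset.mem_filter, Finset.mem_insert, Finset.mem_sdiff]
    constructor
    · rintro ⟨hyI, hy⟩
      by_cases hyJ : y ∈ J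
      · exact Or.inl (le_antisymm (hy hyJ x hx) (hmin y hyJ))
      · exact Or.inr ⟨hyI, hyJ⟩
    · rintro (rfl | ⟨h1, h2⟩)
      · exact ⟨h.subset hx, fun _ z hz => hmin z hz⟩
      · exact ⟨h1, fun h3 => absurd h3 h2⟩
  have h2 := h.card_outer
  rw [h1, Finset.card_insert_of_notMem (by simp [hx]), Finset.card_sdiff_of_subset h.subset,
    h.card_inner, h.card_total] at h2
  have h3 := Finset.card_le_card h.subset
  have h4 := Finset.card_pos.2 h.nonempty
  rw [h.card_inner] at h3 h4
  rw [h.card_total] at h3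
  omega

/-- The shuffle operad `O_A` of a graded commutative algebra `A`: its component of arity `n ≥ 1` is
`A_{n-1}`, its unit is `1 ∈ A_0`, and all its shuffle partial compositions are given by the product
of `A`. -/
def operadOfAlgebra {k : Type u} {A : Type v} [Field k] [CommRing A] [Algebra k A]
    (𝒜 : ℕ → Submodule k A) [GradedAlgebra 𝒜] : ShuffleOperad.{u, v} k where
  obj n := 𝒜 (n - 1)
  one := ⟨1, SetLike.GradedOne.one_mem (A := 𝒜)⟩
  comp h := LinearMap.mk₂ k
    (fun a b => ⟨a * b, h.degree_add ▸ SetLike.mul_mem_graded a.2 b.2⟩)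
    (fun _ _ _ => Subtype.ext (add_mul _ _ _))
    (fun _ _ _ => Subtype.ext (smul_mul_assoc _ _ _))
    (fun _ _ _ => Subtype.ext (mul_add _ _ _))
    (fun _ _ _ => Subtype.ext (mul_smul_comm _ _ _))
  comp_relabel _ _ _ _ := rfl
  one_comp _ _ := Subtype.ext (one_mul _)
  comp_one _ _ := Subtype.ext (mul_one _)
  comp_assoc _ _ _ _ _ _ _ := Subtype.ext (mul_assoc _ _ _).symm
  comp_comm _ _ _ _ _ _ _ _ := Subtype.ext (mul_right_comm _ _ _)

/-! ### Tensor products of homogeneous components and multiplication along the fibres of a map -/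

namespace GradedTensor

section

variable {k : Type u} {A : Type v} [Field k] [CommRing A] [Algebra k A]
  (𝒜 : ℕ → Submodule k A)
variable {ι ι' ι'' κ κ' : Type*}

open Classical in
/-- The degree function `s'` is the sum of the degree function `s` over the fibres of `g`. -/
def DegEq [Fintype ι] (g : ι → ι') (s : ι → ℕ) (s' : ι' → ℕ) : Prop :=
  ∀ j, (∑ i with g i = j, s i) = s' j

theorem degEq_iff [Fintype ι] [DecidableEq ι'] {g : ι → ι'} {s : ι → ℕ} {s' : ι' → ℕ} :
    DegEq g s s' ↔ ∀ j, (∑ i with g i = j, s i) = s' j := by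
  unfold DegEq
  congr!

open Classical in
theorem DegEq.comp [Fintype ι] [Fintype ι'] {g : ι → ι'} {g' : ι' → ι''} {s : ι → ℕ}
    {s' : ι' → ℕ} {s'' : ι'' → ℕ} (h : DegEq g s s') (h' : DegEq g' s' s'') :
    DegEq (g' ∘ g) s s'' := by
  intro l
  rw [← h' l, ← Finset.sum_congr rfl (fun j _ => h j)]
  rw [← Finset.sum_fiberwise_of_maps_to (s := Finset.univ.filter fun i => (g' ∘ g) i = l)
    (t := Finset.univ.filter fun j => g' j = l) (g := g) (by simp)]
  refine Finset.sum_congr rfl fun j hj => Finset.sum_congr ?_ fun _ _ => rfl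
  ext i
  simp only [Finset.mem_filter, Finset.mem_univ, true_and] at hj ⊢
  constructor
  · exact fun h => h.2
  · rintro rfl; exact ⟨hj, rfl⟩

open Classical in
/-- The degree function on the target of `g` obtained by summing over fibres. -/
noncomputable def pushDeg [Fintype ι] (g : ι → ι') (s : ι → ℕ) : ι' → ℕ :=
  fun j => ∑ i with g i = j, s i

theorem degEq_pushDeg [Fintype ι] (g : ι → ι') (s : ι → ℕ) : DegEq g s (pushDeg g s) :=
  fun _ => rfl

theorem DegEq.unique [Fintype ι] {g : ι → ι'} {s : ι → ℕ} {s₁ s₂ : ι' → ℕ} (h₁ : DegEq g s s₁)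
    (h₂ : DegEq g s s₂) : s₁ = s₂ :=
  funext fun j => (h₁ j).symm.trans (h₂ j)

/-- If `g'` factors through `g`, then the degrees are compatible with the factorization. -/
theorem DegEq.of_comp [Fintype ι] [Fintype ι'] {g : ι → ι'} {g' : ι' → ι''} {s : ι → ℕ}
    {s' : ι' → ℕ} {s'' : ι'' → ℕ} (h : DegEq g s s') (h' : DegEq (g' ∘ g) s s'') :
    DegEq g' s' s'' := by
  have := (h.comp (degEq_pushDeg g' s')).unique h'
  rw [← this]
  exact degEq_pushDeg g' s'

theorem degEq_of_bijective [Fintype ι] {e : ι → ι'} (he : Function.Bijective e) {s : ι → ℕ}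
    {s' : ι' → ℕ} (h : ∀ i, s' (e i) = s i) : DegEq e s s' := by
  classical
  refine degEq_iff.2 fun j => ?_
  obtain ⟨i, rfl⟩ := he.2 j
  rw [h i]
  rw [Finset.sum_filter]
  simp [he.1.eq_iff]

theorem degEq_id [Fintype ι] {s s' : ι → ℕ} (h : ∀ i, s' i = s i) : DegEq id s s' :=
  degEq_of_bijective Function.bijective_id h

theorem DegEq.sumMap_id [Fintype ι] [Fintype κ] {g : ι → ι'} {s : ι → ℕ} {s' : ι' → ℕ}
    (h : DegEq g s s') (r : κ → ℕ) :
    DegEq (Sum.map g (id : κ → κ)) (Sum.elim s r) (Sum.elim s' r) := by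
  classical
  refine degEq_iff.2 fun j => ?_
  rw [Finset.sum_filter, Fintype.sum_sum_type]
  rcases j with j | j
  · simp [← degEq_iff.1 h j, Finset.sum_filter]
  · simp

theorem DegEq.sumMap_id_left [Fintype ι] [Fintype κ] {g : ι → ι'} {s : ι → ℕ} {s' : ι' → ℕ}
    (h : DegEq g s s') (r : κ → ℕ) :
    DegEq (Sum.map (id : κ → κ) g) (Sum.elim r s) (Sum.elim r s') := by
  classical
  refine degEq_iff.2 fun j => ?_
  rw [Finset.sum_filter, Fintype.sum_sum_type]
  rcases j with j | j
  · simp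
  · simp [← degEq_iff.1 h j, Finset.sum_filter]

/-- The tensor product of homogeneous components of `A`, of degrees prescribed by `s`. -/
abbrev GTensor (s : ι → ℕ) : Type _ := ⨂[k] i, 𝒜 (s i)

theorem linearMap_ext {M : Type*} [AddCommMonoid M] [Module k M] {s : ι → ℕ}
    {f f' : GTensor 𝒜 s →ₗ[k] M}
    (h : ∀ a, f (PiTensorProduct.tprod k a) = f' (PiTensorProduct.tprod k a)) : f = f' :=
  PiTensorProduct.ext (MultilinearMap.ext h)

variable [GradedAlgebra 𝒜]

open Classical in
/-- Multiplication of homogeneous elements along the fibres of `g`. -/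
noncomputable def prodFun [Fintype ι] {g : ι → ι'} {s : ι → ℕ} {s' : ι' → ℕ} (h : DegEq g s s')
    (a : ∀ i, 𝒜 (s i)) (j : ι') : 𝒜 (s' j) :=
  ⟨∏ i with g i = j, (a i : A), by
    have := SetLike.prod_mem_graded 𝒜 s (fun i => (a i : A))
      (F := Finset.univ.filter fun i => g i = j) (fun i _ => (a i).2)
    rw [← h j]
    exact this⟩

theorem coe_prodFun [Fintype ι] [DecidableEq ι'] {g : ι → ι'} {s : ι → ℕ} {s' : ι' → ℕ}
    (h : DegEq g s s') (a : ∀ i, 𝒜 (s i)) (j : ι') :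
    (prodFun 𝒜 h a j : A) = ∏ i with g i = j, (a i : A) := by
  unfold prodFun
  dsimp only
  congr!

theorem exists_prodFun_update [Fintype ι] [DecidableEq ι] [DecidableEq ι'] {g : ι → ι'}
    {s : ι → ℕ} {s' : ι' → ℕ} (h : DegEq g s s') (a : ∀ i, 𝒜 (s i)) (r : ι) :
    ∃ c : A, ∀ x : 𝒜 (s r), ∃ y : 𝒜 (s' (g r)), (y : A) = c * x ∧
      prodFun 𝒜 h (Function.update a r x) = Function.update (prodFun 𝒜 h a) (g r) y := by
  classical
  refine ⟨∏ i ∈ (Finset.univ.filter fun i => g i = g r).erase r, (a i : A), fun x =>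
    ⟨prodFun 𝒜 h (Function.update a r x) (g r), ?_, ?_⟩⟩
  · rw [coe_prodFun, ← Finset.prod_erase_mul (a := r) _ _ (by simp)]
    simp only [Function.update_self]
    congr 1
    refine Finset.prod_congr rfl fun i hi => ?_
    rw [Function.update_of_ne (Finset.ne_of_mem_erase hi)]
  · funext j
    by_cases hj : j = g r
    · subst hj; simp
    · rw [Function.update_of_ne hj]
      apply Subtype.ext
      rw [coe_prodFun, coe_prodFun]
      refine Finset.prod_congr rfl fun i hi => ?_
      rw [Function.update_of_ne]
      rintro rfl
      exact hj (Finset.mem_filter.1 hi).2.symm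

/-- The linear map that multiplies tensor factors along the fibres of `g`. -/
noncomputable def mulMap [Fintype ι] {g : ι → ι'} {s : ι → ℕ} {s' : ι' → ℕ} (h : DegEq g s s') :
    GTensor 𝒜 s →ₗ[k] GTensor 𝒜 s' :=
  PiTensorProduct.lift
    { toFun := fun a => PiTensorProduct.tprod k (prodFun 𝒜 h a)
      map_update_add' := by
        intro _ a r x y
        classical
        obtain ⟨c, hc⟩ := exists_prodFun_update 𝒜 h a r
        obtain ⟨x', hx', hx⟩ := hc x
        obtain ⟨y', hy', hy⟩ := hc y
        obtain ⟨z', hz', hz⟩ := hc (x + y)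
        have : z' = x' + y' := Subtype.ext (by simp [hx', hy', hz', mul_add])
        rw [hx, hy, hz, this, MultilinearMap.map_update_add]
      map_update_smul' := by
        intro _ a r b x
        classical
        obtain ⟨c, hc⟩ := exists_prodFun_update 𝒜 h a r
        obtain ⟨x', hx', hx⟩ := hc x
        obtain ⟨z', hz', hz⟩ := hc (b • x)
        have : z' = b • x' := Subtype.ext (by simp [hx', hz'])
        rw [hx, hz, this, MultilinearMap.map_update_smul] }

@[simp]
theorem mulMap_tprod [Fintype ι] {g : ι → ι'} {s : ι → ℕ} {s' : ι' → ℕ} (h : DegEq g s s')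
    (a : ∀ i, 𝒜 (s i)) :
    mulMap 𝒜 h (PiTensorProduct.tprod k a) = PiTensorProduct.tprod k (prodFun 𝒜 h a) := by
  simp [mulMap]

theorem mulMap_comp [Fintype ι] [Fintype ι'] {g : ι → ι'} {g' : ι' → ι''} {s : ι → ℕ}
    {s' : ι' → ℕ} {s'' : ι'' → ℕ} (h : DegEq g s s') (h' : DegEq g' s' s'')
    {f : ι → ι''} (hf : DegEq f s s'') (hfg : g' ∘ g = f) (w : GTensor 𝒜 s) :
    mulMap 𝒜 h' (mulMap 𝒜 h w) = mulMap 𝒜 hf w := by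
  subst hfg
  rw [← LinearMap.comp_apply]
  congr 1
  refine linearMap_ext 𝒜 fun a => ?_
  simp only [LinearMap.comp_apply, mulMap_tprod]
  congr 1
  funext l
  classical
  apply Subtype.ext
  simp only [coe_prodFun]
  rw [← Finset.prod_fiberwise_of_maps_to (s := Finset.univ.filter fun i => (g' ∘ g) i = l)
    (t := Finset.univ.filter fun j => g' j = l) (g := g) (by simp)]
  refine Finset.prod_congr rfl fun j hj => Finset.prod_congr ?_ fun _ _ => rfl
  ext i
  simp only [Finset.mem_filter, Finset.mem_univ, true_and] at hj ⊢
  constructor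
  · rintro rfl; exact ⟨hj, rfl⟩
  · exact fun h => h.2

theorem mulMap_id [Fintype ι] {s : ι → ℕ} {g : ι → ι} (hg : g = id) (h : DegEq g s s)
    (w : GTensor 𝒜 s) : mulMap 𝒜 h w = w := by
  subst hg
  suffices mulMap 𝒜 h = LinearMap.id by rw [this]; rfl
  refine linearMap_ext 𝒜 fun a => ?_
  simp only [mulMap_tprod, LinearMap.id_apply]
  congr 1
  funext l
  classical
  apply Subtype.ext
  rw [coe_prodFun]
  simp [Finset.prod_filter]

/-- Multiplication along a map identifying more points vanishes on what a coarser multiplication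
kills. -/
theorem mulMap_eq_zero_of_factor [Fintype ι] [Fintype ι'] {g : ι → ι'} {g' : ι → ι''} {s : ι → ℕ}
    {s' : ι' → ℕ} {s'' : ι'' → ℕ} (h : DegEq g s s') (h' : DegEq g' s s'') (f : ι' → ι'')
    (hf : f ∘ g = g') {w : GTensor 𝒜 s} (hw : mulMap 𝒜 h w = 0) : mulMap 𝒜 h' w = 0 := by
  subst hf
  rw [← mulMap_comp 𝒜 h (h.of_comp h') h' rfl, hw, map_zero]

/-- Reindexing along a bijection is invertible. -/
theorem mulMap_bijective [Fintype ι] [Fintype ι'] {e : ι → ι'} (he : Function.Bijective e)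
    {s : ι → ℕ} {s' : ι' → ℕ} (h : DegEq e s s') : Function.Bijective (mulMap 𝒜 h) := by
  obtain ⟨f, hf1, hf2⟩ := Function.bijective_iff_has_inverse.1 he
  have h1 : f ∘ e = id := funext hf1
  have h2 : e ∘ f = id := funext hf2
  have h' : DegEq f s' s := h.of_comp (by rw [h1]; exact degEq_id fun _ => rfl)
  refine Function.bijective_iff_has_inverse.2 ⟨mulMap 𝒜 h', fun w => ?_, fun w => ?_⟩
  · rw [mulMap_comp 𝒜 h h' (degEq_id fun _ => rfl) h1, mulMap_id 𝒜 rfl]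
  · rw [mulMap_comp 𝒜 h' h (degEq_id fun _ => rfl) h2, mulMap_id 𝒜 rfl]

open Classical in
/-- The product of the factors in the positions `p` and `q` kills the tensor `w`. -/
def Killed [Fintype ι] {s : ι → ℕ} (w : GTensor 𝒜 s) (p q : ι) : Prop :=
  mulMap 𝒜 (degEq_pushDeg (Function.update id p q) s) w = 0

theorem killed_iff [Fintype ι] [inst : DecidableEq ι] {s : ι → ℕ} {w : GTensor 𝒜 s} {p q : ι} :
    Killed 𝒜 w p q ↔ mulMap 𝒜 (degEq_pushDeg (Function.update id p q) s) w = 0 := by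
  obtain rfl : inst = fun a b => Classical.propDecidable (a = b) := Subsingleton.elim _ _
  rfl

theorem Killed.mulMap_eq_zero [Fintype ι] {s : ι → ℕ} {w : GTensor 𝒜 s} {p q : ι}
    (hw : Killed 𝒜 w p q) {g : ι → ι'} (hg : g p = g q) {s' : ι' → ℕ} (h : DegEq g s s') :
    mulMap 𝒜 h w = 0 := by
  classical
  refine mulMap_eq_zero_of_factor 𝒜 _ h g ?_ hw
  funext i
  by_cases hi : i = p
  · subst hi; simp [hg]
  · simp [Function.update_of_ne hi]

theorem killed_of_mulMap_eq_zero [Fintype ι] [Fintype ι'] {s : ι → ℕ} {w : GTensor 𝒜 s} {p q : ι}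
    {g : ι → ι'} {s' : ι' → ℕ} (h : DegEq g s s') (hw : mulMap 𝒜 h w = 0)
    (hg : ∀ i j, g i = g j → i = j ∨ (i = p ∧ j = q) ∨ (i = q ∧ j = p)) : Killed 𝒜 w p q := by
  classical
  obtain ⟨f, hf⟩ : ∃ f : ι' → ι, f ∘ g = Function.update id p q := by
    refine ⟨fun j => if hj : ∃ i, g i = j then Function.update id p q hj.choose else p, ?_⟩
    funext i
    have hj : ∃ i', g i' = g i := ⟨i, rfl⟩
    simp only [Function.comp_apply, dif_pos hj]
    rcases hg _ _ hj.choose_spec with h | ⟨h1, h2⟩ | ⟨h1, h2⟩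
    · rw [h]
    · rw [h1, h2]; by_cases hqp : q = p <;> simp [hqp]
    · rw [h1, h2]; by_cases hqp : q = p <;> simp [hqp]
  exact mulMap_eq_zero_of_factor 𝒜 h _ f hf hw

theorem killed_of_bijective [Fintype ι] [Fintype ι'] {e : ι → ι'} (he : Function.Bijective e)
    {s : ι → ℕ} {s' : ι' → ℕ} (h : DegEq e s s') {w : GTensor 𝒜 s} {p q : ι} :
    Killed 𝒜 (mulMap 𝒜 h w) (e p) (e q) ↔ Killed 𝒜 w p q := by
  classical
  obtain ⟨f, hf1, hf2⟩ := Function.bijective_iff_has_inverse.1 he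
  constructor
  · intro hw
    have h1 := degEq_pushDeg (Function.update id (e p) (e q)) s'
    refine killed_of_mulMap_eq_zero 𝒜 (h.comp h1)
      (by rw [← mulMap_comp 𝒜 h h1 _ rfl]; exact hw) fun i j hij => ?_
    simp only [Function.comp_apply, Function.update_apply, id, he.1.eq_iff] at hij
    split_ifs at hij with h1 h2 h2 <;> simp_all [he.1.eq_iff]
  · intro hw
    have h1 := degEq_pushDeg (Function.update id (e p) (e q)) s'
    unfold Killed
    rw [mulMap_comp 𝒜 h h1 (h.comp h1) rfl]
    refine hw.mulMap_eq_zero 𝒜 ?_ (h.comp h1)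
    by_cases hqp : q = p <;> simp [hqp, he.1.eq_iff]

end

end GradedTensor

/-! ### Tensoring with spectator factors -/

namespace GradedTensor

section

variable {k : Type u} {A : Type v} [Field k] [CommRing A] [Algebra k A]
  (𝒜 : ℕ → Submodule k A)
variable {ι ι' ι'' κ κ' : Type*}

/-- Splitting the tensor factors into two groups. -/
noncomputable def split (s : ι → ℕ) (r : κ → ℕ) :
    GTensor 𝒜 s ⊗[k] GTensor 𝒜 r ≃ₗ[k] GTensor 𝒜 (Sum.elim s r) :=
  PiTensorProduct.tmulEquivDep k (fun i : ι ⊕ κ => 𝒜 (Sum.elim s r i))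

theorem split_tmul (s : ι → ℕ) (r : κ → ℕ) (a : ∀ i, 𝒜 (s i)) (b : ∀ i, 𝒜 (r i)) :
    split 𝒜 s r (PiTensorProduct.tprod k a ⊗ₜ PiTensorProduct.tprod k b) =
      PiTensorProduct.tprod k (fun i : ι ⊕ κ =>
        (Sum.rec a b i : 𝒜 (Sum.elim s r i))) :=
  PiTensorProduct.tmulEquivDep_apply (R := k) (N := fun i : ι ⊕ κ => 𝒜 (Sum.elim s r i)) a b

variable [GradedAlgebra 𝒜]

theorem mulMap_split_left [Fintype ι] [Fintype κ] {g : ι → ι'} {s : ι → ℕ} {s' : ι' → ℕ}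
    (h : DegEq g s s') (r : κ → ℕ) (x : GTensor 𝒜 s ⊗[k] GTensor 𝒜 r) :
    mulMap 𝒜 (h.sumMap_id r) (split 𝒜 s r x) =
      split 𝒜 s' r ((mulMap 𝒜 h).rTensor (GTensor 𝒜 r) x) := by
  suffices mulMap 𝒜 (h.sumMap_id r) ∘ₗ (split 𝒜 s r).toLinearMap =
      (split 𝒜 s' r).toLinearMap ∘ₗ (mulMap 𝒜 h).rTensor (GTensor 𝒜 r) from
    LinearMap.congr_fun this x
  refine TensorProduct.ext (linearMap_ext 𝒜 fun a => linearMap_ext 𝒜 fun b => ?_)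
  simp only [TensorProduct.mk_apply, LinearMap.comp_apply,
    LinearEquiv.coe_coe, LinearMap.rTensor_tmul, mulMap_tprod, split_tmul,
    LinearMap.compr₂ₛₗ_apply]
  congr 1
  funext j
  classical
  apply Subtype.ext
  rw [coe_prodFun, Finset.prod_filter, Fintype.prod_sum_type]
  rcases j with j | j
  · simp [coe_prodFun, Finset.prod_filter]
  · simp

theorem mulMap_split_right [Fintype ι] [Fintype κ] {g : κ → κ'} {r : κ → ℕ} {r' : κ' → ℕ}
    (h : DegEq g r r') (s : ι → ℕ) (x : GTensor 𝒜 s ⊗[k] GTensor 𝒜 r) :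
    mulMap 𝒜 (h.sumMap_id_left s) (split 𝒜 s r x) =
      split 𝒜 s r' ((mulMap 𝒜 h).lTensor (GTensor 𝒜 s) x) := by
  suffices mulMap 𝒜 (h.sumMap_id_left s) ∘ₗ (split 𝒜 s r).toLinearMap =
      (split 𝒜 s r').toLinearMap ∘ₗ (mulMap 𝒜 h).lTensor (GTensor 𝒜 s) from
    LinearMap.congr_fun this x
  refine TensorProduct.ext (linearMap_ext 𝒜 fun a => linearMap_ext 𝒜 fun b => ?_)
  simp only [TensorProduct.mk_apply, LinearMap.comp_apply,
    LinearEquiv.coe_coe, LinearMap.lTensor_tmul, mulMap_tprod, split_tmul,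
    LinearMap.compr₂ₛₗ_apply]
  congr 1
  funext j
  classical
  apply Subtype.ext
  rw [coe_prodFun, Finset.prod_filter, Fintype.prod_sum_type]
  rcases j with j | j
  · simp
  · simp [coe_prodFun, Finset.prod_filter]

theorem killed_split_left [Fintype ι] [DecidableEq ι] [Fintype κ] {s : ι → ℕ} {r : κ → ℕ}
    {x : GTensor 𝒜 s ⊗[k] GTensor 𝒜 r} {p q : ι} :
    Killed 𝒜 (split 𝒜 s r x) (Sum.inl p) (Sum.inl q) ↔
      (mulMap 𝒜 (degEq_pushDeg (Function.update id p q) s)).rTensor (GTensor 𝒜 r) x = 0 := by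
  have key := mulMap_split_left 𝒜 (degEq_pushDeg (Function.update id p q) s) r x
  rw [← LinearEquiv.map_eq_zero_iff (split 𝒜 _ r), ← key]
  constructor
  · intro h
    exact h.mulMap_eq_zero 𝒜 (by by_cases hqp : q = p <;> simp [hqp]) _
  · intro h
    refine killed_of_mulMap_eq_zero 𝒜 _ h ?_
    rintro (i | i) (j | j) hij
    · simp only [Sum.map_inl, Function.update_apply, id, Sum.inl.injEq] at hij ⊢
      split_ifs at hij <;> simp_all
    all_goals simp_all

theorem killed_split_right [Fintype ι] [Fintype κ] [DecidableEq κ] {s : ι → ℕ} {r : κ → ℕ}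
    {x : GTensor 𝒜 s ⊗[k] GTensor 𝒜 r} {p q : κ} :
    Killed 𝒜 (split 𝒜 s r x) (Sum.inr p) (Sum.inr q) ↔
      (mulMap 𝒜 (degEq_pushDeg (Function.update id p q) r)).lTensor (GTensor 𝒜 s) x = 0 := by
  have key := mulMap_split_right 𝒜 (degEq_pushDeg (Function.update id p q) r) s x
  rw [← LinearEquiv.map_eq_zero_iff (split 𝒜 s _), ← key]
  constructor
  · intro h
    exact h.mulMap_eq_zero 𝒜 (by by_cases hqp : q = p <;> simp [hqp]) _
  · intro h
    refine killed_of_mulMap_eq_zero 𝒜 _ h ?_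
    rintro (i | i) (j | j) hij
    · simp_all
    · simp_all
    · simp_all
    · simp only [Sum.map_inr, Function.update_apply, id, Sum.inr.injEq] at hij ⊢
      split_ifs at hij <;> simp_all

omit [GradedAlgebra 𝒜] in
/-- A surjectivity statement between intersections of kernels has a solution operator. -/
theorem exists_solution_operator {τ : Type*} [Finite τ] {V W : Type*} [AddCommGroup V] [Module k V]
    [AddCommGroup W] [Module k W] {V' W' : τ → Type*} [∀ t, AddCommGroup (V' t)]
    [∀ t, Module k (V' t)] [∀ t, AddCommGroup (W' t)] [∀ t, Module k (W' t)]
    (f : V →ₗ[k] W) (α : ∀ t, V →ₗ[k] V' t) (β : ∀ t, W →ₗ[k] W' t)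
    (hf : ∀ w, (∀ t, β t w = 0) → ∃ y, f y = w ∧ ∀ t, α t y = 0) :
    ∃ (σ : W →ₗ[k] V) (ρ : ∀ t, W' t →ₗ[k] W),
      (∀ w, f (σ w) = w + ∑ᶠ t, ρ t (β t w)) ∧ ∀ t w, α t (σ w) = 0 := by
  classical
  have := Fintype.ofFinite τ
  let K : Submodule k W := LinearMap.ker (LinearMap.pi β)
  let L : Submodule k V := LinearMap.ker (LinearMap.pi α) ⊓ K.comap f
  let φ : L →ₗ[k] K := (f ∘ₗ L.subtype).codRestrict K fun x => x.2.2
  have hφ : Function.Surjective φ := by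
    rintro ⟨w, hw⟩
    obtain ⟨y, hy, hy'⟩ := hf w fun t => congrFun hw t
    exact ⟨⟨y, funext hy', show f y ∈ K by rw [hy]; exact hw⟩, Subtype.ext hy⟩
  obtain ⟨ψ, hψ⟩ := φ.exists_rightInverse_of_surjective (LinearMap.range_eq_top.2 hφ)
  obtain ⟨σ, hσ⟩ := LinearMap.exists_extend ψ
  let D : W →ₗ[k] W := f ∘ₗ L.subtype ∘ₗ σ - LinearMap.id
  have hD : ∀ w ∈ K, D w = 0 := by
    intro w hw
    have h1 : σ w = ψ ⟨w, hw⟩ := LinearMap.congr_fun hσ ⟨w, hw⟩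
    have h2 : φ (ψ ⟨w, hw⟩) = ⟨w, hw⟩ := LinearMap.congr_fun hψ ⟨w, hw⟩
    have h3 : f (ψ ⟨w, hw⟩ : V) = w := congrArg Subtype.val h2
    simp [D, h1, h3]
  let B := LinearMap.pi β
  have hker : LinearMap.ker B.rangeRestrict ≤ LinearMap.ker D := by
    rw [LinearMap.ker_rangeRestrict]
    exact hD
  obtain ⟨χ, hχ⟩ := B.rangeRestrict.exists_rightInverse_of_surjective B.range_rangeRestrict
  obtain ⟨χ', hχ'⟩ := LinearMap.exists_extend χ
  refine ⟨L.subtype ∘ₗ σ, fun t => D ∘ₗ χ' ∘ₗ LinearMap.single k W' t, fun w => ?_, fun t w => ?_⟩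
  · have h1 : D (χ' (B w)) = D w := by
      have h2 : χ' (B w) = χ (B.rangeRestrict w) := LinearMap.congr_fun hχ' (B.rangeRestrict w)
      have h3 : B.rangeRestrict (χ (B.rangeRestrict w) - w) = 0 := by
        rw [map_sub, sub_eq_zero]
        exact LinearMap.congr_fun hχ (B.rangeRestrict w)
      have h4 := hker h3
      rw [LinearMap.mem_ker, map_sub, sub_eq_zero] at h4
      rw [h2, h4]
    rw [finsum_eq_sum_of_fintype]
    simp only [LinearMap.comp_apply, ← map_sum]
    have h5 : ∑ t, LinearMap.single k W' t (β t w) = B w := by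
      exact Finset.univ_sum_single (fun t => β t w)
    rw [h5, h1]
    simp [D]
  · exact congrFun (σ w).2.1 t

/-- The degrees of the tensor factors of `A_1 ⊗ ⋯ ⊗ A_1 ⊗ A_m` with `a` factors `A_1`. -/
def combDeg (a m : ℕ) (t : Fin (a + 1)) : ℕ := if (t : ℕ) < a then 1 else m

theorem degEq_mergePos_last (a m : ℕ) :
    DegEq (GradedBar.mergePos (Fin.last a)) (combDeg (a + 1) m) (combDeg a (m + 1)) := by
  refine degEq_iff.2 fun j => ?_
  rw [Finset.sum_filter, Fin.sum_univ_castSucc]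
  have h1 : ∀ i : Fin (a + 1), GradedBar.mergePos (Fin.last a) i.castSucc = i := by
    intro i
    have : (i : ℕ) ≤ a := by omega
    simp [GradedBar.mergePos, this]
  have h2 : GradedBar.mergePos (Fin.last a) (Fin.last (a + 1)) = Fin.last a := by
    simp [GradedBar.mergePos, Fin.last]
  simp only [h1, h2, Finset.sum_ite_eq', Finset.mem_univ, if_true, combDeg, Fin.val_castSucc,
    Fin.val_last, lt_irrefl, if_false, Fin.is_lt]
  by_cases hj : (j : ℕ) < a
  · simp [hj, Fin.ext_iff, hj.ne']
  · have : j = Fin.last a := Fin.ext (by have := j.2; simp; omega)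
    subst this
    simp [add_comm]

/-- Exactness of the Koszul complex at `K_a ⊗ A_{m+1}`, where `K_a ⊆ A_1^{⊗ a}` is the Koszul dual
coalgebra. -/
def KoszulLift (a m : ℕ) : Prop :=
  ∀ w : GTensor 𝒜 (combDeg a (m + 1)), (∀ t : Fin a, Killed 𝒜 w t.castSucc t.succ) →
    ∃ y : GTensor 𝒜 (combDeg (a + 1) m), mulMap 𝒜 (degEq_mergePos_last a m) y = w ∧
      ∀ t : Fin a, Killed 𝒜 y t.castSucc.castSucc t.succ.castSucc

theorem KoszulLift.exists_lift_sum {a m : ℕ} (hK : KoszulLift 𝒜 a m) [Fintype κ] (r : κ → ℕ)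
    (w : GTensor 𝒜 (Sum.elim (combDeg a (m + 1)) r))
    (hw : ∀ t : Fin a, Killed 𝒜 w (Sum.inl t.castSucc) (Sum.inl t.succ)) :
    ∃ y : GTensor 𝒜 (Sum.elim (combDeg (a + 1) m) r),
      mulMap 𝒜 ((degEq_mergePos_last a m).sumMap_id r) y = w ∧
      (∀ t : Fin a, Killed 𝒜 y (Sum.inl t.castSucc.castSucc) (Sum.inl t.succ.castSucc)) ∧
      ∀ p q : κ, Killed 𝒜 w (Sum.inr p) (Sum.inr q) → Killed 𝒜 y (Sum.inr p) (Sum.inr q) := by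
  classical
  have hK' : ∀ w : GTensor 𝒜 (combDeg a (m + 1)), (∀ t : Fin a, mulMap 𝒜 (degEq_pushDeg
      (Function.update id t.castSucc t.succ) (combDeg a (m + 1))) w = 0) →
      ∃ y : GTensor 𝒜 (combDeg (a + 1) m), mulMap 𝒜 (degEq_mergePos_last a m) y = w ∧
        ∀ t : Fin a, mulMap 𝒜 (degEq_pushDeg (Function.update id t.castSucc.castSucc
          t.succ.castSucc) (combDeg (a + 1) m)) y = 0 := by
    intro w hw
    obtain ⟨y, hy, hy'⟩ := hK w fun t => (killed_iff 𝒜).2 (hw t)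
    exact ⟨y, hy, fun t => (killed_iff 𝒜).1 (hy' t)⟩
  obtain ⟨σ, ρ, hσ, hσ'⟩ := exists_solution_operator
    (V := GTensor 𝒜 (combDeg (a + 1) m)) (W := GTensor 𝒜 (combDeg a (m + 1)))
    (V' := fun t : Fin a => GTensor 𝒜 (pushDeg (Function.update id t.castSucc.castSucc
      t.succ.castSucc) (combDeg (a + 1) m)))
    (W' := fun t : Fin a => GTensor 𝒜 (pushDeg (Function.update id t.castSucc t.succ)
      (combDeg a (m + 1)))) (mulMap 𝒜 (degEq_mergePos_last a m))
    (fun t : Fin a => mulMap 𝒜 (degEq_pushDeg (Function.update id t.castSucc.castSucc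
      t.succ.castSucc) (combDeg (a + 1) m)))
    (fun t : Fin a => mulMap 𝒜 (degEq_pushDeg (Function.update id t.castSucc t.succ)
      (combDeg a (m + 1)))) hK'
  obtain ⟨x, rfl⟩ := (split 𝒜 _ _).surjective w
  refine ⟨split 𝒜 _ _ (σ.rTensor _ x), ?_, fun t => ?_, fun p q hpq => ?_⟩
  · rw [mulMap_split_left 𝒜 (degEq_mergePos_last a m)]
    congr 1
    have h1 : mulMap 𝒜 (degEq_mergePos_last a m) ∘ₗ σ = LinearMap.id + ∑ t, ρ t ∘ₗ
        mulMap 𝒜 (degEq_pushDeg (Function.update id t.castSucc t.succ) (combDeg a (m + 1))) := by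
      refine LinearMap.ext fun w => ?_
      simp [hσ, finsum_eq_sum_of_fintype]
    rw [← LinearMap.comp_apply, ← LinearMap.rTensor_comp, h1, LinearMap.rTensor_add,
      LinearMap.add_apply, LinearMap.rTensor_id, LinearMap.id_apply]
    have h2 : ∀ (S : Finset (Fin a)), LinearMap.rTensor (GTensor 𝒜 r) (∑ t ∈ S, ρ t ∘ₗ
        mulMap 𝒜 (degEq_pushDeg (Function.update id t.castSucc t.succ) (combDeg a (m + 1)))) x
        = 0 := by
      intro S
      induction S using Finset.induction_on with
      | empty => simp
      | insert t S ht ih =>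
        rw [Finset.sum_insert ht, LinearMap.rTensor_add, LinearMap.add_apply, ih, add_zero,
          LinearMap.rTensor_comp, LinearMap.comp_apply]
        rw [(killed_split_left 𝒜).1 (hw t), map_zero]
    rw [h2, add_zero]
  · rw [killed_split_left, ← LinearMap.comp_apply, ← LinearMap.rTensor_comp,
      show mulMap 𝒜 _ ∘ₗ σ = 0 from LinearMap.ext (hσ' t), LinearMap.rTensor_zero,
      LinearMap.zero_apply]
  · rw [killed_split_right] at hpq ⊢
    rw [← LinearMap.comp_apply, LinearMap.lTensor_comp_rTensor, ← LinearMap.rTensor_comp_lTensor,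
      LinearMap.comp_apply, hpq, map_zero]

/-- Given an element killed by all products of neighbouring factors in a run of factors of degrees
`1, …, 1, m + 1`, one can split off a factor of degree one from the last factor of the run. -/
theorem KoszulLift.exists_lift {a m : ℕ} (hK : KoszulLift 𝒜 a m) [Fintype κ] [Fintype ι]
    [Fintype ι'] {c : Fin (a + 1) ⊕ κ → ι} (hc : Function.Bijective c)
    {c' : Fin (a + 2) ⊕ κ → ι'} (hc' : Function.Bijective c') {s : ι → ℕ} {s' : ι' → ℕ}
    (hs : ∀ t, s (c (Sum.inl t)) = combDeg a (m + 1) t)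
    (hs' : ∀ t, s' (c' (Sum.inl t)) = combDeg (a + 1) m t)
    (hκ : ∀ x, s' (c' (Sum.inr x)) = s (c (Sum.inr x))) (w : GTensor 𝒜 s)
    (hw : ∀ t : Fin a, Killed 𝒜 w (c (Sum.inl t.castSucc)) (c (Sum.inl t.succ))) :
    ∃ y : GTensor 𝒜 s',
      (∀ (γ : ι' → ι) (h : DegEq γ s' s),
        γ ∘ c' = c ∘ Sum.map (GradedBar.mergePos (Fin.last a)) id → mulMap 𝒜 h y = w) ∧
      (∀ t : Fin a, Killed 𝒜 y (c' (Sum.inl t.castSucc.castSucc)) (c' (Sum.inl t.succ.castSucc))) ∧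
      ∀ p q : κ, Killed 𝒜 w (c (Sum.inr p)) (c (Sum.inr q)) →
        Killed 𝒜 y (c' (Sum.inr p)) (c' (Sum.inr q)) := by
  have h1 : DegEq c (Sum.elim (combDeg a (m + 1)) fun x => s (c (Sum.inr x))) s :=
    degEq_of_bijective hc (by rintro (t | x) <;> simp [hs])
  have h2 : DegEq c' (Sum.elim (combDeg (a + 1) m) fun x => s (c (Sum.inr x))) s' :=
    degEq_of_bijective hc' (by rintro (t | x) <;> simp [hs', hκ])
  obtain ⟨w, rfl⟩ := (mulMap_bijective 𝒜 hc h1).2 w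
  simp only [killed_of_bijective 𝒜 hc h1] at hw ⊢
  obtain ⟨y, hy1, hy2, hy3⟩ := hK.exists_lift_sum 𝒜 _ w hw
  refine ⟨mulMap 𝒜 h2 y, fun γ h hγ => ?_, fun t => ?_, fun p q hpq => ?_⟩
  · rw [mulMap_comp 𝒜 h2 h (h2.comp h) rfl, ← hy1,
      mulMap_comp 𝒜 ((degEq_mergePos_last a m).sumMap_id _) h1 (h2.comp h) hγ.symm]
  · rw [killed_of_bijective 𝒜 hc' h2]; exact hy2 t
  · rw [killed_of_bijective 𝒜 hc' h2]; exact hy3 p q hpq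

end

end GradedTensor

/-! ### Elimination of leading components in complexes of contractions -/

namespace Contraction

section

variable {k : Type*} [Field k] {Θ₂ Θ₁ Θ₀ : Type*} [DecidableEq Θ₂] [DecidableEq Θ₁]
  [DecidableEq Θ₀] {X₂ : Θ₂ → Type*} {X₁ : Θ₁ → Type*} {X₀ : Θ₀ → Type*}
  [∀ T, AddCommMonoid (X₂ T)] [∀ T, AddCommMonoid (X₁ T)] [∀ T, AddCommMonoid (X₀ T)]
  [∀ T, Module k (X₂ T)] [∀ T, Module k (X₁ T)] [∀ T, Module k (X₀ T)]
  {E₂ : Θ₂ → Type*} {E₁ : Θ₁ → Type*} [∀ T, Fintype (E₂ T)] [∀ T, Fintype (E₁ T)]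

/-- A linear combination of contractions. -/
noncomputable def map (con : ∀ T, E₁ T → Θ₀) (ε : ∀ T, E₁ T → k)
    (f : ∀ T (s : E₁ T), X₁ T →ₗ[k] X₀ (con T s)) : (⨁ T, X₁ T) →ₗ[k] ⨁ T, X₀ T :=
  DirectSum.toModule k Θ₁ (⨁ T, X₀ T) fun T =>
    ∑ s : E₁ T, ε T s • (DirectSum.lof k Θ₀ X₀ (con T s) ∘ₗ f T s)

theorem map_lof (con : ∀ T, E₁ T → Θ₀) (ε : ∀ T, E₁ T → k)
    (f : ∀ T (s : E₁ T), X₁ T →ₗ[k] X₀ (con T s)) (T : Θ₁) (x : X₁ T) :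
    map con ε f (DirectSum.lof k Θ₁ X₁ T x) =
      ∑ s : E₁ T, ε T s • DirectSum.lof k Θ₀ X₀ (con T s) (f T s x) := by
  simp [map, DirectSum.toModule_lof]

theorem lof_apply_of_ne {T T' : Θ₁} (h : T' ≠ T) (x : X₁ T') :
    DirectSum.lof k Θ₁ X₁ T' x T = 0 := by
  rw [DirectSum.lof_eq_of]
  exact DirectSum.of_eq_of_ne _ _ _ h.symm

theorem lof_apply_self (T : Θ₁) (x : X₁ T) : DirectSum.lof k Θ₁ X₁ T x T = x := by
  rw [DirectSum.lof_eq_of, DirectSum.of_eq_same]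

omit [DecidableEq Θ₁] in
theorem sum_apply' {σ : Type*} (S : Finset σ) (z : σ → ⨁ T, X₁ T) (T : Θ₁) :
    (∑ i ∈ S, z i) T = ∑ i ∈ S, z i T :=
  DFinsupp.finsetSum_apply S z T

omit [DecidableEq Θ₁] in
theorem smul_apply' (c : k) (z : ⨁ T, X₁ T) (T : Θ₁) : (c • z) T = c • z T :=
  DirectSum.smul_apply c z T

theorem map_apply_of_unique (con : ∀ T, E₁ T → Θ₀) (ε : ∀ T, E₁ T → k)
    (f : ∀ T (s : E₁ T), X₁ T →ₗ[k] X₀ (con T s)) (z : ⨁ T, X₁ T) {T : Θ₁} {s : E₁ T}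
    (hs : ∀ s', con T s' = con T s → s' = s)
    (hT : ∀ T' s', con T' s' = con T s → T' ≠ T → z T' = 0) :
    map con ε f z (con T s) = ε T s • f T s (z T) := by
  classical
  conv_lhs => rw [← DirectSum.sum_support_of z]
  rw [map_sum, sum_apply', Finset.sum_eq_single T]
  · rw [← DirectSum.lof_eq_of k, map_lof, sum_apply', Finset.sum_eq_single s]
    · rw [smul_apply', lof_apply_self]
    · intro s' _ hs'
      rw [smul_apply', lof_apply_of_ne fun h => hs' (hs s' h), smul_zero]
    · simp
  · intro T' hT' hne
    rw [← DirectSum.lof_eq_of k, map_lof, sum_apply']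
    refine Finset.sum_eq_zero fun s' _ => ?_
    rw [smul_apply', lof_apply_of_ne, smul_zero]
    intro h
    exact (DFinsupp.mem_support_iff.1 hT') (hT T' s' h hne)
  · intro h
    rw [DFinsupp.notMem_support_iff.1 h]
    simp

theorem add_neg_one_smul {M : Type*} [AddCommMonoid M] [Module k M] (x : M) :
    x + (-1 : k) • x = 0 := by
  conv_lhs => enter [1]; rw [← one_smul k x]
  rw [← add_smul, add_neg_cancel, zero_smul]

theorem eq_zero_of_smul_eq_zero {M : Type*} [AddCommMonoid M] [Module k M] {c : k} (hc : c ≠ 0)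
    {x : M} (h : c • x = 0) : x = 0 := by
  rw [← inv_smul_smul₀ hc x, h, smul_zero]

theorem elimination [Finite Θ₁] {L : Type*} [LinearOrder L] (rank : Θ₁ → L) (bad : Θ₁ → Prop)
    (hbad : ∀ T T', bad T → rank T' ≤ rank T → bad T')
    (con₂ : ∀ T, E₂ T → Θ₁) (ε₂ : ∀ T, E₂ T → k) (f₂ : ∀ T (s : E₂ T), X₂ T →ₗ[k] X₁ (con₂ T s))
    (con₁ : ∀ T, E₁ T → Θ₀) (ε₁ : ∀ T, E₁ T → k) (f₁ : ∀ T (s : E₁ T), X₁ T →ₗ[k] X₀ (con₁ T s))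
    (hε₂ : ∀ T s, ε₂ T s ≠ 0) (hε₁ : ∀ T s, ε₁ T s ≠ 0)
    (hcomp : ∀ v, map con₁ ε₁ f₁ (map con₂ ε₂ f₂ v) = 0) (w : ⨁ T, X₀ T)
    (step : ∀ T, bad T → ∃ (T' : Θ₂) (j : E₂ T') (K : Set (E₁ T)),
      (∀ s ∈ K, w (con₁ T s) = 0 ∧ (∀ s', con₁ T s' = con₁ T s → s' = s) ∧
        ∀ R r, con₁ R r = con₁ T s → R ≠ T → rank R < rank T) ∧
      ∀ x : X₁ T, (∀ s ∈ K, f₁ T s x = 0) → ∃ y : X₂ T',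
        DirectSum.lof k Θ₁ X₁ (con₂ T' j) (f₂ T' j y) = DirectSum.lof k Θ₁ X₁ T x ∧
        ∀ i, i ≠ j → f₂ T' i y = 0 ∨ rank T < rank (con₂ T' i))
    (z : ⨁ T, X₁ T) (hz : map con₁ ε₁ f₁ z = w) :
    ∃ v, ∀ T, bad T → (z + (-1 : k) • map con₂ ε₂ f₂ v) T = 0 := by
  classical
  have := Fintype.ofFinite Θ₁
  induction hn : (Finset.univ.filter fun T => ∃ R, z R ≠ 0 ∧ bad R ∧ rank R ≤ rank T).card
    using Nat.strong_induction_on generalizing z with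
  | _ n ih =>
  by_cases hz0 : ∀ T, bad T → z T = 0
  · exact ⟨0, fun T hT => by simp [hz0 T hT]⟩
  push Not at hz0
  obtain ⟨T₀, hT₀, hmin⟩ := Finset.exists_min_image
    (Finset.univ.filter fun T => bad T ∧ z T ≠ 0) rank (by
      obtain ⟨T, hT⟩ := hz0; exact ⟨T, by simpa using hT⟩)
  simp only [Finset.mem_filter, Finset.mem_univ, true_and] at hT₀ hmin
  have hlow : ∀ T, rank T < rank T₀ → z T = 0 := by
    intro T hT
    by_contra hne
    exact absurd (hmin T ⟨hbad _ _ hT₀.1 hT.le, hne⟩) (not_le.2 hT)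
  have key : ∀ T, rank T = rank T₀ → ∃ v, ∀ R, rank R ≤ rank T₀ →
      map con₂ ε₂ f₂ v R = DirectSum.lof k Θ₁ X₁ T (z T) R := by
    intro T hT
    obtain ⟨T', j, K, hK, hlift⟩ := step T (hbad _ _ hT₀.1 hT.le)
    obtain ⟨y, hy, hy'⟩ := hlift (z T) (by
      intro s hs
      obtain ⟨h1, h2, h3⟩ := hK s hs
      have h4 := map_apply_of_unique con₁ ε₁ f₁ z h2
        (fun R r h hne => hlow R (hT ▸ h3 R r h hne))
      rw [hz, h1] at h4
      exact eq_zero_of_smul_eq_zero (hε₁ T s) h4.symm)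
    refine ⟨(ε₂ T' j)⁻¹ • DirectSum.lof k Θ₂ X₂ T' y, fun R hR => ?_⟩
    rw [map_smul, map_lof, smul_apply', sum_apply', Finset.sum_eq_single j]
    · rw [hy, smul_apply', smul_smul, inv_mul_cancel₀ (hε₂ T' j), one_smul]
    · intro i _ hi
      rw [smul_apply']
      rcases hy' i hi with h | h
      · simp [h]
      · rw [lof_apply_of_ne, smul_zero]
        rintro rfl
        exact absurd (hT ▸ h) (not_lt.2 hR)
    · simp
  choose! v hv using key
  let V := ∑ T ∈ Finset.univ.filter (fun T => rank T = rank T₀), v T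
  have hV : ∀ R, rank R ≤ rank T₀ → (z + (-1 : k) • map con₂ ε₂ f₂ V) R = 0 := by
    intro R hR
    rw [DirectSum.add_apply, smul_apply']
    suffices h : map con₂ ε₂ f₂ V R = z R by rw [h, add_neg_one_smul]
    simp only [V]
    rw [map_sum, sum_apply', Finset.sum_congr rfl (g := fun T => DirectSum.lof k Θ₁ X₁ T (z T) R)
      (fun T hT => hv T (Finset.mem_filter.1 hT).2 R hR)]
    rcases hR.lt_or_eq with h | h
    · rw [hlow R h]
      refine Finset.sum_eq_zero fun T hT => lof_apply_of_ne ?_ _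
      rintro rfl
      exact h.ne (Finset.mem_filter.1 hT).2
    · rw [Finset.sum_eq_single R]
      · rw [lof_apply_self]
      · intro T _ hne
        exact lof_apply_of_ne hne _
      · intro h'
        exact (h' (Finset.mem_filter.2 ⟨Finset.mem_univ _, h⟩)).elim
  obtain ⟨v', hv'⟩ := ih _ (by
    rw [← hn]
    refine Finset.card_lt_card ⟨fun T hT => ?_, fun h => ?_⟩
    · obtain ⟨R, hR, hbR, hRT⟩ := (Finset.mem_filter.1 hT).2
      have h1 : rank T₀ < rank R := by
        by_contra hle
        exact hR (hV R (not_lt.1 hle))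
      exact Finset.mem_filter.2 ⟨Finset.mem_univ _, T₀, hT₀.2, hT₀.1, h1.le.trans hRT⟩
    · have h1 := h (Finset.mem_filter.2 ⟨Finset.mem_univ T₀, T₀, hT₀.2, hT₀.1, le_rfl⟩)
      obtain ⟨R, hR, hbR, hRT⟩ := (Finset.mem_filter.1 h1).2
      exact hR (hV R hRT)) (z + (-1 : k) • map con₂ ε₂ f₂ V) (by
      rw [map_add, map_smul, hz, hcomp, smul_zero, add_zero]) rfl
  refine ⟨V + v', fun T hT => ?_⟩
  rw [map_add, smul_add, ← add_assoc]
  exact hv' T hT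

end

end Contraction

/-! ### The Koszul complex of a Koszul algebra is exact -/

namespace GradedBar

open GradedTensor

section

variable {k : Type u} {A : Type v} [Field k] [CommRing A] [Algebra k A]
  (𝒜 : ℕ → Submodule k A)

theorem mergePos_castSucc {q : ℕ} (t : Fin q) : mergePos t t.castSucc = t := by
  simp [mergePos]

theorem mergePos_succ {q : ℕ} (t : Fin q) : mergePos t t.succ = t := by
  simp [mergePos]

theorem eq_or_of_mergePos_eq {q : ℕ} {t : Fin q} {r r' : Fin (q + 1)}
    (h : mergePos t r = mergePos t r') :
    r = r' ∨ (r = t.castSucc ∧ r' = t.succ) ∨ (r = t.succ ∧ r' = t.castSucc) := by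
  have h := congrArg Fin.val h
  simp only [mergePos] at h
  simp only [Fin.ext_iff, Fin.val_castSucc, Fin.val_succ]
  split_ifs at h <;> (simp only at h; omega)

@[to_additive]
theorem prod_mergePos {M : Type*} [CommMonoid M] {q : ℕ} (t : Fin q) (f : Fin (q + 1) → M)
    (s : Fin q) :
    ∏ r with mergePos t r = s, f r = Fin.contractNth t.castSucc (· * ·) f s := by
  unfold Fin.contractNth
  split_ifs with h1 h2
  · have : (Finset.univ.filter fun r => mergePos t r = s) = {s.castSucc} := by
      ext r
      simp only [Finset.mem_filter, Finset.mem_univ, true_and, Finset.mem_singleton, mergePos,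
        Fin.ext_iff, Fin.val_castSucc] at h1 ⊢
      split_ifs <;> simp only <;> omega
    rw [this, Finset.prod_singleton]
  · have : (Finset.univ.filter fun r => mergePos t r = s) = {s.castSucc, s.succ} := by
      ext r
      simp only [Finset.mem_filter, Finset.mem_univ, true_and, Finset.mem_singleton, mergePos,
        Fin.ext_iff, Fin.val_castSucc, Finset.mem_insert, Fin.val_succ] at h1 h2 ⊢
      split_ifs <;> simp only <;> omega
    rw [this, Finset.prod_pair]
    simp [Fin.ext_iff]
  · have : (Finset.univ.filter fun r => mergePos t r = s) = {s.succ} := by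
      ext r
      simp only [Finset.mem_filter, Finset.mem_univ, true_and, Finset.mem_singleton, mergePos,
        Fin.ext_iff, Fin.val_castSucc, Fin.val_succ] at h1 h2 ⊢
      split_ifs <;> simp only <;> omega
    rw [this, Finset.prod_singleton]

theorem Index.degEq_merge {q j : ℕ} (i : Index (q + 1) j) (t : Fin q) :
    DegEq (mergePos t) i.1 (i.merge t).1 :=
  degEq_iff.2 fun s => sum_mergePos t i.1 s

theorem Index.merge_apply_lt {q j : ℕ} (i : Index (q + 1) j) {t s : Fin q} (h : s < t) :
    (i.merge t).1 s = i.1 s.castSucc := by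
  have : (s : ℕ) < t := h
  simp [Index.merge, Fin.contractNth, this]

theorem Index.merge_apply_self {q j : ℕ} (i : Index (q + 1) j) (t : Fin q) :
    (i.merge t).1 t = i.1 t.castSucc + i.1 t.succ := by
  simp [Index.merge, Fin.contractNth]

theorem Index.merge_apply_gt {q j : ℕ} (i : Index (q + 1) j) {t s : Fin q} (h : t < s) :
    (i.merge t).1 s = i.1 s.succ := by
  have h1 : (t : ℕ) < s := h
  have h2 : ¬ (s : ℕ) < t := by omega
  have h3 : ¬ (s : ℕ) = t := by omega
  simp [Index.merge, Fin.contractNth, h2, h3]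

theorem Index.eq_of_merge_eq {q j : ℕ} {i i' : Index (q + 1) j} {t : Fin q}
    (h : i.merge t = i'.merge t) (ht : i.1 t.castSucc = i'.1 t.castSucc) : i = i' := by
  have h0 : ∀ s, (i.merge t).1 s = (i'.merge t).1 s := fun s => by rw [h]
  apply Subtype.ext
  funext r
  rcases lt_trichotomy r t.castSucc with hr | rfl | hr
  · have h1 := h0 (r.castLT (by have : (r : ℕ) < t := hr; omega))
    rwa [i.merge_apply_lt (by exact hr), i'.merge_apply_lt (by exact hr)] at h1
  · exact ht
  · have hr' : (t : ℕ) < r := hr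
    rcases eq_or_ne r t.succ with rfl | hne
    · have h1 := h0 t
      rw [i.merge_apply_self, i'.merge_apply_self] at h1
      omega
    · have hne' : (r : ℕ) ≠ t + 1 := fun h => hne (Fin.ext h)
      obtain ⟨s, rfl⟩ := Fin.exists_succ_eq.2 (show r ≠ 0 by rintro rfl; simp at hr')
      have h1 := h0 s
      have hts : t < s := by
        rw [Fin.val_succ] at hr' hne'
        exact Fin.lt_def.2 (by omega)
      rwa [i.merge_apply_gt hts, i'.merge_apply_gt hts] at h1

/-- The number of entries `1` at the beginning of a sequence. -/
noncomputable def lead {q : ℕ} (i : Fin q → ℕ) : ℕ :=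
  sInf {r | ∀ h : r < q, i ⟨r, h⟩ ≠ 1}

theorem eq_one_of_lt_lead {q : ℕ} {i : Fin q → ℕ} {t : Fin q} (h : (t : ℕ) < lead i) : i t = 1 := by
  have := Nat.notMem_of_lt_sInf h
  simpa using this

theorem lead_spec {q : ℕ} (i : Fin q → ℕ) (h : lead i < q) : i ⟨lead i, h⟩ ≠ 1 :=
  Nat.sInf_mem (s := {r | ∀ h : r < q, i ⟨r, h⟩ ≠ 1}) ⟨q, fun h => absurd h (lt_irrefl q)⟩ h

theorem le_lead {q : ℕ} {i : Fin q → ℕ} {r : ℕ} (hr : r ≤ q)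
    (h : ∀ t : Fin q, (t : ℕ) < r → i t = 1) : r ≤ lead i := by
  by_contra hlt
  exact lead_spec i (by omega) (h ⟨lead i, by omega⟩ (by simp; omega))

theorem lead_eq {q : ℕ} {i : Fin q → ℕ} {r : ℕ} (hr : r < q)
    (h : ∀ t : Fin q, (t : ℕ) < r → i t = 1) (h' : i ⟨r, hr⟩ ≠ 1) : lead i = r :=
  le_antisymm (not_lt.1 fun hlt => h' (eq_one_of_lt_lead hlt)) (le_lead hr.le h)

theorem lead_merge {q j : ℕ} (i : Index (q + 1) j) (t : Fin q) :
    lead (i.merge t).1 = min (t : ℕ) (lead i.1) := by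
  rcases le_or_gt (t : ℕ) (lead i.1) with h | h
  · rw [min_eq_left h]
    refine lead_eq t.2 (fun s hs => ?_) ?_
    · rw [i.merge_apply_lt hs]
      exact eq_one_of_lt_lead (by simp; omega)
    · rw [i.merge_apply_self]
      have := i.2.1 t.castSucc
      have := i.2.1 t.succ
      omega
  · rw [min_eq_right h.le]
    refine lead_eq (by omega) (fun s hs => ?_) ?_
    · rw [i.merge_apply_lt (Fin.lt_def.2 (by omega))]
      exact eq_one_of_lt_lead (by simpa using hs)
    · rw [i.merge_apply_lt (Fin.lt_def.2 (by simpa using h))]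
      exact lead_spec i.1 (by omega)

theorem finite_index (q j : ℕ) : Finite (Index q j) := by
  refine Finite.of_injective (β := Fin q → Fin (j + 1))
    (fun i t => ⟨i.1 t, Nat.lt_succ_of_le ?_⟩) fun i i' h => ?_
  · exact (Finset.single_le_sum (fun _ _ => Nat.zero_le _) (Finset.mem_univ t)).trans i.2.2.le
  · apply Subtype.ext
    funext t
    exact congrArg Fin.val (congrFun h t)

theorem isEmpty_index {q j : ℕ} (h : j < q) : IsEmpty (Index q j) := by
  refine ⟨fun i => ?_⟩
  have h1 := Finset.card_nsmul_le_sum Finset.univ i.1 1 fun t _ => i.2.1 t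
  rw [i.2.2] at h1
  simp at h1
  omega

variable [GradedAlgebra 𝒜]

theorem d_eq_map (j q : ℕ) : d 𝒜 j q = Contraction.map (k := k) (Θ₁ := Index (q + 1) j)
    (Θ₀ := Index q j) (X₁ := fun i => GTensor 𝒜 i.1) (X₀ := fun i => GTensor 𝒜 i.1)
    (E₁ := fun _ => Fin q) (fun i t => i.merge t)
    (fun _ t => (-1 : k) ^ (t : ℕ)) (fun i t => mulMap 𝒜 (i.degEq_merge t)) := by
  unfold d Contraction.map
  congr 1
  funext i
  refine Finset.sum_congr rfl fun t _ => ?_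
  congr 2
  refine linearMap_ext 𝒜 fun a => ?_
  rw [PiTensorProduct.lift.tprod, mulMap_tprod]
  change PiTensorProduct.tprod k _ = _
  congr 1
  funext s
  apply Subtype.ext
  rw [coe_prodFun]
  exact (prod_mergePos t (fun r => (a r : A)) s).symm

theorem lof_congr {q j : ℕ} {i i' : Index q j} (h : i = i') {x : GTensor 𝒜 i.1}
    {x' : GTensor 𝒜 i'.1} (hx : mulMap 𝒜 (degEq_id fun t => by rw [h]) x = x') :
    DirectSum.lof k (Index q j) (fun i => GTensor 𝒜 i.1) i x =
      DirectSum.lof k (Index q j) (fun i => GTensor 𝒜 i.1) i' x' := by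
  subst h
  rw [← hx, mulMap_id 𝒜 rfl]

/-- The index of `A_1 ⊗ ⋯ ⊗ A_1 ⊗ A_m`. -/
def combIndex {a m N : ℕ} (h : a + m = N) (hm : 1 ≤ m) : Index (a + 1) N :=
  ⟨combDeg a m, fun t => by unfold combDeg; split_ifs <;> omega, by
    rw [Fin.sum_univ_castSucc]
    simp [combDeg, h]⟩

theorem lead_combDeg_le (a m : ℕ) : a ≤ lead (combDeg a m) :=
  le_lead (by omega) fun t ht => by simp [combDeg, ht]

theorem lead_combDeg {a m : ℕ} (hm : m ≠ 1) : lead (combDeg a m) = a :=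
  lead_eq (by omega) (fun t ht => by simp [combDeg, ht]) (by simp [combDeg, hm])

theorem eq_combIndex {a m N : ℕ} (h : a + m = N) (hm : 1 ≤ m) {i : Index (a + 1) N}
    (hi : a ≤ lead i.1) : i = combIndex h hm := by
  have h1 : ∀ t : Fin (a + 1), (t : ℕ) < a → i.1 t = combDeg a m t := fun t ht => by
    rw [eq_one_of_lt_lead (lt_of_lt_of_le ht hi)]
    simp [combDeg, ht]
  have h2 := i.2.2.trans (combIndex h hm).2.2.symm
  simp only [combIndex] at h2
  rw [Fin.sum_univ_castSucc, Fin.sum_univ_castSucc,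
    Finset.sum_congr rfl fun t _ => h1 t.castSucc t.2] at h2
  apply Subtype.ext
  funext t
  rcases lt_or_ge (t : ℕ) a with ht | ht
  · exact h1 t ht
  · have : t = Fin.last a := Fin.ext (by have := t.2; simp; omega)
    subst this
    exact Nat.add_left_cancel h2

/-- Split off `1` from the entry in position `r`. -/
def splitFun {q : ℕ} (i : Fin (q + 1) → ℕ) (r : Fin (q + 1)) (t : Fin (q + 2)) : ℕ :=
  if h : (t : ℕ) < r then i ⟨t, by omega⟩ else if (t : ℕ) = r then 1 else
    if (t : ℕ) = r + 1 then i r - 1 else i ⟨t - 1, by omega⟩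

theorem splitFun_of_lt {q : ℕ} (i : Fin (q + 1) → ℕ) {r : Fin (q + 1)} {t : Fin (q + 2)}
    (h : (t : ℕ) < r) : splitFun i r t = i ⟨t, by omega⟩ := by
  simp [splitFun, h]

theorem splitFun_of_gt {q : ℕ} (i : Fin (q + 1) → ℕ) {r : Fin (q + 1)} {t : Fin (q + 2)}
    (h : (r : ℕ) + 1 < t) : splitFun i r t = i ⟨t - 1, by omega⟩ := by
  have h1 : ¬ (t : ℕ) < r := by omega
  have h2 : ¬ (t : ℕ) = r := by omega
  have h3 : ¬ (t : ℕ) = r + 1 := by omega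
  simp [splitFun, h1, h2, h3]

theorem contractNth_splitFun {q : ℕ} (i : Fin (q + 1) → ℕ) {r : Fin (q + 1)} (hr : 2 ≤ i r) :
    Fin.contractNth r.castSucc (· + ·) (splitFun i r) = i := by
  funext s
  unfold Fin.contractNth
  split_ifs with h1 h2
  · rw [splitFun_of_lt i (by simpa using h1)]
    rfl
  · obtain rfl : s = r := Fin.ext h2
    simp [splitFun]
    omega
  · rw [splitFun_of_gt i (by simp at h1 h2 ⊢; omega)]
    rfl

/-- Split off `1` from the entry in position `r`. -/
def Index.splitAt {q j : ℕ} (i : Index (q + 1) j) (r : Fin (q + 1)) (hr : 2 ≤ i.1 r) :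
    Index (q + 2) j :=
  ⟨splitFun i.1 r, fun t => by
    have h1 := i.2.1
    unfold splitFun
    split_ifs
    exacts [h1 _, le_rfl, by omega, h1 _], by
    rw [← sum_contractNth r, contractNth_splitFun i.1 hr]
    exact i.2.2⟩

theorem Index.merge_splitAt {q j : ℕ} (i : Index (q + 1) j) (r : Fin (q + 1)) (hr : 2 ≤ i.1 r) :
    (i.splitAt r hr).merge r = i :=
  Subtype.ext (contractNth_splitFun i.1 hr)

theorem Index.lt_lead_splitAt {q j : ℕ} (i : Index (q + 1) j) (r : Fin (q + 1)) (hr : 2 ≤ i.1 r)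
    (h : lead i.1 = r) : (r : ℕ) < lead (i.splitAt r hr).1 := by
  refine le_lead (by omega) fun t ht => ?_
  rcases (Nat.lt_succ_iff.1 ht).lt_or_eq with h1 | h1
  · simp only [splitAt]
    rw [splitFun_of_lt i.1 h1]
    exact eq_one_of_lt_lead (by simp; omega)
  · simp [splitAt, splitFun, h1]

theorem bijective_sumElim_fin {p c n : ℕ} (h : p + c = n) : Function.Bijective
    (Sum.elim (fun t : Fin p => (⟨t, by omega⟩ : Fin n))
      (fun t : Fin c => (⟨p + t, by omega⟩ : Fin n))) := by
  subst h
  convert (finSumFinEquiv (m := p) (n := c)).bijective using 1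
  funext x
  rcases x with x | x <;> rfl

theorem sum_lead_lt {q j : ℕ} (i : Index (q + 1) j) (h : lead i.1 < q) :
    lead i.1 + i.1 ⟨lead i.1, by omega⟩ < j := by
  have h1 := i.2.2
  have h2 := (bijective_sumElim_fin (p := lead i.1 + 1) (c := q - lead i.1) (n := q + 1)
    (by omega)).sum_comp i.1
  rw [Fintype.sum_sum_type, Fin.sum_univ_castSucc, h1] at h2
  simp only [Sum.elim_inl, Sum.elim_inr, Fin.val_castSucc, Fin.val_last] at h2
  rw [Finset.sum_congr rfl (g := fun _ => 1) (fun t _ => eq_one_of_lt_lead (by simp))] at h2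
  have h3 := Finset.card_nsmul_le_sum (Finset.univ : Finset (Fin (q - lead i.1)))
    (fun t => i.1 ⟨lead i.1 + 1 + t, by omega⟩) 1 fun t _ => i.2.1 _
  simp only [Finset.sum_const, Finset.card_univ, Fintype.card_fin, smul_eq_mul, mul_one] at h2 h3
  omega

theorem exists_lift_splitAt {q j : ℕ} (hK : ∀ r m, 1 ≤ m → r + (m + 1) < j → KoszulLift 𝒜 r m)
    (i : Index (q + 1) j) (h : lead i.1 < q) :
    ∃ (i' : Index (q + 1 + 1) j) (r : Fin (q + 1)), ∀ x : GTensor 𝒜 i.1,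
      (∀ t : Fin q, (t : ℕ) < lead i.1 → mulMap 𝒜 (i.degEq_merge t) x = 0) →
      ∃ y : GTensor 𝒜 i'.1,
        DirectSum.lof k (Index (q + 1) j) (fun i => GTensor 𝒜 i.1) (i'.merge r)
          (mulMap 𝒜 (i'.degEq_merge r) y) =
        DirectSum.lof k (Index (q + 1) j) (fun i => GTensor 𝒜 i.1) i x ∧
        ∀ t, t ≠ r → mulMap 𝒜 (i'.degEq_merge t) y = 0 ∨ lead i.1 < lead (i'.merge t).1 := by
  have h1 := lead_spec i.1 (by omega)
  have h2 := i.2.1 ⟨lead i.1, by omega⟩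
  have h3 := sum_lead_lt i h
  obtain ⟨m, hm⟩ : ∃ m, i.1 ⟨lead i.1, by omega⟩ = m + 1 := ⟨_, (Nat.sub_add_cancel h2).symm⟩
  let r : Fin (q + 1) := ⟨lead i.1, by omega⟩
  have hr : 2 ≤ i.1 r := by show 2 ≤ i.1 ⟨lead i.1, by omega⟩; omega
  refine ⟨i.splitAt r hr, r, fun x hx => ?_⟩
  have hlead : lead i.1 < lead (i.splitAt r hr).1 := i.lt_lead_splitAt r hr rfl
  have hc := bijective_sumElim_fin (p := lead i.1 + 1) (c := q - lead i.1) (n := q + 1) (by omega)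
  have hc' := bijective_sumElim_fin (p := lead i.1 + 2) (c := q - lead i.1) (n := q + 2) (by omega)
  have hs : ∀ t : Fin (lead i.1 + 1), i.1 (Sum.elim (fun t : Fin (lead i.1 + 1) =>
      (⟨t, by omega⟩ : Fin (q + 1))) (fun t : Fin (q - lead i.1) => ⟨lead i.1 + 1 + t, by omega⟩)
      (Sum.inl t)) = combDeg (lead i.1) (m + 1) t := by
    intro t
    rcases Nat.lt_or_ge t (lead i.1) with ht | ht
    · simp only [Sum.elim_inl, combDeg, ht, if_true]
      exact eq_one_of_lt_lead ht
    · have ht' : (t : ℕ) = lead i.1 := by omega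
      simp only [Sum.elim_inl, combDeg, ht', lt_irrefl, if_false]
      exact hm
  have hs' : ∀ t : Fin (lead i.1 + 2), (i.splitAt r hr).1 (Sum.elim
      (fun t : Fin (lead i.1 + 2) => (⟨t, by omega⟩ : Fin (q + 2)))
      (fun t : Fin (q - lead i.1) => ⟨lead i.1 + 2 + t, by omega⟩) (Sum.inl t)) =
      combDeg (lead i.1 + 1) m t := by
    intro t
    rcases Nat.lt_or_ge t (lead i.1 + 1) with ht | ht
    · simp only [Sum.elim_inl, combDeg, ht, if_true]
      exact eq_one_of_lt_lead (lt_of_lt_of_le ht hlead)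
    · have ht' : (t : ℕ) = lead i.1 + 1 := by omega
      simp only [Sum.elim_inl, combDeg, ht', lt_irrefl, if_false]
      simp [Index.splitAt, splitFun, r, hm]
  have hκ : ∀ t : Fin (q - lead i.1), (i.splitAt r hr).1 (Sum.elim
      (fun t : Fin (lead i.1 + 2) => (⟨t, by omega⟩ : Fin (q + 2)))
      (fun t : Fin (q - lead i.1) => ⟨lead i.1 + 2 + t, by omega⟩) (Sum.inr t)) =
      i.1 (Sum.elim (fun t : Fin (lead i.1 + 1) => (⟨t, by omega⟩ : Fin (q + 1)))
        (fun t : Fin (q - lead i.1) => ⟨lead i.1 + 1 + t, by omega⟩) (Sum.inr t)) := by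
    intro t
    simp only [Sum.elim_inr, Index.splitAt]
    rw [splitFun_of_gt]
    · refine congrArg i.1 (Fin.ext ?_)
      simp only
      omega
    · simp only [r]
      omega
  obtain ⟨y, hy1, hy2, -⟩ := (hK (lead i.1) m (by omega) (by omega)).exists_lift 𝒜 hc hc' hs hs' hκ
    x fun t => killed_of_mulMap_eq_zero 𝒜 _ (hx ⟨t, by omega⟩ t.2) fun p p' hp =>
      eq_or_of_mergePos_eq hp
  refine ⟨y, lof_congr 𝒜 (i.merge_splitAt r hr) ?_, fun t ht => ?_⟩
  · rw [mulMap_comp 𝒜 _ _ (((i.splitAt r hr).degEq_merge r).comp (degEq_id fun t => by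
      rw [i.merge_splitAt r hr])) rfl]
    refine hy1 _ _ ?_
    funext z
    rcases z with z | z
    · apply Fin.ext
      simp only [Function.comp_apply, id, mergePos, Sum.elim_inl, Sum.map_inl, Fin.val_last, r]
      split_ifs <;> simp_all
    · apply Fin.ext
      have : ¬ (lead i.1 + 2 + (z : ℕ) ≤ lead i.1) := by omega
      simp only [Function.comp_apply, id, mergePos, Sum.elim_inr, Sum.map_inr, r, this,
        dif_neg, not_false_eq_true]
      omega
  · rcases lt_or_gt_of_ne ht with hlt | hgt
    · left
      refine (hy2 ⟨t, hlt⟩).mulMap_eq_zero 𝒜 ?_ _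
      exact (mergePos_castSucc t).trans (mergePos_succ t).symm
    · right
      rw [lead_merge]
      exact lt_min hgt hlead

theorem koszulLift_of_bar_exact (H : ∀ j q : ℕ, q ≠ j →
    HomologyVanishesAt (C := Chains 𝒜 j) (d 𝒜 j) q) {m : ℕ} (hm : 1 ≤ m) (a : ℕ) :
    KoszulLift 𝒜 a m := by
  induction hN : a + (m + 1) using Nat.strong_induction_on generalizing a m with
  | _ N ih =>
  intro w hw
  obtain ⟨c', hc'⟩ : ∃ c' : Index (a + 1) N, c'.1 = combDeg a (m + 1) :=
    ⟨combIndex hN (by omega), rfl⟩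
  have hlead' : lead c'.1 = a := by rw [hc', lead_combDeg (by omega)]
  have hdeg : DegEq id (combDeg a (m + 1)) c'.1 := degEq_id fun t => by rw [hc']
  obtain ⟨W, hW⟩ : ∃ W : Chains 𝒜 N (a + 1), W =
    DirectSum.lof k _ (fun i : Index (a + 1) N => GTensor 𝒜 i.1) c' (mulMap 𝒜 hdeg w) := ⟨_, rfl⟩
  have hW0 : ∀ i : Index (a + 1) N, lead i.1 < a → W i = 0 := by
    intro i hi
    rw [hW]
    refine Contraction.lof_apply_of_ne (k := k) (X₁ := fun i : Index (a + 1) N => GTensor 𝒜 i.1)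
      ?_ (mulMap 𝒜 hdeg w)
    rintro rfl
    omega
  have hdW : d 𝒜 N a W = 0 := by
    rw [d_eq_map, hW]
    refine (Contraction.map_lof _ _ _ _ _).trans (Finset.sum_eq_zero fun t _ => ?_)
    rw [mulMap_comp 𝒜 hdeg (c'.degEq_merge t) (hdeg.comp (c'.degEq_merge t)) rfl,
      (hw t).mulMap_eq_zero 𝒜 (by simp [mergePos_castSucc, mergePos_succ]), map_zero, smul_zero]
  obtain ⟨Y, hY⟩ := (H N (a + 1) (by omega) W).1 hdW
  have hdd : ∀ v, d 𝒜 N (a + 1) (d 𝒜 N (a + 1 + 1) v) = 0 := by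
    intro v
    rcases eq_or_ne (a + 1 + 1) N with h | h
    · have := isEmpty_index (q := a + 1 + 1 + 1) (j := N) (by omega)
      have : v = 0 := by
        refine DFinsupp.ext fun i => isEmptyElim i
      rw [this, map_zero, map_zero]
    · exact (H N (a + 1 + 1) h _).2 ⟨v, rfl⟩
  have := finite_index (a + 1 + 1) N
  rw [d_eq_map] at hY
  rw [d_eq_map, d_eq_map] at hdd
  have hK : ∀ r m, 1 ≤ m → r + (m + 1) < N → KoszulLift 𝒜 r m :=
    fun r m hm h => ih _ h hm r rfl
  have hstep : ∀ i : Index (a + 1 + 1) N, lead i.1 < a + 1 →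
      ∃ (i' : Index (a + 1 + 1 + 1) N) (r : Fin (a + 1 + 1)) (K : Set (Fin (a + 1))),
      (∀ t ∈ K, W (i.merge t) = 0 ∧ (∀ t', i.merge t' = i.merge t → t' = t) ∧
        ∀ (R : Index (a + 1 + 1) N) r, R.merge r = i.merge t → R ≠ i → lead R.1 < lead i.1) ∧
      ∀ x : GTensor 𝒜 i.1, (∀ t ∈ K, mulMap 𝒜 (i.degEq_merge t) x = 0) → ∃ y : GTensor 𝒜 i'.1,
        DirectSum.lof k (Index (a + 1 + 1) N) (fun i => GTensor 𝒜 i.1) (i'.merge r)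
          (mulMap 𝒜 (i'.degEq_merge r) y) =
        DirectSum.lof k (Index (a + 1 + 1) N) (fun i => GTensor 𝒜 i.1) i x ∧
        ∀ t, t ≠ r → mulMap 𝒜 (i'.degEq_merge t) y = 0 ∨ lead i.1 < lead (i'.merge t).1 := by
    intro i hi
    obtain ⟨i', r, hlift⟩ := exists_lift_splitAt 𝒜 hK i hi
    refine ⟨i', r, {t | (t : ℕ) < lead i.1}, fun t ht => ⟨?_, fun t' h => ?_, fun R r hR hne => ?_⟩,
      fun x hx => hlift x fun t ht => hx t ht⟩
    · exact hW0 _ (by rw [lead_merge, min_eq_left (le_of_lt ht)]; simp at ht; omega)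
    · have h1 := congrArg (fun i => lead i.1) h
      simp only [lead_merge] at h1
      simp only [Set.mem_ofPred_eq] at ht
      exact Fin.ext (by omega)
    · by_contra hle
      have h1 := congrArg (fun i => lead i.1) hR
      simp only [lead_merge] at h1
      simp only [Set.mem_ofPred_eq] at ht
      obtain rfl : r = t := Fin.ext (by omega)
      exact hne (Index.eq_of_merge_eq hR (by
        rw [eq_one_of_lt_lead (i := i.1) (by simpa using ht),
          eq_one_of_lt_lead (i := R.1) (by simp; omega)]))
  obtain ⟨v, hv⟩ := Contraction.elimination (k := k) (Θ₂ := Index (a + 1 + 1 + 1) N)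
    (Θ₁ := Index (a + 1 + 1) N) (Θ₀ := Index (a + 1) N) (X₂ := fun i => GTensor 𝒜 i.1)
    (X₁ := fun i => GTensor 𝒜 i.1) (X₀ := fun i => GTensor 𝒜 i.1)
    (E₂ := fun _ => Fin (a + 1 + 1)) (E₁ := fun _ => Fin (a + 1))
    (fun i : Index (a + 1 + 1) N => lead i.1)
    (fun i => lead i.1 < a + 1) (fun _ _ h h' => lt_of_le_of_lt h' h)
    (fun i t => i.merge t) (fun _ t => (-1 : k) ^ (t : ℕ)) (fun i t => mulMap 𝒜 (i.degEq_merge t))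
    (fun i t => i.merge t) (fun _ t => (-1 : k) ^ (t : ℕ)) (fun i t => mulMap 𝒜 (i.degEq_merge t))
    (fun _ _ => pow_ne_zero _ (by simp)) (fun _ _ => pow_ne_zero _ (by simp)) hdd W hstep Y hY
  obtain ⟨Z, hZ⟩ : ∃ Z, Z = Y + (-1 : k) • Contraction.map (k := k) (Θ₁ := Index (a + 1 + 1 + 1) N)
    (Θ₀ := Index (a + 1 + 1) N) (X₁ := fun i => GTensor 𝒜 i.1) (X₀ := fun i => GTensor 𝒜 i.1)
    (E₁ := fun _ => Fin (a + 1 + 1)) (fun i t => i.merge t)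
    (fun _ t => (-1 : k) ^ (t : ℕ)) (fun i t => mulMap 𝒜 (i.degEq_merge t)) v := ⟨_, rfl⟩
  rw [← hZ] at hv
  have hdZ : Contraction.map (k := k) (Θ₁ := Index (a + 1 + 1) N)
    (Θ₀ := Index (a + 1) N) (X₁ := fun i => GTensor 𝒜 i.1) (X₀ := fun i => GTensor 𝒜 i.1)
    (E₁ := fun _ => Fin (a + 1)) (fun i t => i.merge t)
    (fun _ t => (-1 : k) ^ (t : ℕ)) (fun i t => mulMap 𝒜 (i.degEq_merge t)) Z = W := by
    rw [hZ, map_add, map_smul, hdd v, hY, smul_zero, add_zero]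
  have hsum : (a + 1) + m = N := by omega
  obtain ⟨c, hc, hc1⟩ : ∃ c : Index (a + 1 + 1) N, c.1 = combDeg (a + 1) m ∧ c = combIndex hsum hm :=
    ⟨combIndex hsum hm, rfl, rfl⟩
  have hlead : a + 1 ≤ lead c.1 := by rw [hc]; exact lead_combDeg_le _ _
  have hcomp : ∀ t : Fin (a + 1), W (c.merge t) =
      (-1 : k) ^ (t : ℕ) • mulMap 𝒜 (c.degEq_merge t) (Z c) := by
    intro t
    rw [← hdZ]
    refine Contraction.map_apply_of_unique _ _ _ Z (fun t' h => ?_) fun R r _ hne => ?_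
    · have h1 := congrArg (fun i => lead i.1) h
      simp only [lead_merge] at h1
      exact Fin.ext (by omega)
    · refine hv R (not_le.1 fun hle => hne ?_)
      rw [hc1]
      exact eq_combIndex hsum hm hle
  have hdeg' : DegEq id c.1 (combDeg (a + 1) m) := degEq_id fun t => by rw [hc]
  have hmerge : c.merge (Fin.last a) = c' := by
    have : (c.merge (Fin.last a)).1 = combDeg a (m + 1) := by
      have h1 := degEq_mergePos_last a m
      rw [← hc] at h1
      exact (c.degEq_merge (Fin.last a)).unique h1
    exact Subtype.ext (this.trans hc'.symm)
  refine ⟨((-1 : k) ^ a) • mulMap 𝒜 hdeg' (Z c), ?_, fun t => ?_⟩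
  · have h1 := hcomp (Fin.last a)
    have hdeg2 : DegEq id (c.merge (Fin.last a)).1 (combDeg a (m + 1)) :=
      degEq_id fun t => by rw [hmerge, hc']
    have h2 : ∀ (i : Index (a + 1) N) (h : i = c') (h' : DegEq id i.1 (combDeg a (m + 1))),
        mulMap 𝒜 h' (W i) = w := by
      rintro i rfl h'
      have h3 : W i = mulMap 𝒜 hdeg w := by
        rw [hW]
        exact Contraction.lof_apply_self (k := k) (X₁ := fun i : Index (a + 1) N => GTensor 𝒜 i.1)
          i _
      rw [h3, mulMap_comp 𝒜 hdeg h' (degEq_id fun _ => rfl) rfl, mulMap_id 𝒜 rfl]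
    have h4 := h2 _ hmerge hdeg2
    rw [h1, map_smul, mulMap_comp 𝒜 _ hdeg2 ((c.degEq_merge (Fin.last a)).comp hdeg2) rfl] at h4
    rw [map_smul, mulMap_comp 𝒜 hdeg' (degEq_mergePos_last a m)
      ((c.degEq_merge (Fin.last a)).comp hdeg2) rfl]
    exact h4
  · have h1 := hcomp t.castSucc
    rw [hW0 _ (by rw [lead_merge]; simp)] at h1
    have h2 := Contraction.eq_zero_of_smul_eq_zero (pow_ne_zero _ (by simp)) h1.symm
    have h3 : Killed 𝒜 (Z c) t.castSucc.castSucc t.succ.castSucc := by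
      refine killed_of_mulMap_eq_zero 𝒜 _ h2 fun p p' hp => ?_
      exact eq_or_of_mergePos_eq hp
    rw [killed_iff] at h3 ⊢
    rw [map_smul]
    have h4 := ((killed_of_bijective 𝒜 Function.bijective_id hdeg').2 ((killed_iff 𝒜).2 h3))
    rw [show mulMap 𝒜 _ (mulMap 𝒜 hdeg' (Z c)) = 0 from (killed_iff 𝒜).1 h4, smul_zero]

end

end GradedBar

/-! ### The combinatorics of shuffle trees -/

namespace ShuffleTree

/-- The smallest leaf above a vertex. -/
noncomputable def mn (S : Finset ℕ) : ℕ := sInf (S : Set ℕ)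

theorem mn_mem {S : Finset ℕ} (h : S.Nonempty) : mn S ∈ S :=
  Finset.mem_coe.1 (Nat.sInf_mem (Finset.coe_nonempty.2 h))

theorem mn_le {S : Finset ℕ} {x : ℕ} (h : x ∈ S) : mn S ≤ x :=
  Nat.sInf_le (Finset.mem_coe.2 h)

theorem mn_eq {S : Finset ℕ} {x : ℕ} (hx : x ∈ S) (h : ∀ y ∈ S, x ≤ y) : mn S = x :=
  (mn_le hx).antisymm (h _ (mn_mem ⟨x, hx⟩))

theorem mn_anti {S R : Finset ℕ} (hS : S.Nonempty) (h : S ⊆ R) : mn R ≤ mn S :=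
  mn_le (h (mn_mem hS))

/-- The labels of the inputs of a vertex other than the smallest one. -/
noncomputable def labels (T : Finset (Finset ℕ)) (S : Finset ℕ) : Finset ℕ :=
  (inputs T S).erase (mn S)

theorem mem_labels {T : Finset (Finset ℕ)} {S : Finset ℕ} {x : ℕ} :
    x ∈ labels T S ↔ x ∈ S ∧ mn S < x ∧ ∀ R ∈ T, R ⊂ S → x ∈ R → mn R = x := by
  simp only [labels, inputs, Finset.mem_erase, Finset.mem_filter]
  constructor
  · rintro ⟨h1, h2, h3⟩
    exact ⟨h2, (mn_le h2).lt_of_ne' h1, fun R hR hRS hx => mn_eq hx (h3 R hR hRS hx)⟩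
  · rintro ⟨h1, h2, h3⟩
    refine ⟨h2.ne', h1, fun R hR hRS hx y hy => ?_⟩
    rw [← h3 R hR hRS hx]
    exact mn_le hy

theorem inputs_eq_insert {T : Finset (Finset ℕ)} {S : Finset ℕ} (hS : S.Nonempty) :
    inputs T S = insert (mn S) (labels T S) := by
  rw [labels, Finset.insert_erase]
  exact Finset.mem_filter.2 ⟨mn_mem hS, fun R _ hRS _ y hy => mn_le (hRS.1 hy)⟩

theorem card_labels {T : Finset (Finset ℕ)} {S : Finset ℕ} (hS : S.Nonempty) :
    (labels T S).card = (inputs T S).card - 1 := by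
  rw [inputs_eq_insert hS, Finset.card_insert_of_notMem (by simp [labels])]
  rfl

/-- The vertex `S` with parent `U` is good if the smallest leaf above `S` is the smallest leaf above
`U` and all other labels of `S` precede those of `U`. -/
def Good (T : Finset (Finset ℕ)) (S U : Finset ℕ) : Prop :=
  IsParent T S U ∧ mn S = mn U ∧ ∀ x ∈ labels T S, ∀ y ∈ labels T U, x < y

/-- The sum over all labels of the smallest leaves of the vertices they belong to. -/
noncomputable def weight (T : Finset (Finset ℕ)) : ℕ :=
  ∑ S ∈ T, (labels T S).card * mn S

/-- The pairs of labels which are in the wrong order on a path of vertices with the same smallest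
leaf. -/
def inversions (T : Finset (Finset ℕ)) : Set (ℕ × ℕ) :=
  {p | p.1 < p.2 ∧ ∃ R ∈ T, ∃ V ∈ T, R ⊂ V ∧ mn R = mn V ∧ p.1 ∈ labels T V ∧ p.2 ∈ labels T R}

/-- The labels which are not the largest label of their vertex. -/
def inner (T : Finset (Finset ℕ)) : Set ℕ :=
  {x | ∃ S ∈ T, x ∈ labels T S ∧ ∃ y ∈ labels T S, x < y}

/-- The part of the rank which does not change under the removal of good vertices. -/
noncomputable def coarseRank (T : Finset (Finset ℕ)) : ℤ ×ₗ ℤ :=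
  toLex (-(weight T : ℤ), -((inversions T).ncard : ℤ))

/-- The rank of a tree. -/
noncomputable def rank (T : Finset (Finset ℕ)) : (ℤ ×ₗ ℤ) ×ₗ ℕ :=
  toLex (coarseRank T, sInf (inner T))

theorem rank_lt_of_coarseRank_lt {T T' : Finset (Finset ℕ)} (h : coarseRank T < coarseRank T') :
    rank T < rank T' :=
  Prod.Lex.toLex_lt_toLex.2 (Or.inl h)

theorem rank_lt_of_coarseRank_eq {T T' : Finset (Finset ℕ)} (h : coarseRank T = coarseRank T')
    (h' : sInf (inner T) < sInf (inner T')) : rank T < rank T' :=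
  Prod.Lex.toLex_lt_toLex.2 (Or.inr ⟨h, h'⟩)

variable {I : Finset ℕ} {T : Finset (Finset ℕ)} {S U : Finset ℕ}

theorem _root_.IsTree.nonempty (hT : IsTree I T) (hS : S ∈ T) : S.Nonempty :=
  Finset.card_pos.1 (Nat.zero_lt_two.trans_le (hT.two_le_card S hS))

theorem eq_of_mem_labels (hT : IsTree I T) (hS : S ∈ T) (hU : U ∈ T) {x : ℕ}
    (hxS : x ∈ labels T S) (hxU : x ∈ labels T U) : S = U := by
  rw [mem_labels] at hxS hxU
  by_contra hne
  rcases hT.laminar S hS U hU with h | h | h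
  · exact hxS.2.1.ne (hxU.2.2 S hS (h.ssubset_of_ne hne) hxS.1)
  · exact hxU.2.1.ne (hxS.2.2 U hU (h.ssubset_of_ne (Ne.symm hne)) hxU.1)
  · exact Finset.disjoint_left.1 h hxS.1 hxU.1

theorem exists_mem_labels (hI : I ∈ T) {x : ℕ} (hx : x ∈ I) (hx' : mn I < x) :
    ∃ S ∈ T, x ∈ labels T S := by
  classical
  obtain ⟨S, hS, hmin⟩ := Finset.exists_min_image (T.filter fun V => x ∈ V ∧ mn V < x) Finset.card
    ⟨I, Finset.mem_filter.2 ⟨hI, hx, hx'⟩⟩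
  rw [Finset.mem_filter] at hS
  refine ⟨S, hS.1, mem_labels.2 ⟨hS.2.1, hS.2.2, fun R hR hRS hxR => ?_⟩⟩
  by_contra hne
  exact absurd (hmin R (Finset.mem_filter.2 ⟨hR, hxR, (mn_le hxR).lt_of_ne hne⟩))
    (not_le.2 (Finset.card_lt_card hRS))

theorem labels_nonempty (hT : IsTree I T) (hS : S ∈ T) : (labels T S).Nonempty := by
  classical
  obtain ⟨R₀, h1, h2, h3⟩ : ∃ R₀, mn S ∈ R₀ ∧ R₀ ⊂ S ∧ ∀ R ∈ T, R ⊂ S → ¬ Disjoint R R₀ → R ⊆ R₀ := by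
    have hmS := mn_mem (hT.nonempty hS)
    by_cases hF : (T.filter fun R => R ⊂ S ∧ mn S ∈ R).Nonempty
    · obtain ⟨R₀, hR₀, hmax⟩ := Finset.exists_max_image _ Finset.card hF
      rw [Finset.mem_filter] at hR₀
      refine ⟨R₀, hR₀.2.2, hR₀.2.1, fun R hR hRS hd => ?_⟩
      rcases hT.laminar R hR R₀ hR₀.1 with h | h | h
      · exact h
      · exact (Finset.eq_of_subset_of_card_le h
          (hmax R (Finset.mem_filter.2 ⟨hR, hRS, h hR₀.2.2⟩))).ge
      · exact absurd h hd
    · refine ⟨{mn S}, by simp, ?_, fun R hR hRS hd => ?_⟩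
      · refine (Finset.singleton_subset_iff.2 hmS).ssubset_of_ne fun h => ?_
        have := hT.two_le_card S hS
        rw [← h] at this
        simp at this
      · rw [Finset.disjoint_singleton_right, not_not] at hd
        exact absurd ⟨R, Finset.mem_filter.2 ⟨hR, hRS, hd⟩⟩ hF
  have hne : (S \ R₀).Nonempty := Finset.sdiff_nonempty.2 h2.2
  have hx := mn_mem hne
  rw [Finset.mem_sdiff] at hx
  refine ⟨mn (S \ R₀), mem_labels.2 ⟨hx.1, (mn_le hx.1).lt_of_ne ?_, fun R hR hRS hxR => ?_⟩⟩
  · intro h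
    rw [← h] at hx
    exact hx.2 h1
  · refine mn_eq hxR fun y hy => mn_le (Finset.mem_sdiff.2 ⟨hRS.1 hy, fun hy' => hx.2 ?_⟩)
    exact h3 R hR hRS (Finset.not_disjoint_iff.2 ⟨y, hy, hy'⟩) hxR

theorem sum_card_labels (hT : IsTree I T) (hI : I ∈ T) :
    ∑ S ∈ T, (labels T S).card = I.card - 1 := by
  classical
  rw [← Finset.card_biUnion, ← Finset.card_erase_of_mem (mn_mem (hT.nonempty hI))]
  · congr 1
    ext x
    rw [Finset.mem_biUnion, Finset.mem_erase]
    constructor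
    · rintro ⟨S, hS, hx⟩
      rw [mem_labels] at hx
      exact ⟨((mn_anti (hT.nonempty hS) (hT.subset S hS)).trans_lt hx.2.1).ne',
        hT.subset S hS hx.1⟩
    · rintro ⟨h1, h2⟩
      exact exists_mem_labels hI h2 ((mn_le h2).lt_of_ne' h1)
  · intro S hS R hR hne
    exact Finset.disjoint_left.2 fun x hx hx' => hne (eq_of_mem_labels hT hS hR hx hx')

theorem exists_inner (hT : IsTree I T) (hI : I ∈ T) (h : T.card ≠ I.card - 1) :
    (inner T).Nonempty := by
  by_contra hcon
  refine h ?_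
  rw [← sum_card_labels hT hI, Finset.card_eq_sum_ones]
  refine Finset.sum_congr rfl fun S hS => ?_
  obtain ⟨x, hx⟩ := labels_nonempty hT hS
  symm
  refine Finset.card_eq_one.2 ⟨x, Finset.eq_singleton_iff_unique_mem.2 ⟨hx, fun y hy => ?_⟩⟩
  by_contra hne
  rcases lt_or_gt_of_ne hne with hlt | hlt
  · exact hcon ⟨y, S, hS, hy, x, hx, hlt⟩
  · exact hcon ⟨x, S, hS, hx, y, hy, hlt⟩

theorem labels_erase_of_isParent (hT : IsTree I T) (hS : S ∈ T) (hU : IsParent T S U) :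
    labels (T.erase S) U = labels T U ∪ labels T S := by
  ext x
  simp only [Finset.mem_union, mem_labels]
  constructor
  · rintro ⟨h1, h2, h3⟩
    by_cases hxS : x ∈ S
    · rcases (mn_le hxS).lt_or_eq with h | h
      · exact Or.inr ⟨hxS, h, fun R hR hRS hxR =>
          h3 R (Finset.mem_erase.2 ⟨hRS.ne, hR⟩) (hRS.trans hU.2.1) hxR⟩
      · refine Or.inl ⟨h1, h2, fun R hR hRU hxR => ?_⟩
        by_cases hRS : R = S
        · rwa [hRS]
        · exact h3 R (Finset.mem_erase.2 ⟨hRS, hR⟩) hRU hxR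
    · refine Or.inl ⟨h1, h2, fun R hR hRU hxR => ?_⟩
      have hRS : R ≠ S := fun h => hxS (h ▸ hxR)
      exact h3 R (Finset.mem_erase.2 ⟨hRS, hR⟩) hRU hxR
  · rintro (⟨h1, h2, h3⟩ | ⟨h1, h2, h3⟩)
    · exact ⟨h1, h2, fun R hR => h3 R (Finset.mem_of_mem_erase hR)⟩
    · refine ⟨hU.2.1.1 h1, (mn_anti (hT.nonempty hS) hU.2.1.1).trans_lt h2, fun R hR hRU hxR => ?_⟩
      rw [Finset.mem_erase] at hR
      exact h3 R hR.2 (hT.ssubset_of_parent hU hS hR.2 hR.1 hRU h1 hxR) hxR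

theorem labels_erase_of_not_isParent (hT : IsTree I T) (hS : S ∈ T) {R : Finset ℕ} (hR : R ∈ T)
    (h : ¬ IsParent T S R) : labels (T.erase S) R = labels T R := by
  rw [labels, hT.inputs_erase hS hR h, labels]

theorem disjoint_labels (hT : IsTree I T) (hS : S ∈ T) (hU : U ∈ T) (hne : S ≠ U) :
    Disjoint (labels T S) (labels T U) :=
  Finset.disjoint_left.2 fun _ hx hx' => hne (eq_of_mem_labels hT hS hU hx hx')

theorem weight_erase (hT : IsTree I T) (hS : S ∈ T) (hU : IsParent T S U) :
    weight (T.erase S) + (labels T S).card * mn S = weight T + (labels T S).card * mn U := by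
  have h1 : weight T = (labels T S).card * mn S + ∑ R ∈ T.erase S, (labels T R).card * mn R :=
    (Finset.add_sum_erase _ _ hS).symm
  have h2 : weight (T.erase S) = ∑ R ∈ T.erase S, ((labels T R).card * mn R +
      if R = U then (labels T S).card * mn U else 0) := by
    refine Finset.sum_congr rfl fun R hR => ?_
    have hR' := Finset.mem_of_mem_erase hR
    split_ifs with h
    · subst h
      rw [labels_erase_of_isParent hT hS hU, Finset.card_union_of_disjoint
        (disjoint_labels hT hR' hS (Finset.ne_of_mem_erase hR)), add_mul]
    · rw [labels_erase_of_not_isParent hT hS hR' fun h' => h (h'.unique hU), add_zero]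
  rw [h2, h1, Finset.sum_add_distrib, Finset.sum_ite_eq',
    if_pos (Finset.mem_erase.2 ⟨hU.2.1.ne', hU.1⟩)]
  ring

/-- The labels of the tree with `S` removed. -/
theorem mem_labels_erase (hT : IsTree I T) (hS : S ∈ T) (hU : IsParent T S U) {R : Finset ℕ}
    (hR : R ∈ T) {x : ℕ} (hx : x ∈ labels (T.erase S) R) :
    x ∈ labels T R ∨ (R = U ∧ x ∈ labels T S) := by
  by_cases h : R = U
  · subst h
    rw [labels_erase_of_isParent hT hS hU, Finset.mem_union] at hx
    exact hx.imp_right fun h => ⟨rfl, h⟩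
  · rw [labels_erase_of_not_isParent hT hS hR fun h' => h (h'.unique hU)] at hx
    exact Or.inl hx

theorem labels_subset_erase (hT : IsTree I T) (hS : S ∈ T) (hU : IsParent T S U) {R : Finset ℕ}
    (hR : R ∈ T) : labels T R ⊆ labels (T.erase S) R := by
  by_cases h : R = U
  · subst h
    rw [labels_erase_of_isParent hT hS hU]
    exact Finset.subset_union_left
  · rw [labels_erase_of_not_isParent hT hS hR fun h' => h (h'.unique hU)]

theorem inversions_finite (hT : IsTree I T) : (inversions T).Finite := by
  refine (I ×ˢ I).finite_toSet.subset ?_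
  rintro ⟨x, y⟩ ⟨-, R, hR, V, hV, -, -, hx, hy⟩
  exact Finset.mem_coe.2 (Finset.mem_product.2
    ⟨hT.subset V hV (mem_labels.1 hx).1, hT.subset R hR (mem_labels.1 hy).1⟩)

theorem inversions_erase_subset (hT : IsTree I T) (hS : S ∈ T) (hU : IsParent T S U)
    (hmn : mn S = mn U) : inversions (T.erase S) ⊆ inversions T := by
  rintro ⟨x, y⟩ ⟨hxy, R, hR, V, hV, hRV, hm, hx, hy⟩
  rw [Finset.mem_erase] at hR hV
  refine ⟨hxy, ?_⟩
  rcases mem_labels_erase hT hS hU hV.2 hx with hx | ⟨rfl, hx⟩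
  · rcases mem_labels_erase hT hS hU hR.2 hy with hy | ⟨rfl, hy⟩
    · exact ⟨R, hR.2, V, hV.2, hRV, hm, hx, hy⟩
    · exact ⟨S, hS, V, hV.2, hU.2.1.trans hRV, hmn.trans hm, hx, hy⟩
  · rcases mem_labels_erase hT hS hU hR.2 hy with hy | ⟨rfl, hy⟩
    · refine ⟨R, hR.2, S, hS, ?_, hm.trans hmn.symm, hx, hy⟩
      refine hT.ssubset_of_parent hU hS hR.2 hR.1 hRV (mn_mem (hT.nonempty hS)) ?_
      rw [hmn, ← hm]
      exact mn_mem (hT.nonempty hR.2)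
    · exact absurd rfl hRV.ne

theorem inversions_erase_of_good (hT : IsTree I T) (hS : S ∈ T) (h : Good T S U) :
    inversions (T.erase S) = inversions T := by
  obtain ⟨hU, hmn, hlt⟩ := h
  refine (inversions_erase_subset hT hS hU hmn).antisymm ?_
  rintro ⟨x, y⟩ ⟨hxy, R, hR, V, hV, hRV, hm, hx, hy⟩
  refine ⟨hxy, ?_⟩
  have hSU : ∀ z ∈ labels T S, z ∈ labels (T.erase S) U := fun z hz => by
    rw [labels_erase_of_isParent hT hS hU]
    exact Finset.mem_union_right _ hz
  have hUT : U ∈ T.erase S := Finset.mem_erase.2 ⟨hU.2.1.ne', hU.1⟩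
  by_cases hVS : V = S
  · subst hVS
    refine ⟨R, Finset.mem_erase.2 ⟨hRV.ne, hR⟩, U, hUT, hRV.trans hU.2.1, hm.trans hmn,
      hSU x hx, labels_subset_erase hT hS hU hR hy⟩
  · by_cases hRS : R = S
    · subst hRS
      have hne : U ≠ V := by
        rintro rfl
        exact lt_asymm hxy (hlt y hy x hx)
      exact ⟨U, hUT, V, Finset.mem_erase.2 ⟨hVS, hV⟩, (hU.2.2 V hV hRV).ssubset_of_ne hne,
        hmn.symm.trans hm, labels_subset_erase hT hS hU hV hx, hSU y hy⟩
    · exact ⟨R, Finset.mem_erase.2 ⟨hRS, hR⟩, V, Finset.mem_erase.2 ⟨hVS, hV⟩, hRV, hm,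
        labels_subset_erase hT hS hU hV hx, labels_subset_erase hT hS hU hR hy⟩

theorem coarseRank_erase_of_good (hT : IsTree I T) (hS : S ∈ T) (h : Good T S U) :
    coarseRank (T.erase S) = coarseRank T := by
  have h1 := weight_erase hT hS h.1
  rw [h.2.1] at h1
  rw [coarseRank, inversions_erase_of_good hT hS h, Nat.add_right_cancel h1, coarseRank]

theorem lt_coarseRank_erase (hT : IsTree I T) (hS : S ∈ T) (hU : IsParent T S U)
    (h : ¬ Good T S U) : coarseRank T < coarseRank (T.erase S) := by
  have h1 := weight_erase hT hS hU
  rw [coarseRank, coarseRank, Prod.Lex.toLex_lt_toLex]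
  rcases (mn_anti (hT.nonempty hS) hU.2.1.1).lt_or_eq with hlt | hmn
  · left
    have h2 := Nat.mul_lt_mul_of_pos_left hlt (Finset.card_pos.2 (labels_nonempty hT hS))
    simp only
    omega
  · right
    refine ⟨by rw [hmn] at h1; simp only; omega, ?_⟩
    have h2 : (inversions (T.erase S)).ncard < (inversions T).ncard := by
      refine Set.ncard_lt_ncard ?_ (inversions_finite hT)
      refine ⟨inversions_erase_subset hT hS hU hmn.symm, fun hsub => h ⟨hU, hmn.symm, ?_⟩⟩
      intro x hx y hy
      by_contra hlt
      have hne : y ≠ x := by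
        rintro rfl
        exact hU.2.1.ne (eq_of_mem_labels hT hS hU.1 hx hy)
      obtain ⟨-, R, hR, V, hV, hRV, -, hy', hx'⟩ := hsub (show (y, x) ∈ inversions T from
        ⟨(not_lt.1 hlt).lt_of_ne hne, S, hS, U, hU.1, hU.2.1, hmn.symm, hy, hx⟩)
      have hUT : U ∈ T.erase S := Finset.mem_erase.2 ⟨hU.2.1.ne', hU.1⟩
      have hTe : IsTree I (T.erase S) := hT.erase fun h => hU.2.1.2 (h ▸ hT.subset U hU.1)
      have e1 := eq_of_mem_labels hTe hV hUT hy' (labels_subset_erase hT hS hU hU.1 hy)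
      have e2 := eq_of_mem_labels hTe hR hUT hx' (by
        rw [labels_erase_of_isParent hT hS hU]; exact Finset.mem_union_right _ hx)
      exact hRV.ne (e2.trans e1.symm)
    simp only
    omega

/-- A vertex is determined by its inputs, its parent and the tree from which it is removed. -/
theorem mem_iff_of_isParent (hT : IsTree I T) (hS : S ∈ T) (hU : IsParent T S U) {y : ℕ} :
    y ∈ S ↔ y ∈ U ∧ ∃ x ∈ inputs T S, y = x ∨ ∃ R ∈ T.erase S, R ⊂ U ∧ x ∈ R ∧ y ∈ R := by
  classical
  constructor
  · intro hy
    refine ⟨hU.2.1.1 hy, ?_⟩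
    by_cases hF : (T.filter fun R => R ⊂ S ∧ y ∈ R).Nonempty
    · obtain ⟨R, hR, hmax⟩ := Finset.exists_max_image _ Finset.card hF
      rw [Finset.mem_filter] at hR
      have hm := mn_mem (hT.nonempty hR.1)
      refine ⟨mn R, Finset.mem_filter.2 ⟨hR.2.1.1 hm, fun R' hR' hR'S hm' z hz => ?_⟩, Or.inr
        ⟨R, Finset.mem_erase.2 ⟨hR.2.1.ne, hR.1⟩, hR.2.1.trans hU.2.1, hm, hR.2.2⟩⟩
      rcases hT.laminar R' hR' R hR.1 with h | h | h
      · exact mn_le (h hz)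
      · rw [← Finset.eq_of_subset_of_card_le h
          (hmax R' (Finset.mem_filter.2 ⟨hR', hR'S, h hR.2.2⟩))] at hz
        exact mn_le hz
      · exact absurd hm (Finset.disjoint_left.1 h hm')
    · exact ⟨y, Finset.mem_filter.2 ⟨hy, fun R hR hRS hyR =>
        absurd ⟨R, Finset.mem_filter.2 ⟨hR, hRS, hyR⟩⟩ hF⟩, Or.inl rfl⟩
  · rintro ⟨-, x, hx, rfl | ⟨R, hR, hRU, hxR, hyR⟩⟩
    · exact (Finset.mem_filter.1 hx).1
    · rw [Finset.mem_erase] at hR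
      exact (hT.ssubset_of_parent hU hS hR.2 hR.1 hRU (Finset.mem_filter.1 hx).1 hxR).1 hyR

theorem le_of_lt_of_mem_labels (hS : S ∈ T) {x y : ℕ} (hx : x ∈ labels T S) (hy : y ∈ labels T S)
    (hxy : x < y) : sInf (inner T) ≤ x :=
  Nat.sInf_le ⟨S, hS, hx, y, hy, hxy⟩

/-- A good vertex all of whose labels precede the smallest inner label has just one label. -/
theorem labels_eq_singleton (hT : IsTree I T) (hS : S ∈ T)
    (hlt : ∀ x ∈ labels T S, x < sInf (inner T)) : ∃ x, labels T S = {x} := by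
  obtain ⟨x, hx⟩ := labels_nonempty hT hS
  refine ⟨x, Finset.eq_singleton_iff_unique_mem.2 ⟨hx, fun y hy => ?_⟩⟩
  by_contra hne
  rcases lt_or_gt_of_ne hne with h | h
  · exact absurd (le_of_lt_of_mem_labels hS hy hx h) (not_le.2 (hlt y hy))
  · exact absurd (le_of_lt_of_mem_labels hS hx hy h) (not_le.2 (hlt x hx))

/-- Among the trees which become equal to a given tree after the removal of a vertex, the one where
the removed vertex is good with small labels has the largest rank. -/
theorem rank_lt_of_erase_eq (hT : IsTree I T) (hS : S ∈ T) (h : Good T S U)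
    (hlt : ∀ x ∈ labels T S, x < sInf (inner T)) {T' : Finset (Finset ℕ)} (hT' : IsTree I T')
    {R : Finset ℕ} (hR : R ∈ T') (hRI : R ≠ I) (he : T'.erase R = T.erase S) (hne : T' ≠ T) :
    rank T' < rank T := by
  have hW := coarseRank_erase_of_good hT hS h
  obtain ⟨V, hV⟩ := hT'.exists_parent hR hRI
  by_cases hg : Good T' R V
  swap
  · refine rank_lt_of_coarseRank_lt ?_
    rw [← hW, ← he]
    exact lt_coarseRank_erase hT' hR hV hg
  have hW' := coarseRank_erase_of_good hT' hR hg
  refine rank_lt_of_coarseRank_eq (by rw [← hW', ← hW, he]) ?_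
  obtain ⟨x, hx⟩ := labels_eq_singleton hT hS hlt
  have hxj := hlt x (by simp [hx])
  suffices hs : ∃ Q ∈ T', x ∈ labels T' Q ∧ ∃ y ∈ labels T' Q, y ≠ x ∧ y ∈ labels (T.erase S) U by
    obtain ⟨Q, hQ, hxQ, y, hyQ, hyx, hyU⟩ := hs
    refine (le_of_lt_of_mem_labels hQ hxQ hyQ ?_).trans_lt hxj
    rw [labels_erase_of_isParent hT hS h.1, Finset.mem_union, hx, Finset.mem_singleton] at hyU
    exact h.2.2 x (by simp [hx]) y (hyU.resolve_right hyx)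
  have hUT : U ∈ T.erase S := Finset.mem_erase.2 ⟨h.1.2.1.ne', h.1.1⟩
  have hTe : IsTree I (T.erase S) := hT.erase fun h' => h.1.2.1.2 (h' ▸ hT.subset U h.1.1)
  have hxU : x ∈ labels (T.erase S) U := by
    rw [labels_erase_of_isParent hT hS h.1, hx]
    simp
  have hUT' : U ∈ T' := by rw [← he] at hUT; exact Finset.mem_of_mem_erase hUT
  have hVT : V ∈ T.erase S := by rw [← he]; exact Finset.mem_erase.2 ⟨hV.2.1.ne', hV.1⟩
  have hRV : labels (T.erase S) V = labels T' V ∪ labels T' R := by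
    rw [← he, labels_erase_of_isParent hT' hR hV]
  have hxU' := hxU
  rw [← he] at hxU'
  obtain ⟨y, hy⟩ := labels_nonempty hT h.1.1
  have hxy : x < y := h.2.2 x (by simp [hx]) y hy
  rcases mem_labels_erase hT' hR hV hUT' hxU' with hxT' | ⟨rfl, hxR⟩
  · by_cases hUV : U = V
    · subst hUV
      obtain ⟨z, hz⟩ := labels_nonempty hT' hR
      have h1 := hg.2.2 z hz x hxT'
      have h2 : z ∈ labels (T.erase S) U := by rw [hRV]; exact Finset.mem_union_right _ hz
      rw [labels_erase_of_isParent hT hS h.1, Finset.mem_union, hx, Finset.mem_singleton] at h2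
      rcases h2 with h2 | h2
      · exact absurd (h.2.2 x (by simp [hx]) z h2) (lt_asymm h1)
      · exact absurd h2 h1.ne
    · have h1 := labels_subset_erase hT hS h.1 h.1.1 hy
      refine ⟨U, hUT', hxT', y, ?_, hxy.ne', h1⟩
      rw [← he] at h1
      exact (mem_labels_erase hT' hR hV hUT' h1).resolve_right fun h' => hUV h'.1
  · by_cases hex : ∃ z ∈ labels T' R, z ≠ x
    · obtain ⟨z, hz, hzx⟩ := hex
      exact ⟨R, hR, hxR, z, hz, hzx, by rw [hRV]; exact Finset.mem_union_right _ hz⟩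
    · push Not at hex
      have hRx : labels T' R = {x} := Finset.eq_singleton_iff_unique_mem.2 ⟨hxR, hex⟩
      have hRS : R = S := by
        ext y
        rw [mem_iff_of_isParent hT' hR hV, mem_iff_of_isParent hT hS h.1, he,
          inputs_eq_insert (hT'.nonempty hR), inputs_eq_insert (hT.nonempty hS), hx, hRx, hg.2.1,
          h.2.1]
      refine absurd ?_ hne
      rw [← Finset.insert_erase hR, he, hRS, Finset.insert_erase hS]

end ShuffleTree

namespace ShuffleTree

/-- The vertex `U` has a smallest label `j`, which is not its only label. -/
structure Splits (T : Finset (Finset ℕ)) (U : Finset ℕ) (j : ℕ) : Prop where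
  mem : U ∈ T
  mem_labels : j ∈ labels T U
  le : ∀ x ∈ labels T U, j ≤ x
  exists_lt : ∃ x ∈ labels T U, j < x

open Classical in
/-- The leaves above the first two inputs of the vertex `U`. -/
noncomputable def pairVertex (T : Finset (Finset ℕ)) (U : Finset ℕ) (j : ℕ) : Finset ℕ :=
  {y ∈ U | y = mn U ∨ y = j ∨ ∃ R ∈ T, R ⊂ U ∧ y ∈ R ∧ (mn U ∈ R ∨ j ∈ R)}

/-- Split off a vertex from `U` which has the first two inputs of `U` as inputs. -/
noncomputable def splitTree (T : Finset (Finset ℕ)) (U : Finset ℕ) (j : ℕ) : Finset (Finset ℕ) :=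
  insert (pairVertex T U j) T

variable {I : Finset ℕ} {T : Finset (Finset ℕ)} {S U : Finset ℕ} {j : ℕ}

theorem mem_pairVertex {y : ℕ} : y ∈ pairVertex T U j ↔
    y ∈ U ∧ (y = mn U ∨ y = j ∨ ∃ R ∈ T, R ⊂ U ∧ y ∈ R ∧ (mn U ∈ R ∨ j ∈ R)) := by
  simp [pairVertex]

theorem exists_splits (hT : IsTree I T) (hI : I ∈ T) (h : T.card ≠ I.card - 1) :
    ∃ U, Splits T U (sInf (inner T)) := by
  obtain ⟨U, hU, hj, y, hy, hlt⟩ := Nat.sInf_mem (exists_inner hT hI h)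
  refine ⟨U, hU, hj, fun x hx => ?_, y, hy, hlt⟩
  by_contra hcon
  exact hcon (le_of_lt_of_mem_labels hU hx hj (not_le.1 hcon))

namespace Splits

theorem mn_lt (h : Splits T U j) : mn U < j := (ShuffleTree.mem_labels.1 h.mem_labels).2.1

theorem mem_self (h : Splits T U j) : j ∈ U := (ShuffleTree.mem_labels.1 h.mem_labels).1

theorem mn_mem (h : Splits T U j) : mn U ∈ U := ShuffleTree.mn_mem ⟨j, h.mem_self⟩

theorem mn_mem_pairVertex (h : Splits T U j) : mn U ∈ pairVertex T U j :=
  mem_pairVertex.2 ⟨h.mn_mem, Or.inl rfl⟩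

theorem mem_pairVertex_self (h : Splits T U j) : j ∈ pairVertex T U j :=
  mem_pairVertex.2 ⟨h.mem_self, Or.inr (Or.inl rfl)⟩

theorem _root_.ShuffleTree.pairVertex_subset : pairVertex T U j ⊆ U :=
  fun _ hy => (mem_pairVertex.1 hy).1

theorem mn_pairVertex (h : Splits T U j) : mn (pairVertex T U j) = mn U :=
  mn_eq h.mn_mem_pairVertex fun _ hy => mn_le (pairVertex_subset hy)

theorem mn_eq_of_mem (h : Splits T U j) {R : Finset ℕ} (hR : R ∈ T) (hRU : R ⊂ U) (hj : j ∈ R) :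
    mn R = j :=
  (ShuffleTree.mem_labels.1 h.mem_labels).2.2 R hR hRU hj

theorem pairVertex_ssubset (h : Splits T U j) : pairVertex T U j ⊂ U := by
  obtain ⟨y, hy, hlt⟩ := h.exists_lt
  rw [ShuffleTree.mem_labels] at hy
  refine ⟨pairVertex_subset, fun hsub => ?_⟩
  obtain ⟨-, rfl | rfl | ⟨R, hR, hRU, hyR, hm | hm⟩⟩ := mem_pairVertex.1 (hsub hy.1)
  · exact lt_irrefl _ hy.2.1
  · exact lt_irrefl _ hlt
  · have h1 := hy.2.2 R hR hRU hyR
    have h2 := mn_le hm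
    exact absurd hy.2.1 (not_lt.2 (h1 ▸ h2))
  · exact hlt.ne ((h.mn_eq_of_mem hR hRU hm).symm.trans (hy.2.2 R hR hRU hyR))

theorem subset_pairVertex {R : Finset ℕ} (hR : R ∈ T) (hRU : R ⊂ U) (hm : mn U ∈ R ∨ j ∈ R) :
    R ⊆ pairVertex T U j :=
  fun _ hy => mem_pairVertex.2 ⟨hRU.1 hy, Or.inr (Or.inr ⟨R, hR, hRU, hy, hm⟩)⟩

theorem subset_or_disjoint (hT : IsTree I T) {R : Finset ℕ} (hR : R ∈ T) (hRU : R ⊂ U) :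
    R ⊆ pairVertex T U j ∨ Disjoint R (pairVertex T U j) := by
  by_cases hm : mn U ∈ R ∨ j ∈ R
  · exact Or.inl (subset_pairVertex hR hRU hm)
  rw [or_iff_not_imp_right, Finset.not_disjoint_iff]
  rintro ⟨y, hyR, hyP⟩
  obtain ⟨-, rfl | rfl | ⟨R', hR', hRU', hyR', hm'⟩⟩ := mem_pairVertex.1 hyP
  · exact absurd (Or.inl hyR) hm
  · exact absurd (Or.inr hyR) hm
  · rcases hT.laminar R hR R' hR' with h1 | h1 | h1
    · exact h1.trans (subset_pairVertex hR' hRU' hm')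
    · exact absurd (hm'.imp (fun h => h1 h) fun h => h1 h) hm
    · exact absurd hyR' (Finset.disjoint_left.1 h1 hyR)

theorem pairVertex_notMem (h : Splits T U j) : pairVertex T U j ∉ T := fun hP => by
  have h1 := h.mn_eq_of_mem hP h.pairVertex_ssubset h.mem_pairVertex_self
  rw [h.mn_pairVertex] at h1
  exact h.mn_lt.ne h1

theorem laminar_pairVertex (hT : IsTree I T) (h : Splits T U j) {R : Finset ℕ} (hR : R ∈ T) :
    R ⊆ pairVertex T U j ∨ U ⊆ R ∨ Disjoint R (pairVertex T U j) := by
  rcases hT.laminar R hR U h.mem with h1 | h1 | h1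
  · rcases eq_or_ne R U with rfl | hne
    · exact Or.inr (Or.inl subset_rfl)
    · exact (subset_or_disjoint hT hR (h1.ssubset_of_ne hne)).imp_right Or.inr
  · exact Or.inr (Or.inl h1)
  · exact Or.inr (Or.inr (h1.mono_right pairVertex_subset))

theorem isTree (hT : IsTree I T) (h : Splits T U j) : IsTree I (splitTree T U j) where
  subset R hR := by
    rcases Finset.mem_insert.1 hR with rfl | hR
    · exact pairVertex_subset.trans (hT.subset U h.mem)
    · exact hT.subset R hR
  two_le_card R hR := by
    rcases Finset.mem_insert.1 hR with rfl | hR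
    · exact Finset.one_lt_card.2
        ⟨_, h.mn_mem_pairVertex, _, h.mem_pairVertex_self, h.mn_lt.ne⟩
    · exact hT.two_le_card R hR
  root_mem hI := Finset.mem_insert_of_mem (hT.root_mem hI)
  laminar R hR R' hR' := by
    rcases Finset.mem_insert.1 hR with rfl | hR <;> rcases Finset.mem_insert.1 hR' with rfl | hR'
    · exact Or.inl subset_rfl
    · rcases h.laminar_pairVertex hT hR' with h1 | h1 | h1
      · exact Or.inr (Or.inl h1)
      · exact Or.inl (pairVertex_subset.trans h1)
      · exact Or.inr (Or.inr h1.symm)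
    · rcases h.laminar_pairVertex hT hR with h1 | h1 | h1
      · exact Or.inl h1
      · exact Or.inr (Or.inl (pairVertex_subset.trans h1))
      · exact Or.inr (Or.inr h1)
    · exact hT.laminar R hR R' hR'

theorem pairVertex_mem : pairVertex T U j ∈ splitTree T U j := Finset.mem_insert_self _ _

theorem mem_splitTree {R : Finset ℕ} (hR : R ∈ T) : R ∈ splitTree T U j :=
  Finset.mem_insert_of_mem hR

theorem erase_splitTree (h : Splits T U j) : (splitTree T U j).erase (pairVertex T U j) = T :=
  Finset.erase_insert h.pairVertex_notMem

theorem isParent (hT : IsTree I T) (h : Splits T U j) :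
    IsParent (splitTree T U j) (pairVertex T U j) U := by
  refine ⟨mem_splitTree h.mem, h.pairVertex_ssubset, fun R hR hPR => ?_⟩
  rcases Finset.mem_insert.1 hR with rfl | hR
  · exact absurd rfl hPR.ne
  · rcases h.laminar_pairVertex hT hR with h1 | h1 | h1
    · exact absurd h1 hPR.2
    · exact h1
    · exact absurd h.mem_pairVertex_self (Finset.disjoint_left.1 h1 (hPR.1 h.mem_pairVertex_self))

theorem labels_pairVertex (h : Splits T U j) :
    labels (splitTree T U j) (pairVertex T U j) = {j} := by
  ext x
  rw [Finset.mem_singleton, ShuffleTree.mem_labels, h.mn_pairVertex]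
  constructor
  · rintro ⟨hxP, hlt, hx⟩
    by_contra hne
    obtain ⟨-, rfl | rfl | ⟨R, hR, hRU, hxR, hm⟩⟩ := mem_pairVertex.1 hxP
    · exact lt_irrefl _ hlt
    · exact hne rfl
    · have h1 := hx R (mem_splitTree hR) ((subset_pairVertex hR hRU hm).ssubset_of_ne
        fun he => h.pairVertex_notMem (he ▸ hR)) hxR
      rcases hm with hm | hm
      · exact absurd hlt (not_lt.2 (h1 ▸ mn_le hm))
      · exact hne (h1.symm.trans (h.mn_eq_of_mem hR hRU hm))
  · rintro rfl
    refine ⟨h.mem_pairVertex_self, h.mn_lt, fun R hR hRP hxR => ?_⟩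
    rcases Finset.mem_insert.1 hR with rfl | hR
    · exact absurd rfl hRP.ne
    · exact h.mn_eq_of_mem hR (hRP.trans h.pairVertex_ssubset) hxR

theorem labels_splitTree (hT : IsTree I T) (h : Splits T U j) :
    labels (splitTree T U j) U = (labels T U).erase j := by
  have h1 := labels_erase_of_isParent (h.isTree hT) pairVertex_mem (h.isParent hT)
  have h2 := disjoint_labels (h.isTree hT) pairVertex_mem (mem_splitTree h.mem)
    h.pairVertex_ssubset.ne
  rw [h.erase_splitTree, h.labels_pairVertex] at h1
  rw [h.labels_pairVertex, Finset.disjoint_singleton_left] at h2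
  rw [h1, Finset.erase_union_distrib, Finset.erase_eq_of_notMem h2]
  simp

theorem labels_splitTree_of_ne (hT : IsTree I T) (h : Splits T U j) (hS : S ∈ T) (hne : S ≠ U) :
    labels (splitTree T U j) S = labels T S := by
  conv_rhs => rw [← h.erase_splitTree]
  exact (labels_erase_of_not_isParent (h.isTree hT) pairVertex_mem (mem_splitTree hS)
    fun h' => hne (h'.unique (h.isParent hT))).symm

theorem labels_splitTree_subset (hT : IsTree I T) (h : Splits T U j) (hS : S ∈ T) :
    labels (splitTree T U j) S ⊆ labels T S := by
  by_cases hne : S = U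
  · subst hne
    rw [h.labels_splitTree hT]
    exact Finset.erase_subset _ _
  · rw [h.labels_splitTree_of_ne hT hS hne]

theorem good (hT : IsTree I T) (h : Splits T U j) :
    Good (splitTree T U j) (pairVertex T U j) U := by
  refine ⟨h.isParent hT, h.mn_pairVertex, fun x hx y hy => ?_⟩
  rw [h.labels_pairVertex, Finset.mem_singleton] at hx
  rw [h.labels_splitTree hT, Finset.mem_erase] at hy
  rw [hx]
  exact (h.le y hy.2).lt_of_ne' hy.1

theorem coarseRank_splitTree (hT : IsTree I T) (h : Splits T U j) :
    coarseRank (splitTree T U j) = coarseRank T := by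
  rw [← coarseRank_erase_of_good (h.isTree hT) pairVertex_mem (h.good hT), h.erase_splitTree]

theorem isParent_of_isParent_splitTree {V : Finset ℕ}
    (hV : IsParent (splitTree T U j) S V) (hne : V ≠ pairVertex T U j) : IsParent T S V :=
  ⟨(Finset.mem_insert.1 hV.1).resolve_left hne, hV.2.1, fun R hR => hV.2.2 R (mem_splitTree hR)⟩

theorem isParent_of_isParent_pairVertex (hT : IsTree I T) (h : Splits T U j)
    (hV : IsParent (splitTree T U j) S (pairVertex T U j)) : IsParent T S U := by
  refine ⟨h.mem, hV.2.1.trans h.pairVertex_ssubset, fun R hR hSR => ?_⟩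
  refine (h.isParent hT).2.2 R (mem_splitTree hR) ((hV.2.2 R (mem_splitTree hR) hSR).ssubset_of_ne ?_)
  rintro rfl
  exact h.pairVertex_notMem hR

theorem isParent_splitTree (hT : IsTree I T) (h : Splits T U j) (hS : S ∈ T) {V : Finset ℕ}
    (hV : IsParent T S V) (hne : V ≠ U) : IsParent (splitTree T U j) S V := by
  obtain ⟨W, hW⟩ := (h.isTree hT).exists_parent (mem_splitTree hS)
    fun h' => hV.2.1.2 (h' ▸ hT.subset V hV.1)
  by_cases hWP : W = pairVertex T U j
  · subst hWP
    exact absurd (hV.unique (h.isParent_of_isParent_pairVertex hT hW)) hne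
  · rwa [hV.unique (isParent_of_isParent_splitTree hW hWP)]

theorem isParent_pairVertex (hT : IsTree I T) (h : Splits T U j) (hS : S ∈ T)
    (hU : IsParent T S U) (hmn : mn S = mn U) :
    IsParent (splitTree T U j) S (pairVertex T U j) := by
  obtain ⟨W, hW⟩ := (h.isTree hT).exists_parent (mem_splitTree hS)
    fun h' => hU.2.1.2 (h' ▸ hT.subset U hU.1)
  by_cases hWP : W = pairVertex T U j
  · rwa [← hWP]
  · obtain rfl := hU.unique (isParent_of_isParent_splitTree hW hWP)
    have h1 : S ⊆ pairVertex T U j := subset_pairVertex hS hU.2.1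
      (Or.inl (hmn ▸ ShuffleTree.mn_mem (hT.nonempty hS)))
    have h2 := hW.2.2 _ pairVertex_mem (h1.ssubset_of_ne fun he => h.pairVertex_notMem (he ▸ hS))
    exact absurd h2 h.pairVertex_ssubset.2

/-- A good vertex of the split tree with small labels is good in the original tree. -/
theorem good_of_good_splitTree (hT : IsTree I T) (h : Splits T U j) (hS : S ∈ T) {V : Finset ℕ}
    (hg : Good (splitTree T U j) S V) (hlt : ∀ x ∈ labels (splitTree T U j) S, x < j) :
    (∀ x ∈ labels T S, x < j) ∧ ∃ W, Good T S W := by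
  have hSU : S ≠ U := by
    rintro rfl
    obtain ⟨y, hy, hjy⟩ := h.exists_lt
    refine lt_asymm hjy (hlt y ?_)
    rw [h.labels_splitTree hT]
    exact Finset.mem_erase.2 ⟨hjy.ne', hy⟩
  have hgl := hg.2.2
  rw [h.labels_splitTree_of_ne hT hS hSU] at hlt hgl
  refine ⟨hlt, ?_⟩
  by_cases hVP : V = pairVertex T U j
  · subst hVP
    exact ⟨U, h.isParent_of_isParent_pairVertex hT hg.1, hg.2.1.trans h.mn_pairVertex,
      fun x hx y hy => (hlt x hx).trans_le (h.le y hy)⟩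
  · have hp := isParent_of_isParent_splitTree hg.1 hVP
    refine ⟨V, hp, hg.2.1, fun x hx y hy => ?_⟩
    by_cases hVU : V = U
    · subst hVU
      exact (hlt x hx).trans_le (h.le y hy)
    · rw [h.labels_splitTree_of_ne hT hp.1 hVU] at hgl
      exact hgl x hx y hy

/-- The removal of a vertex of the split tree other than the new vertex and the good vertices with
small labels increases the rank. -/
theorem rank_lt_erase (hT : IsTree I T) (h : Splits T U (sInf (inner T))) {R : Finset ℕ}
    (hR : R ∈ splitTree T U (sInf (inner T))) (hRI : R ≠ I)
    (hRP : R ≠ pairVertex T U (sInf (inner T)))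
    (hK : ¬ ((∃ W, Good T R W) ∧ ∀ x ∈ labels T R, x < sInf (inner T))) :
    rank T < rank ((splitTree T U (sInf (inner T))).erase R) := by
  have hT' := h.isTree hT
  obtain ⟨V, hV⟩ := hT'.exists_parent hR hRI
  by_cases hg : Good (splitTree T U (sInf (inner T))) R V
  swap
  · refine rank_lt_of_coarseRank_lt ?_
    rw [← h.coarseRank_splitTree hT]
    exact lt_coarseRank_erase hT' hR hV hg
  refine rank_lt_of_coarseRank_eq ((h.coarseRank_splitTree hT).symm.trans
    (coarseRank_erase_of_good hT' hR hg).symm) ?_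
  have hRT := (Finset.mem_insert.1 hR).resolve_left hRP
  have hne : ∀ Q ∈ T, ∀ x ∈ labels (splitTree T U (sInf (inner T))) Q, x ≠ sInf (inner T) := by
    rintro Q hQ x hx rfl
    refine h.pairVertex_notMem (eq_of_mem_labels hT' (mem_splitTree hQ) pairVertex_mem hx ?_ ▸ hQ)
    rw [h.labels_pairVertex, Finset.mem_singleton]
  have hle : ∀ Q ∈ T, ∀ x ∈ labels (splitTree T U (sInf (inner T))) Q,
      ∀ y ∈ labels (splitTree T U (sInf (inner T))) Q, x < y → sInf (inner T) < x :=
    fun Q hQ x hx y hy hxy => (le_of_lt_of_mem_labels hQ (h.labels_splitTree_subset hT hQ hx)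
      (h.labels_splitTree_subset hT hQ hy) hxy).lt_of_ne' (hne Q hQ x hx)
  obtain ⟨z, hz, hjz⟩ : ∃ z ∈ labels (splitTree T U (sInf (inner T))) R, sInf (inner T) < z := by
    by_contra! hcon
    have hlt := fun x hx => (hcon x hx).lt_of_ne (hne R hRT x hx)
    obtain ⟨h1, h2⟩ := h.good_of_good_splitTree hT hRT hg hlt
    exact hK ⟨h2, h1⟩
  have hRall : ∀ x ∈ labels (splitTree T U (sInf (inner T))) R, sInf (inner T) < x := by
    intro x hx
    rcases lt_or_ge (sInf (inner T)) x with h1 | h1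
    · exact h1
    · exact hle R hRT x hx z hz (h1.trans_lt hjz)
  have hVall : ∀ x ∈ labels (splitTree T U (sInf (inner T))) V, sInf (inner T) < x :=
    fun x hx => hjz.trans (hg.2.2 z hz x hx)
  have hVe : V ∈ (splitTree T U (sInf (inner T))).erase R :=
    Finset.mem_erase.2 ⟨hV.2.1.ne', hV.1⟩
  have hnonempty : (inner ((splitTree T U (sInf (inner T))).erase R)).Nonempty := by
    obtain ⟨y, hy⟩ := labels_nonempty hT' hV.1
    refine ⟨z, V, hVe, ?_, y, ?_, hg.2.2 z hz y hy⟩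
    · rw [labels_erase_of_isParent hT' hR hV]; exact Finset.mem_union_right _ hz
    · rw [labels_erase_of_isParent hT' hR hV]; exact Finset.mem_union_left _ hy
  obtain ⟨Q, hQ, hx, y, hy, hxy⟩ := Nat.sInf_mem hnonempty
  have hQ' := Finset.mem_of_mem_erase hQ
  rcases mem_labels_erase hT' hR hV hQ' hx with hx | ⟨rfl, hx⟩
  · rcases mem_labels_erase hT' hR hV hQ' hy with hy | ⟨rfl, hy⟩
    · rcases Finset.mem_insert.1 hQ' with rfl | hQT
      · rw [h.labels_pairVertex, Finset.mem_singleton] at hx hy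
        exact absurd (hx.trans hy.symm) hxy.ne
      · exact hle Q hQT _ hx y hy hxy
    · exact hVall _ hx
  · exact hRall _ hx

end Splits

theorem exists_maximal_chain (r : Finset ℕ → Finset ℕ → Prop) (hr : ∀ S U, r S U → S ⊂ U)
    (U : Finset ℕ) : ∃ (a : ℕ) (c : Fin (a + 1) → Finset ℕ), c (Fin.last a) = U ∧
      (∀ t : Fin a, r (c t.castSucc) (c t.succ)) ∧ ∀ S, ¬ r S (c 0) := by
  induction U using Finset.strongInduction with
  | H U ih =>
  by_cases hS : ∃ S, r S U
  · obtain ⟨S, hS⟩ := hS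
    obtain ⟨a, c, h1, h2, h3⟩ := ih S (hr S U hS)
    refine ⟨a + 1, Fin.snoc (α := fun _ => Finset ℕ) c U, by simp, fun t => ?_, ?_⟩
    · rw [Fin.snoc_castSucc]
      induction t using Fin.lastCases with
      | last => rw [Fin.succ_last, Fin.snoc_last, h1]; exact hS
      | cast t => rw [Fin.succ_castSucc, Fin.snoc_castSucc]; exact h2 t
    · have : Fin.snoc (α := fun _ => Finset ℕ) c U 0 = c 0 := by
        rw [← Fin.castSucc_zero, Fin.snoc_castSucc]
      rwa [this]
  · exact ⟨0, fun _ => U, rfl, fun t => t.elim0, fun S h => hS ⟨S, h⟩⟩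

end ShuffleTree

/-! ### The bar complex of the operad of an algebra -/

namespace TreeBar

open GradedTensor ShuffleTree

section

variable {I : Finset ℕ} {T T' T'' : Finset (Finset ℕ)} {S U : Finset ℕ}

/-- The degrees of the decorations of a tree. -/
def deg (T : Finset (Finset ℕ)) (S : {S // S ∈ T}) : ℕ := (inputs T S.1).card - 1

theorem deg_eq (hT : IsTree I T) (S : {S // S ∈ T}) : deg T S = (labels T S.1).card :=
  (card_labels (hT.nonempty S.2)).symm

/-- The map `g` sends each vertex of `T` to the smallest vertex of `T'` containing it. -/
def IsUp (g : {S // S ∈ T} → {S // S ∈ T'}) : Prop :=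
  ∀ V, V.1 ⊆ (g V).1 ∧ ∀ R ∈ T', V.1 ⊆ R → (g V).1 ⊆ R

theorem IsUp.unique {g g' : {S // S ∈ T} → {S // S ∈ T'}} (hg : IsUp g) (hg' : IsUp g') :
    g = g' :=
  funext fun V => Subtype.ext
    (((hg V).2 _ (g' V).2 (hg' V).1).antisymm ((hg' V).2 _ (g V).2 (hg V).1))

theorem IsUp.comp {g : {S // S ∈ T} → {S // S ∈ T'}} {g' : {S // S ∈ T'} → {S // S ∈ T''}}
    (hg : IsUp g) (hg' : IsUp g') (h : T'' ⊆ T') : IsUp (g' ∘ g) := fun V =>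
  ⟨(hg V).1.trans (hg' _).1, fun R hR hVR => (hg' _).2 R hR ((hg V).2 R (h hR) hVR)⟩

theorem IsUp.eq_of_mem {g : {S // S ∈ T} → {S // S ∈ T'}} (hg : IsUp g) (V : {S // S ∈ T})
    (hV : V.1 ∈ T') : (g V).1 = V.1 :=
  ((hg V).2 _ hV subset_rfl).antisymm (hg V).1

theorem isUp_id : IsUp (id : {S // S ∈ T} → {S // S ∈ T}) :=
  fun _ => ⟨subset_rfl, fun _ _ h => h⟩

/-- The map on vertices induced by the contraction of the edge connecting `S` to its parent. -/
noncomputable def up (hT : IsTree I T) (hS : S ∈ T) (hSI : S ≠ I) (V : {V // V ∈ T}) :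
    {V // V ∈ T.erase S} :=
  if h : V.1 = S then
    ⟨(hT.exists_parent hS hSI).choose, Finset.mem_erase.2
      ⟨(hT.exists_parent hS hSI).choose_spec.2.1.ne', (hT.exists_parent hS hSI).choose_spec.1⟩⟩
  else ⟨V.1, Finset.mem_erase.2 ⟨h, V.2⟩⟩

theorem up_self (hT : IsTree I T) (hS : S ∈ T) (hSI : S ≠ I) (hU : IsParent T S U) :
    (up hT hS hSI ⟨S, hS⟩).1 = U := by
  simp only [up, dif_pos]
  exact (hT.exists_parent hS hSI).choose_spec.unique hU

theorem up_of_ne (hT : IsTree I T) (hS : S ∈ T) (hSI : S ≠ I) {V : {V // V ∈ T}} (h : V.1 ≠ S) :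
    (up hT hS hSI V).1 = V.1 := by
  simp [up, h]

theorem isUp_up (hT : IsTree I T) (hS : S ∈ T) (hSI : S ≠ I) : IsUp (up hT hS hSI) := by
  intro V
  by_cases h : V.1 = S
  · obtain ⟨U, hU⟩ := hT.exists_parent hS hSI
    obtain rfl : V = ⟨S, hS⟩ := Subtype.ext h
    rw [up_self hT hS hSI hU]
    refine ⟨hU.2.1.1, fun R hR hSR => ?_⟩
    rw [Finset.mem_erase] at hR
    exact hU.2.2 R hR.2 (hSR.ssubset_of_ne hR.1.symm)
  · rw [up_of_ne hT hS hSI h]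
    exact ⟨subset_rfl, fun _ _ h => h⟩

/-- The fibres of `up`. -/
@[to_additive]
theorem prod_up {M : Type*} [CommMonoid M] (hT : IsTree I T) (hS : S ∈ T) (hSI : S ≠ I)
    (hU : IsParent T S U) (f : {V // V ∈ T} → M) (V : {V // V ∈ T.erase S}) :
    ∏ R with up hT hS hSI R = V, f R =
      if V.1 = U then f ⟨V.1, Finset.mem_of_mem_erase V.2⟩ * f ⟨S, hS⟩
      else f ⟨V.1, Finset.mem_of_mem_erase V.2⟩ := by
  have hV := Finset.mem_erase.1 V.2
  have hne : (⟨V.1, hV.2⟩ : {V // V ∈ T}) ≠ ⟨S, hS⟩ := fun h => hV.1 (congrArg Subtype.val h)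
  have key : ∀ R : {V // V ∈ T}, up hT hS hSI R = V ↔
      R = ⟨V.1, hV.2⟩ ∨ (V.1 = U ∧ R = ⟨S, hS⟩) := by
    intro R
    rw [Subtype.ext_iff]
    by_cases h : R.1 = S
    · obtain rfl : R = ⟨S, hS⟩ := Subtype.ext h
      rw [up_self hT hS hSI hU]
      simp [hne.symm, eq_comm]
    · rw [up_of_ne hT hS hSI h]
      have : R ≠ ⟨S, hS⟩ := fun h' => h (congrArg Subtype.val h')
      simp [this, Subtype.ext_iff]
  split_ifs with h
  · rw [show (Finset.univ.filter fun R => up hT hS hSI R = V) = {⟨V.1, hV.2⟩, ⟨S, hS⟩} by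
      ext R; simp [key, h], Finset.prod_pair hne]
  · rw [show (Finset.univ.filter fun R => up hT hS hSI R = V) = {⟨V.1, hV.2⟩} by
      ext R; simp [key, h], Finset.prod_singleton]

theorem degEq_up (hT : IsTree I T) (hS : S ∈ T) (hSI : S ≠ I) :
    DegEq (up hT hS hSI) (deg T) (deg (T.erase S)) := by
  obtain ⟨U, hU⟩ := hT.exists_parent hS hSI
  refine degEq_iff.2 fun V => ?_
  have hV := Finset.mem_erase.1 V.2
  rw [sum_up hT hS hSI hU, deg_eq (hT.erase hSI)]
  simp only [deg_eq hT]
  split_ifs with h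
  · rw [h, labels_erase_of_isParent hT hS hU, Finset.card_union_of_disjoint
      (disjoint_labels hT hU.1 hS hU.2.1.ne')]
  · rw [labels_erase_of_not_isParent hT hS hV.2 fun h' => h (h'.unique hU)]

variable {k : Type u} {A : Type v} [Field k] [CommRing A] [Algebra k A]
  (𝒜 : ℕ → Submodule k A) [GradedAlgebra 𝒜]

theorem coe_castArity {m n : ℕ} (h : m = n) (x : (operadOfAlgebra 𝒜).obj m) :
    @Subtype.val A (· ∈ 𝒜 (n - 1)) ((operadOfAlgebra 𝒜).castArity h x) =
      @Subtype.val A (· ∈ 𝒜 (m - 1)) x := by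
  subst h
  rfl

theorem lift_contractMulti (hT : IsTree I T) (hS : S ∈ T) (hSI : S ≠ I) :
    PiTensorProduct.lift ((operadOfAlgebra 𝒜).contractMulti hT hS hSI) =
      mulMap 𝒜 (degEq_up hT hS hSI) := by
  obtain ⟨U, hU⟩ := hT.exists_parent hS hSI
  refine linearMap_ext 𝒜 fun a => ?_
  refine (PiTensorProduct.lift.tprod _).trans (Eq.trans ?_ (mulMap_tprod 𝒜 _ a).symm)
  refine congrArg (PiTensorProduct.tprod k) (funext fun V => ?_)
  refine Subtype.ext (Eq.trans ?_
    ((coe_prodFun 𝒜 _ a V).trans (prod_up hT hS hSI hU (fun R => (a R : A)) V)).symm)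
  by_cases h : V.1 = U
  · exact (congrArg (Subtype.val (p := (· ∈ 𝒜 _))) (dif_pos (h ▸ hU : IsParent T S V.1))).trans
      (if_pos h).symm
  · exact (congrArg (Subtype.val (p := (· ∈ 𝒜 _))) (dif_neg fun h' => h (h'.unique hU))).trans
      ((coe_castArity 𝒜 _ _).trans (if_neg h).symm)

open Classical in
/-- The sign of the contraction of the edge connecting `S` to its parent. -/
noncomputable def sign (k : Type*) [Field k] (T : Finset (Finset ℕ)) (S : Finset ℕ) : k :=
  (-1 : k) ^ (T.filter fun R => toColex R < toColex S).card

theorem sign_ne_zero : sign k T S ≠ 0 := pow_ne_zero _ (by simp)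

theorem sign_mul_add {R : Finset ℕ} (hS : S ∈ T) (hR : R ∈ T) (hne : S ≠ R) :
    sign k T S * sign k (T.erase S) R + sign k T R * sign k (T.erase R) S = 0 := by
  wlog h : toColex S < toColex R generalizing S R
  · rw [add_comm]
    exact this hR hS hne.symm ((not_lt.1 h).lt_of_ne fun h' => hne (toColex_inj.1 h'.symm))
  unfold sign
  rw [Finset.filter_erase, Finset.filter_erase, Finset.erase_eq_of_notMem (a := R)
    (fun h' => lt_asymm h (Finset.mem_filter.1 h').2), ← Finset.card_erase_add_one
    (s := T.filter fun V => toColex V < toColex R) (Finset.mem_filter.2 ⟨hS, h⟩), pow_succ]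
  ring

/-- The bar complex of the operad of an algebra. -/
abbrev Chains (I : Finset ℕ) (q : ℕ) : Type (max u v) :=
  ⨁ T : ShuffleOperad.TreeIndex I q, GTensor 𝒜 (deg T.1)

/-- The differential of the bar complex of the operad of an algebra. -/
noncomputable def dMap (I : Finset ℕ) (q : ℕ) : Chains 𝒜 I (q + 1) →ₗ[k] Chains 𝒜 I q :=
  Contraction.map (k := k) (Θ₁ := ShuffleOperad.TreeIndex I (q + 1))
    (Θ₀ := ShuffleOperad.TreeIndex I q) (X₁ := fun T => GTensor 𝒜 (deg T.1))
    (X₀ := fun T => GTensor 𝒜 (deg T.1)) (E₁ := fun T => {S // S ∈ T.1.erase I})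
    (fun T S => T.contract S) (fun T S => sign k T.1 S.1)
    (fun T S => mulMap 𝒜 (degEq_up T.2.1 (Finset.mem_of_mem_erase S.2)
      (Finset.ne_of_mem_erase S.2)))

theorem barD_eq_map (P : ShuffleOperad.{u, v} k) (I : Finset ℕ) (q : ℕ) :
    P.barD I q = Contraction.map (k := k) (Θ₁ := ShuffleOperad.TreeIndex I (q + 1))
      (Θ₀ := ShuffleOperad.TreeIndex I q) (X₁ := fun T => P.TreeTensor T.1)
      (X₀ := fun T => P.TreeTensor T.1) (E₁ := fun T => {S // S ∈ T.1.erase I})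
      (fun T S => T.contract S) (fun T S => sign k T.1 S.1)
      (fun T S => PiTensorProduct.lift (P.contractMulti T.2.1 (Finset.mem_of_mem_erase S.2)
        (Finset.ne_of_mem_erase S.2))) := rfl

theorem barD_eq (I : Finset ℕ) (q : ℕ) : (operadOfAlgebra 𝒜).barD I q = dMap 𝒜 I q := by
  refine (barD_eq_map _ _ _).trans ?_
  unfold dMap
  congr 1
  funext T S
  exact lift_contractMulti 𝒜 _ _ _

theorem lof_eq {q : ℕ} {T T' : ShuffleOperad.TreeIndex I q} (h : T = T')
    {x : GTensor 𝒜 (deg T.1)} {x' : GTensor 𝒜 (deg T'.1)}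
    (hx : ∀ (g : {V // V ∈ T.1} → {V // V ∈ T'.1}) (hd : DegEq g (deg T.1) (deg T'.1)), IsUp g →
      mulMap 𝒜 hd x = x') :
    DirectSum.lof k (ShuffleOperad.TreeIndex I q) (fun T => GTensor 𝒜 (deg T.1)) T x =
      DirectSum.lof k (ShuffleOperad.TreeIndex I q) (fun T => GTensor 𝒜 (deg T.1)) T' x' := by
  subst h
  rw [← hx id (degEq_id fun _ => rfl) isUp_id, mulMap_id 𝒜 rfl]

theorem mulMap_up_up (hT : IsTree I T) {R : Finset ℕ} (hS : S ∈ T) (hSI : S ≠ I)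
    (hR' : R ∈ T.erase S) (hS' : S ∈ T.erase R) (hR : R ∈ T) (hRI : R ≠ I)
    {g : {V // V ∈ (T.erase S).erase R} → {V // V ∈ (T.erase R).erase S}}
    (hd : DegEq g (deg ((T.erase S).erase R)) (deg ((T.erase R).erase S))) (hg : IsUp g)
    (x : GTensor 𝒜 (deg T)) :
    mulMap 𝒜 hd (mulMap 𝒜 (degEq_up (hT.erase hSI) hR' hRI) (mulMap 𝒜 (degEq_up hT hS hSI) x)) =
      mulMap 𝒜 (degEq_up (hT.erase hRI) hS' hSI) (mulMap 𝒜 (degEq_up hT hR hRI) x) := by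
  have h1 : IsUp (g ∘ up (hT.erase hSI) hR' hRI) :=
    (isUp_up _ _ _).comp hg Finset.erase_right_comm.ge
  have h2 : IsUp (up (hT.erase hRI) hS' hSI ∘ up hT hR hRI) :=
    (isUp_up _ _ _).comp (isUp_up _ _ _) (Finset.erase_subset _ _)
  have h3 : IsUp ((g ∘ up (hT.erase hSI) hR' hRI) ∘ up hT hS hSI) :=
    (isUp_up _ _ _).comp h1 (Finset.erase_right_comm.ge.trans (Finset.erase_subset _ _))
  rw [mulMap_comp 𝒜 _ hd ((degEq_up _ _ _).comp hd) rfl,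
    mulMap_comp 𝒜 _ ((degEq_up _ _ _).comp hd) ((degEq_up hT hS hSI).comp
      ((degEq_up (hT.erase hSI) hR' hRI).comp hd)) rfl]
  exact (mulMap_comp 𝒜 _ _ _ (h2.unique h3) x).symm

theorem dMap_dMap (q : ℕ) (z : Chains 𝒜 I (q + 1 + 1)) : dMap 𝒜 I q (dMap 𝒜 I (q + 1) z) = 0 := by
  rw [← LinearMap.comp_apply]
  suffices h : dMap 𝒜 I q ∘ₗ dMap 𝒜 I (q + 1) = 0 by rw [h]; rfl
  refine DirectSum.linearMap_ext k fun T => LinearMap.ext fun x => ?_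
  rw [LinearMap.comp_apply, LinearMap.comp_apply, dMap, dMap, Contraction.map_lof, map_sum]
  simp only [map_smul, Contraction.map_lof, Finset.smul_sum, smul_smul]
  rw [Finset.sum_sigma']
  refine Finset.sum_involution (fun p _ => ⟨⟨p.2.1, ?_⟩, ⟨p.1.1, ?_⟩⟩) (fun p _ => ?_) ?_ ?_ ?_
  · have h1 := Finset.mem_erase.1 p.2.2
    exact Finset.mem_erase.2 ⟨h1.1, Finset.mem_of_mem_erase h1.2⟩
  · have h1 := Finset.mem_erase.1 p.2.2
    have h2 := Finset.mem_erase.1 p.1.2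
    exact Finset.mem_erase.2 ⟨h2.1, Finset.mem_erase.2
      ⟨(Finset.ne_of_mem_erase h1.2).symm, h2.2⟩⟩
  · obtain ⟨⟨S, hS⟩, ⟨R, hR⟩⟩ := p
    have hS' := Finset.mem_erase.1 hS
    have hR' := Finset.mem_erase.1 hR
    have hR'' := Finset.mem_erase.1 hR'.2
    have hS'' : S ∈ T.1.erase R := Finset.mem_erase.2 ⟨hR''.1.symm, hS'.2⟩
    have hlof := lof_eq (k := k) 𝒜 (T := (T.contract ⟨S, hS⟩).contract ⟨R, hR⟩)
      (T' := (T.contract ⟨R, Finset.mem_erase.2 ⟨hR'.1, hR''.2⟩⟩).contract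
        ⟨S, Finset.mem_erase.2 ⟨hS'.1, hS''⟩⟩)
      (Subtype.ext (Finset.erase_right_comm))
      (fun g hd hg => mulMap_up_up 𝒜 T.2.1 hS'.2 hS'.1 hR'.2 hS'' hR''.2 hR'.1 hd hg x)
    refine (congrArg (fun y => _ • y + _) hlof).trans ?_
    refine (add_smul _ _ _).symm.trans ?_
    exact (congrArg (fun c : k => c • _) (sign_mul_add hS'.2 hR''.2 hR''.1.symm)).trans
      (zero_smul _ _)
  · rintro ⟨⟨S, hS⟩, ⟨R, hR⟩⟩ _ _ h
    have hR'' := Finset.mem_erase.1 (Finset.mem_of_mem_erase hR)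
    exact hR''.1 (congrArg (fun p => p.1.1) h)
  · intros
    exact Finset.mem_sigma.2 ⟨Finset.mem_univ _, Finset.mem_univ _⟩
  · rintro ⟨⟨S, hS⟩, ⟨R, hR⟩⟩ _
    rfl

theorem finite_treeIndex (I : Finset ℕ) (q : ℕ) : Finite (ShuffleOperad.TreeIndex I q) := by
  refine Finite.of_injective (β := {T // T ∈ I.powerset.powerset}) (fun T => ⟨T.1, ?_⟩)
    fun T T' h => Subtype.ext (congrArg (fun T => T.1) h)
  exact Finset.mem_powerset.2 fun S hS => Finset.mem_powerset.2 (T.2.1.subset S hS)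

end

end TreeBar

namespace TreeBar

open GradedTensor ShuffleTree

section

variable {I : Finset ℕ} {T : Finset (Finset ℕ)} {S U : Finset ℕ}
  {k : Type u} {A : Type v} [Field k] [CommRing A] [Algebra k A]
  (𝒜 : ℕ → Submodule k A) [GradedAlgebra 𝒜]

/-- The vertex `S` is good and its labels precede all labels which are not the largest label of
their vertex. -/
def Small (T : Finset (Finset ℕ)) (S : Finset ℕ) : Prop :=
  (∃ W, Good T S W) ∧ ∀ x ∈ labels T S, x < sInf (inner T)

theorem Small.mn_eq {W : Finset ℕ} (h : Small T S) (hW : IsParent T S W) : mn S = mn W := by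
  obtain ⟨V, hV⟩ := h.1
  rw [hV.2.1, hW.unique hV.1]

theorem Small.unique (hT : IsTree I T) {R W : Finset ℕ} (hS : S ∈ T) (hR : R ∈ T)
    (h : Small T S) (h' : Small T R) (hW : IsParent T S W) (hW' : IsParent T R W) : S = R := by
  have h1 : mn S = mn R := (h.mn_eq hW).trans (h'.mn_eq hW').symm
  by_contra hne
  rcases hT.laminar S hS R hR with h2 | h2 | h2
  · exact hW'.2.1.2 (hW.2.2 R hR (h2.ssubset_of_ne hne))
  · exact hW.2.1.2 (hW'.2.2 S hS (h2.ssubset_of_ne (Ne.symm hne)))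
  · exact Finset.disjoint_left.1 h2 (mn_mem (hT.nonempty hS))
      (h1 ▸ mn_mem (hT.nonempty hR))

theorem IsUp.apply_pairVertex (hT : IsTree I T) {j : ℕ} (h : Splits T U j)
    {g : {S // S ∈ splitTree T U j} → {S // S ∈ T}} (hg : IsUp g) :
    (g ⟨pairVertex T U j, Splits.pairVertex_mem⟩).1 = U := by
  refine ((hg _).2 U h.mem pairVertex_subset).antisymm ?_
  refine (h.isParent hT).2.2 _ (Splits.mem_splitTree (g _).2) ((hg
    ⟨pairVertex T U j, Splits.pairVertex_mem⟩).1.ssubset_of_ne ?_)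
  intro he
  refine h.pairVertex_notMem ?_
  have := (g ⟨pairVertex T U j, Splits.pairVertex_mem⟩).2
  rwa [← he] at this

theorem killed_of_mulMap_up_eq_zero (hT : IsTree I T) (hS : S ∈ T) (hSI : S ≠ I)
    (hU : IsParent T S U) {x : GTensor 𝒜 (deg T)} (hx : mulMap 𝒜 (degEq_up hT hS hSI) x = 0) :
    Killed 𝒜 x ⟨S, hS⟩ ⟨U, hU.1⟩ := by
  refine killed_of_mulMap_eq_zero 𝒜 _ hx fun p p' hp => ?_
  have hp := congrArg Subtype.val hp
  by_cases h : p.1 = S <;> by_cases h' : p'.1 = S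
  · exact Or.inl (Subtype.ext (h.trans h'.symm))
  · obtain rfl : p = ⟨S, hS⟩ := Subtype.ext h
    rw [up_self hT hS hSI hU, up_of_ne hT hS hSI h'] at hp
    exact Or.inr (Or.inl ⟨rfl, Subtype.ext hp.symm⟩)
  · obtain rfl : p' = ⟨S, hS⟩ := Subtype.ext h'
    rw [up_self hT hS hSI hU, up_of_ne hT hS hSI h] at hp
    exact Or.inr (Or.inr ⟨Subtype.ext hp, rfl⟩)
  · rw [up_of_ne hT hS hSI h, up_of_ne hT hS hSI h'] at hp
    exact Or.inl (Subtype.ext hp)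

theorem mulMap_up_eq_zero_of_killed (hT : IsTree I T) (hS : S ∈ T) (hSI : S ≠ I)
    (hU : IsParent T S U) {x : GTensor 𝒜 (deg T)} (hx : Killed 𝒜 x ⟨S, hS⟩ ⟨U, hU.1⟩) :
    mulMap 𝒜 (degEq_up hT hS hSI) x = 0 := by
  refine hx.mulMap_eq_zero 𝒜 (Subtype.ext ?_) _
  rw [up_self hT hS hSI hU, up_of_ne hT hS hSI hU.2.1.ne']

theorem exists_lift_splitTree (hK : ∀ a m, 1 ≤ m → KoszulLift 𝒜 a m) (hT : IsTree I T) {j : ℕ}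
    (hj : j = sInf (inner T)) (h : Splits T U j) (x : GTensor 𝒜 (deg T))
    (hx : ∀ S (hS : S ∈ T) (hSI : S ≠ I), Small T S → mulMap 𝒜 (degEq_up hT hS hSI) x = 0) :
    ∃ y : GTensor 𝒜 (deg (splitTree T U j)),
      (∀ (g : {S // S ∈ splitTree T U j} → {S // S ∈ T})
        (hd : DegEq g (deg (splitTree T U j)) (deg T)), IsUp g → mulMap 𝒜 hd y = x) ∧
      ∀ S (hS : S ∈ T) (hSI : S ≠ I), Small T S →
        mulMap 𝒜 (degEq_up (h.isTree hT) (Splits.mem_splitTree hS) hSI) y = 0 := by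
  classical
  obtain ⟨a, c, hcU, hcr, hc0⟩ := exists_maximal_chain
    (fun S V => (S ∈ T ∧ Small T S) ∧ IsParent T S V) (fun S V h => h.2.2.1) U
  have hcT : ∀ t, c t ∈ T := fun t => by
    induction t using Fin.lastCases with
    | last => rw [hcU]; exact h.mem
    | cast t => exact (hcr t).1.1
  have hcm : StrictMono c := Fin.strictMono_iff_lt_succ.2 fun t => (hcr t).2.2.1
  have hci := hcm.injective
  have hcne : ∀ t, t ≠ Fin.last a → c t ≠ U := fun t ht he => ht (hci (he.trans hcU.symm))
  let κ := {S : {S // S ∈ T} // ∀ t, c t ≠ S.1}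
  let c' : Fin (a + 2) → Finset ℕ := Fin.snoc (α := fun _ => Finset ℕ)
    (fun t => if t = Fin.last a then pairVertex T U j else c t) U
  have hc'_last : c' (Fin.last (a + 1)) = U := Fin.snoc_last _ _
  have hc'_P : c' (Fin.last a).castSucc = pairVertex T U j := by
    simp only [c', Fin.snoc_castSucc, if_true]
  have hc'_of_ne : ∀ t, t ≠ Fin.last a → c' t.castSucc = c t := fun t ht => by
    simp only [c', Fin.snoc_castSucc, if_neg ht]
  have hc'T : ∀ t, c' t ∈ splitTree T U j := fun t => by
    induction t using Fin.lastCases with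
    | last => rw [hc'_last]; exact Splits.mem_splitTree h.mem
    | cast t =>
      by_cases ht : t = Fin.last a
      · rw [ht, hc'_P]; exact Splits.pairVertex_mem
      · rw [hc'_of_ne t ht]; exact Splits.mem_splitTree (hcT t)
  have hc'c : ∀ t, c' t ≠ pairVertex T U j → ∃ r, c r = c' t := fun t ht => by
    induction t using Fin.lastCases with
    | last => exact ⟨Fin.last a, hcU.trans hc'_last.symm⟩
    | cast t =>
      by_cases ht' : t = Fin.last a
      · rw [ht'] at ht; exact absurd hc'_P ht
      · exact ⟨t, (hc'_of_ne t ht').symm⟩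
  have hc'm : StrictMono c' := by
    refine Fin.strictMono_iff_lt_succ.2 fun t => ?_
    induction t using Fin.lastCases with
    | last => rw [hc'_P, Fin.succ_last, hc'_last]; exact h.pairVertex_ssubset
    | cast t =>
      rw [Fin.succ_castSucc, hc'_of_ne _ (Fin.castSucc_lt_last t).ne]
      by_cases ht : t.succ = Fin.last a
      · rw [ht, hc'_P]
        have hp := (hcr t).2
        rw [ht, hcU] at hp
        exact (h.isParent_pairVertex hT (hcT _) hp ((hcr t).1.2.mn_eq hp)).2.1
      · rw [hc'_of_ne _ ht]
        exact hcm (Fin.castSucc_lt_succ)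
  let e : Fin (a + 1) ⊕ κ → {S // S ∈ T} := Sum.elim (fun t => ⟨c t, hcT t⟩) Subtype.val
  let e' : Fin (a + 2) ⊕ κ → {S // S ∈ splitTree T U j} :=
    Sum.elim (fun t => ⟨c' t, hc'T t⟩) fun V => ⟨V.1.1, Splits.mem_splitTree V.1.2⟩
  have he : Function.Bijective e := by
    constructor
    · rintro (t | V) (t' | V') hV
      · exact congrArg Sum.inl (hci (congrArg Subtype.val hV))
      · exact absurd (congrArg Subtype.val hV) (V'.2 t)
      · exact absurd (congrArg Subtype.val hV).symm (V.2 t')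
      · exact congrArg Sum.inr (Subtype.ext hV)
    · intro V
      by_cases hV : ∃ t, c t = V.1
      · obtain ⟨t, ht⟩ := hV
        exact ⟨Sum.inl t, Subtype.ext ht⟩
      · push Not at hV
        exact ⟨Sum.inr ⟨V, hV⟩, rfl⟩
  have he' : Function.Bijective e' := by
    have hne : ∀ t (V : κ), c' t ≠ V.1.1 := fun t V hV => by
      by_cases ht : c' t = pairVertex T U j
      · exact h.pairVertex_notMem (ht ▸ hV ▸ V.1.2)
      · obtain ⟨r, hr⟩ := hc'c t ht
        exact V.2 r (hr.trans hV)
    constructor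
    · rintro (t | V) (t' | V') hV
      · exact congrArg Sum.inl (hc'm.injective (congrArg Subtype.val hV))
      · exact absurd (congrArg Subtype.val hV) (hne t V')
      · exact absurd (congrArg Subtype.val hV).symm (hne t' V)
      · exact congrArg Sum.inr (Subtype.ext (Subtype.ext
          (show V.1.1 = V'.1.1 from congrArg (fun x => x.1) hV)))
    · intro V
      rcases Finset.mem_insert.1 V.2 with hV | hV
      · exact ⟨Sum.inl (Fin.last a).castSucc, Subtype.ext (hc'_P.trans hV.symm)⟩
      · by_cases hV' : ∃ t, c t = V.1
        · obtain ⟨t, ht⟩ := hV'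
          by_cases hta : t = Fin.last a
          · refine ⟨Sum.inl (Fin.last (a + 1)), Subtype.ext ?_⟩
            rw [← ht, hta]
            exact hc'_last.trans hcU.symm
          · exact ⟨Sum.inl t.castSucc, Subtype.ext ((hc'_of_ne t hta).trans ht)⟩
        · push Not at hV'
          exact ⟨Sum.inr ⟨⟨V.1, hV⟩, hV'⟩, rfl⟩
  obtain ⟨m, hm1, hm⟩ : ∃ m, 1 ≤ m ∧ (labels T U).card = m + 1 := by
    obtain ⟨z, hz, hjz⟩ := h.exists_lt
    have := Finset.one_lt_card.2 ⟨j, h.mem_labels, z, hz, hjz.ne⟩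
    exact ⟨(labels T U).card - 1, by omega, by omega⟩
  have hone : ∀ t, t ≠ Fin.last a → (labels T (c t)).card = 1 := fun t ht => by
    induction t using Fin.lastCases with
    | last => exact absurd rfl ht
    | cast t =>
      obtain ⟨x, hx⟩ := labels_eq_singleton hT (hcT _) (hcr t).1.2.2
      rw [hx, Finset.card_singleton]
  have hs : ∀ t, deg T (e (Sum.inl t)) = combDeg a (m + 1) t := by
    intro t
    rw [deg_eq hT]
    simp only [e, Sum.elim_inl, combDeg]
    by_cases ht : t = Fin.last a
    · simp [ht, hcU, hm]
    · rw [hone t ht, if_pos (by have : (t : ℕ) ≠ a := fun h => ht (Fin.ext h); omega)]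
  have hs' : ∀ t, deg (splitTree T U j) (e' (Sum.inl t)) = combDeg (a + 1) m t := by
    intro t
    rw [deg_eq (h.isTree hT)]
    simp only [e', Sum.elim_inl, combDeg]
    induction t using Fin.lastCases with
    | last =>
      rw [hc'_last, h.labels_splitTree hT, Finset.card_erase_of_mem h.mem_labels, hm]
      simp
    | cast t =>
      rw [if_pos (by simp; omega)]
      by_cases ht : t = Fin.last a
      · rw [ht, hc'_P, h.labels_pairVertex, Finset.card_singleton]
      · rw [hc'_of_ne t ht, h.labels_splitTree_of_ne hT (hcT t) (hcne t ht), hone t ht]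
  have hκ : ∀ V, deg (splitTree T U j) (e' (Sum.inr V)) = deg T (e (Sum.inr V)) := by
    intro V
    rw [deg_eq hT, deg_eq (h.isTree hT)]
    simp only [e, e', Sum.elim_inr]
    rw [h.labels_splitTree_of_ne hT V.1.2 fun hV => V.2 (Fin.last a) (hcU.trans hV.symm)]
  have hneI : ∀ {S V}, IsParent T S V → S ≠ I := fun hp hSI => hp.2.1.2 (hSI ▸ hT.subset _ hp.1)
  obtain ⟨y, hy1, hy2, hy3⟩ := (hK a m hm1).exists_lift 𝒜 he he' hs hs' hκ x fun t =>
    killed_of_mulMap_up_eq_zero 𝒜 hT (hcT t.castSucc) (hneI (hcr t).2) (hcr t).2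
      (hx _ (hcT _) (hneI (hcr t).2) (hcr t).1.2)
  refine ⟨y, fun g hd hg => hy1 g hd (funext ?_), fun S hS hSI hsm => ?_⟩
  · rintro (t | V)
    · apply Subtype.ext
      simp only [Function.comp_apply, Sum.map_inl, e, e', Sum.elim_inl]
      induction t using Fin.lastCases with
      | last =>
        rw [hg.eq_of_mem _ (by simp only [hc'_last]; exact h.mem)]
        simp only [hc'_last]
        rw [← Fin.succ_last, GradedBar.mergePos_succ, hcU]
      | cast t =>
        have h1 : GradedBar.mergePos (Fin.last a) t.castSucc = t := by
          have : (t : ℕ) ≤ a := by omega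
          simp [GradedBar.mergePos, this]
        rw [h1]
        by_cases ht : t = Fin.last a
        · subst ht
          simp only [hc'_P]
          rw [hg.apply_pairVertex hT h, hcU]
        · rw [hg.eq_of_mem _ (by simp only [hc'_of_ne t ht]; exact hcT t)]
          exact hc'_of_ne t ht
    · exact Subtype.ext (hg.eq_of_mem _ V.1.2)
  · obtain ⟨V, hV⟩ := hT.exists_parent hS hSI
    by_cases hSc : ∃ t, c t = S
    · obtain ⟨t, rfl⟩ := hSc
      induction t using Fin.lastCases with
      | last =>
        obtain ⟨z, hz, hjz⟩ := h.exists_lt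
        have h1 := hsm.2 z (by rw [hcU]; exact hz)
        rw [← hj] at h1
        exact absurd h1 (lt_asymm hjz)
      | cast t =>
        have hp := (hcr t).2
        obtain rfl := hV.unique hp
        have hkill := hy2 t
        have e1 : e' (Sum.inl t.castSucc.castSucc) =
            ⟨c t.castSucc, Splits.mem_splitTree (hcT _)⟩ :=
          Subtype.ext (hc'_of_ne _ (Fin.castSucc_lt_last t).ne)
        by_cases ht : t.succ = Fin.last a
        · rw [ht, hcU] at hp
          have hp' := h.isParent_pairVertex hT hS hp (hsm.mn_eq hp)
          have e2 : e' (Sum.inl t.succ.castSucc) = ⟨pairVertex T U j, hp'.1⟩ :=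
            Subtype.ext (by rw [ht]; exact hc'_P)
          rw [e1, e2] at hkill
          exact mulMap_up_eq_zero_of_killed 𝒜 _ _ _ hp' hkill
        · have hp' := h.isParent_splitTree hT hS hp (hcne _ ht)
          have e2 : e' (Sum.inl t.succ.castSucc) = ⟨c t.succ, hp'.1⟩ :=
            Subtype.ext (hc'_of_ne _ ht)
          rw [e1, e2] at hkill
          exact mulMap_up_eq_zero_of_killed 𝒜 _ _ _ hp' hkill
    · push Not at hSc
      have hVc : ∀ t, c t ≠ V := by
        rintro t rfl
        induction t using Fin.cases with
        | zero => exact hc0 S ⟨⟨hS, hsm⟩, hV⟩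
        | succ t =>
          exact hSc _ (Small.unique hT (hcT _) hS (hcr t).1.2 hsm (hcr t).2 hV)
      have hp' := h.isParent_splitTree hT hS hV fun hVU => hVc (Fin.last a) (hcU.trans hVU.symm)
      exact mulMap_up_eq_zero_of_killed 𝒜 _ _ _ hp' (hy3 ⟨⟨S, hS⟩, hSc⟩ ⟨⟨V, hV.1⟩, hVc⟩
        (killed_of_mulMap_up_eq_zero 𝒜 hT hS hSI hV (hx S hS hSI hsm)))

/-- The bar complex is exact at trees with the wrong number of vertices. -/
theorem exact_dMap (hK : ∀ a m, 1 ≤ m → KoszulLift 𝒜 a m) (I : Finset ℕ) (q : ℕ)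
    (hq : q + 1 ≠ I.card - 1) : Function.Exact (dMap 𝒜 I (q + 1)) (dMap 𝒜 I q) := by
  intro z
  refine ⟨fun hz => ?_, ?_⟩
  swap
  · rintro ⟨v, rfl⟩
    exact dMap_dMap 𝒜 q v
  have := finite_treeIndex I (q + 1)
  have hstep : ∀ T : ShuffleOperad.TreeIndex I (q + 1), True →
      ∃ (T' : ShuffleOperad.TreeIndex I (q + 1 + 1)) (j : {S // S ∈ T'.1.erase I})
        (K : Set {S // S ∈ T.1.erase I}),
      (∀ s ∈ K, (0 : Chains 𝒜 I q) (T.contract s) = 0 ∧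
        (∀ s', T.contract s' = T.contract s → s' = s) ∧
        ∀ (R : ShuffleOperad.TreeIndex I (q + 1)) r, R.contract r = T.contract s → R ≠ T →
          rank R.1 < rank T.1) ∧
      ∀ x : GTensor 𝒜 (deg T.1), (∀ s ∈ K, mulMap 𝒜 (degEq_up T.2.1
        (Finset.mem_of_mem_erase s.2) (Finset.ne_of_mem_erase s.2)) x = 0) →
        ∃ y : GTensor 𝒜 (deg T'.1),
          DirectSum.lof k (ShuffleOperad.TreeIndex I (q + 1)) (fun T => GTensor 𝒜 (deg T.1))
            (T'.contract j) (mulMap 𝒜 (degEq_up T'.2.1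
              (Finset.mem_of_mem_erase j.2) (Finset.ne_of_mem_erase j.2)) y) =
          DirectSum.lof k (ShuffleOperad.TreeIndex I (q + 1)) (fun T => GTensor 𝒜 (deg T.1)) T x ∧
          ∀ i, i ≠ j → mulMap 𝒜 (degEq_up T'.2.1
            (Finset.mem_of_mem_erase i.2) (Finset.ne_of_mem_erase i.2)) y = 0 ∨
            rank T.1 < rank (T'.contract i).1 := by
    intro T _
    have hT := T.2.1
    have hI : I ∈ T.1 := by
      obtain ⟨S, hS⟩ := Finset.card_pos.1 (by rw [T.2.2]; exact Nat.succ_pos q : 0 < T.1.card)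
      exact hT.root_mem ((hT.two_le_card S hS).trans (Finset.card_le_card (hT.subset S hS)))
    obtain ⟨U, hU⟩ := exists_splits hT hI (by rw [T.2.2]; exact hq)
    have hPI : pairVertex T.1 U (sInf (inner T.1)) ≠ I := fun h =>
      hU.pairVertex_ssubset.2 ((hT.subset U hU.mem).trans h.ge)
    refine ⟨⟨splitTree T.1 U (sInf (inner T.1)), hU.isTree hT, by
      rw [splitTree, Finset.card_insert_of_notMem hU.pairVertex_notMem, T.2.2]⟩,
      ⟨pairVertex T.1 U (sInf (inner T.1)), Finset.mem_erase.2 ⟨hPI, Splits.pairVertex_mem⟩⟩,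
      {s | Small T.1 s.1}, fun s hs => ⟨rfl, fun s' he => ?_, fun R r he hne => ?_⟩,
      fun x hx => ?_⟩
    · have h1 : T.1.erase s'.1 = T.1.erase s.1 := congrArg Subtype.val he
      by_contra hne
      have h2 : s'.1 ∈ T.1.erase s.1 :=
        Finset.mem_erase.2 ⟨fun h => hne (Subtype.ext h), Finset.mem_of_mem_erase s'.2⟩
      rw [← h1] at h2
      exact Finset.notMem_erase _ _ h2
    · obtain ⟨⟨W, hW⟩, hlt⟩ := hs
      exact rank_lt_of_erase_eq hT (Finset.mem_of_mem_erase s.2) hW hlt R.2.1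
        (Finset.mem_of_mem_erase r.2) (Finset.ne_of_mem_erase r.2) (congrArg Subtype.val he)
        fun h => hne (Subtype.ext h)
    · obtain ⟨y, hy1, hy2⟩ := exists_lift_splitTree 𝒜 hK hT rfl hU x fun S hS hSI hsm =>
        hx ⟨S, Finset.mem_erase.2 ⟨hSI, hS⟩⟩ hsm
      refine ⟨y, lof_eq 𝒜 (Subtype.ext hU.erase_splitTree) fun g hd hg => ?_, fun i hi => ?_⟩
      · refine (mulMap_comp 𝒜 _ hd ((degEq_up _ _ _).comp hd) rfl y).trans (hy1 _ _ ?_)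
        exact (isUp_up _ _ _).comp hg hU.erase_splitTree.ge
      · have hi' := Finset.mem_erase.1 i.2
        have hne : i.1 ≠ pairVertex T.1 U (sInf (inner T.1)) := fun h => hi (Subtype.ext h)
        by_cases hsm : Small T.1 i.1
        · exact Or.inl (hy2 i.1 ((Finset.mem_insert.1 hi'.2).resolve_left hne) hi'.1 hsm)
        · exact Or.inr (hU.rank_lt_erase hT hi'.2 hi'.1 hne hsm)
  obtain ⟨v, hv⟩ := Contraction.elimination (k := k)
    (Θ₂ := ShuffleOperad.TreeIndex I (q + 1 + 1))
    (Θ₁ := ShuffleOperad.TreeIndex I (q + 1)) (Θ₀ := ShuffleOperad.TreeIndex I q)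
    (X₂ := fun T => GTensor 𝒜 (deg T.1)) (X₁ := fun T => GTensor 𝒜 (deg T.1))
    (X₀ := fun T => GTensor 𝒜 (deg T.1))
    (E₂ := fun T => {S // S ∈ T.1.erase I}) (E₁ := fun T => {S // S ∈ T.1.erase I})
    (fun T => rank T.1) (fun _ => True) (fun _ _ _ _ => trivial)
    (fun T S => T.contract S) (fun T S => sign k T.1 S.1)
    (fun T S => mulMap 𝒜 (degEq_up T.2.1 (Finset.mem_of_mem_erase S.2)
      (Finset.ne_of_mem_erase S.2)))
    (fun T S => T.contract S) (fun T S => sign k T.1 S.1)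
    (fun T S => mulMap 𝒜 (degEq_up T.2.1 (Finset.mem_of_mem_erase S.2)
      (Finset.ne_of_mem_erase S.2)))
    (fun _ _ => sign_ne_zero) (fun _ _ => sign_ne_zero) (dMap_dMap 𝒜 q) 0 hstep z hz
  refine ⟨v, ?_⟩
  have h1 : z + (-1 : k) • dMap 𝒜 I (q + 1) v = 0 := DFinsupp.ext fun T => hv T trivial
  have h2 := congrArg (· + dMap 𝒜 I (q + 1) v) h1
  simp only [zero_add] at h2
  rw [add_assoc, add_comm ((-1 : k) • _), Contraction.add_neg_one_smul, add_zero] at h2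
  exact h2.symm

end

end TreeBar

theorem isConnected_operadOfAlgebra {k : Type u} {A : Type v} [Field k] [CommRing A] [Algebra k A]
    (𝒜 : ℕ → Submodule k A) [GradedAlgebra 𝒜] (h : IsConnectedGraded 𝒜) :
    (operadOfAlgebra 𝒜).IsConnected := by
  have hval : ∀ c : k, @Subtype.val A (· ∈ 𝒜 (1 - 1)) (c • (operadOfAlgebra 𝒜).one) =
      algebraMap k A c := fun c => (Algebra.algebraMap_eq_smul_one c).symm
  constructor
  · intro c c' hc
    refine h.1 ?_
    rw [← hval, ← hval]
    exact congrArg (Subtype.val (p := (· ∈ 𝒜 (1 - 1)))) hc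
  · intro x
    have hx : @Subtype.val A (· ∈ 𝒜 (1 - 1)) x ∈ (1 : Submodule k A) := by
      rw [← h.2]
      exact Subtype.property (p := (· ∈ 𝒜 (1 - 1))) x
    obtain ⟨c, hc⟩ := Submodule.mem_one.1 hx
    exact ⟨c, Subtype.ext (p := (· ∈ 𝒜 (1 - 1))) ((hval c).trans hc)⟩

theorem theorem4p3 {k A : Type*} [Field k] [CharZero k] [CommRing A] [Algebra k A]
    (𝒜 : ℕ → Submodule k A) [GradedAlgebra 𝒜] (hA : IsKoszulAlgebra 𝒜) :
    (operadOfAlgebra 𝒜).IsKoszul := by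
  refine ⟨isConnected_operadOfAlgebra 𝒜 hA.1, fun n q hn hq => ?_⟩
  cases q with
  | zero =>
    intro z
    have : IsEmpty (ShuffleOperad.TreeIndex (Finset.Icc 1 n) 0) := by
      refine ⟨fun T => ?_⟩
      have h1 := T.2.1.root_mem (by rw [Nat.card_Icc]; omega)
      rw [Finset.card_eq_zero.1 T.2.2] at h1
      exact Finset.notMem_empty _ h1
    exact ⟨0, DFinsupp.ext fun T => isEmptyElim T⟩
  | succ q =>
    simp only [HomologyVanishesAt]
    rw [TreeBar.barD_eq, TreeBar.barD_eq]
    exact TreeBar.exact_dMap 𝒜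
      (fun a m hm => GradedBar.koszulLift_of_bar_exact 𝒜 hA.2 hm a) _ q
      (by rw [Nat.card_Icc]; omega)
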